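/- Let $\Xi$ be a real vector space of dimension $2n$ with a symplectic form $[\![\cdot,\cdot]\!]$, and let $dY$ be the Lebesgue measure on $\Xi$ for which the symplectic Fourier transform $a\mapsto\int_\Xi e^{-i[\![\cdot,Y]\!]}a(Y)\,dY$ is unitary on $L^2(\Xi)$ (that is, $(2\pi)^{-n}dx\,d\xi$ in symplectic coordinates). Let $\Theta$ be a strongly continuous action of $\Xi$ by $*$-automorphisms of a (not necessarily unital or commutative) $C^*$-algebra $\mathcal A$. Let $\mathcal A^\infty$ be the space of all $f\in\mathcal A$ for which $X\mapsto\Theta_X(f)$ is $C^\infty$, with the Fréchet topology given by the norms of the derivatives of $X\mapsto\Theta_X(f)$ at $X=0$, and let $\mathfrak A^\infty$ denote the same Fréchet space with the involution of $\mathcal A$ and the Rieffel product $$f\,\#\,g=2^{2n}\int_\Xi\int_\Xi e^{2i[\![Y,Z]\!]}\,\Theta_Y(f)\,\Theta_Z(g)\,dY\,dZ\in\mathcal A^\infty ,$$ the integral being an oscillatory integral: the limit for $\varepsilon\to0+$ of the integrals with an additional factor $\chi(\varepsilon Y,\varepsilon Z)$, which exists and is the same for all $\chi\in\mathscr S(\Xi\times\Xi)$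 with $\chi(0)=1$. Let $\mathscr S(\Xi;\mathcal A^\infty)=\mathscr S(\Xi;\mathfrak A^\infty)$ be the space of smooth functions $\Xi\to\mathcal A^\infty$ all of whose derivatives decrease rapidly with respect to every seminorm of $\mathcal A^\infty$, with its usual topology. Define on it $$(F_1\,\square\,F_2)(X)=2^{2n}\int_\Xi\int_\Xi e^{-2i[\![A,B]\!]}\,F_1(X-A)\,\#\,F_2(X-B)\,dA\,dB,\qquad F^\square(X)=F(X)^*,$$ $$(G_1\diamond G_2)(X)=\int_\Xi e^{-\frac i2[\![X,Y]\!]}\,\Theta_{(Y-X)/2}[G_1(Y)]\,\Theta_{Y/2}[G_2(X-Y)]\,dY,\qquad G^\diamond(X)=G(-X)^*,$$ and let $$[M(F)](X)=\int_\Xi e^{-i[\![X,Y]\!]}\,\Theta_Y[F(Y)]\,dY ,$$ that is, $M=\mathfrak F\circ C$ with $[C(F)](X)=\Theta_X[F(X)]$ and $(\mathfrak F F)(X)=\int_\Xi e^{-i[\![X,Y]\!]}F(Y)\,dY$. Then the oscillatory integrals defining $\#$ exist and $\mathcal A^\infty\,\#\,\mathcal A^\infty\subset\mathcal A^\infty$,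 the integrals defining $\square$, $\diamond$, $M$ (and $M^{-1}$ below) converge absolutely in $\mathcal A$, the operations $\square,{}^\square,\diamond,{}^\diamond$ and $M$ map into the Schwartz space, $(\mathscr S(\Xi;\mathfrak A^\infty),\square,{}^\square)$ and $(\mathscr S(\Xi;\mathcal A^\infty),\diamond,{}^\diamond)$ are Fréchet $*$-algebras (complete metrizable locally convex spaces with a jointly continuous associative bilinear product and a continuous conjugate-linear anti-multiplicative involution), and $$M:(\mathscr S(\Xi;\mathfrak A^\infty),\square,{}^\square)\to(\mathscr S(\Xi;\mathcal A^\infty),\diamond,{}^\diamond)$$ is an isomorphism of Fréchet $*$-algebras (a linear homeomorphism that respects products and involutions), whose inverse is given by $$[M^{-1}(G)](X)=\int_\Xi e^{-i[\![X,Y]\!]}\,\Theta_{-X}[G(Y)]\,dY .$$ -/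

import Mathlib

open MeasureTheory Filter Topology
open scoped SchwartzMap ContDiff

noncomputable section

namespace RieffelCrossed

/-- A strongly continuous action `Θ` of the vector group `Ξ` by `*`-automorphisms of the
(possibly non-unital, non-commutative) C*-algebra `A`. -/
structure VectorAction (Ξ A : Type*) [NormedAddCommGroup Ξ] [NonUnitalCStarAlgebra A] where
  /-- the automorphism `Θ_X` -/
  aut : Ξ → A ≃⋆ₐ[ℂ] A
  aut_zero : ∀ f, aut 0 f = f
  aut_add : ∀ X Y f, aut (X + Y) f = aut X (aut Y f)
  continuous_orbit : ∀ f, Continuous fun X => aut X f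

variable {Ξ A : Type*} [NormedAddCommGroup Ξ] [NormedSpace ℝ Ξ] [NonUnitalCStarAlgebra A]

/-! ### Smooth vectors and vector-valued Schwartz functions -/

/-- The space `A^∞` of smooth vectors: those `f` whose orbit map `X ↦ Θ_X(f)` is `C^∞`. -/
def smoothVectors (Θ : VectorAction Ξ A) : Submodule ℂ A where
  carrier := {f | ContDiff ℝ ∞ fun X => Θ.aut X f}
  add_mem' := by
    intro f g hf hg
    have h : ContDiff ℝ ∞ ((fun X => Θ.aut X f) + fun X => Θ.aut X g) := ContDiff.add hf hg
    have e : (fun X => Θ.aut X (f + g)) = (fun X => Θ.aut X f) + fun X => Θ.aut X g := by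
      funext X
      exact map_add _ _ _
    rw [Set.mem_ofPred_eq, e]
    exact h
  zero_mem' := by
    simpa only [Set.mem_ofPred_eq, map_zero] using contDiff_const
  smul_mem' := by
    intro c f hf
    have h : ContDiff ℝ ∞ (c • fun X => Θ.aut X f) := ContDiff.const_smul c hf
    have e : (fun X => Θ.aut X (c • f)) = c • fun X => Θ.aut X f := by
      funext X
      exact map_smul _ _ _
    rw [Set.mem_ofPred_eq, e]
    exact h

/-- The `k`-th derivative at the origin of the orbit map, `f ↦ ∂^k [Θ_X(f)]_{X = 0}`, i.e. all the
`δ^α f` with `|α| = k` at once. The Fréchet topology of `A^∞` is the one defined by the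
seminorms `f ↦ ‖jet Θ k f‖`, `k ∈ ℕ`. -/
def jet (Θ : VectorAction Ξ A) (k : ℕ) :
    smoothVectors Θ →ₗ[ℂ] ContinuousMultilinearMap ℝ (fun _ : Fin k => Ξ) A where
  toFun f := iteratedFDeriv ℝ k (fun X => Θ.aut X (f : A)) 0
  map_add' := by
    intro f g
    have hf : ContDiff ℝ ∞ fun X => Θ.aut X (f : A) := f.2
    have hg : ContDiff ℝ ∞ fun X => Θ.aut X (g : A) := g.2
    have h := iteratedFDeriv_add_apply (𝕜 := ℝ) (i := k) (x := (0 : Ξ))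
      (hf.contDiffAt.of_le (by exact_mod_cast le_top))
      (hg.contDiffAt.of_le (by exact_mod_cast le_top))
    rw [← h]
    congr 1
    funext X
    simp
  map_smul' := by
    intro c f
    have hf : ContDiff ℝ ∞ fun X => Θ.aut X (f : A) := f.2
    have h := iteratedFDeriv_const_smul_apply (𝕜 := ℝ) (i := k) (x := (0 : Ξ)) (a := c)
      (hf.contDiffAt.of_le (by exact_mod_cast le_top))
    rw [RingHom.id_apply, ← h]
    congr 1
    funext X
    simp

/-- The functions `F : Ξ → A^∞` that are smooth and rapidly decreasing together with all their
derivatives, for all the seminorms of `A^∞`. The jets embed the Fréchet space `A^∞` as a closed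
subspace of a product of Banach spaces (of continuous `k`-linear maps), so `F` is smooth as an
`A^∞`-valued map iff every `jet Θ k ∘ F` is smooth, and then
`jet Θ k (∂^m F) = ∂^m (jet Θ k ∘ F)` by linearity and continuity of the jets. -/
def schwartzSubmodule (Θ : VectorAction Ξ A) : Submodule ℂ (Ξ → smoothVectors Θ) where
  carrier := {F | ∀ k : ℕ, ContDiff ℝ ∞ (fun X => jet Θ k (F X)) ∧
    ∀ N m : ℕ, ∃ C : ℝ, ∀ X : Ξ,
      ‖X‖ ^ N * ‖iteratedFDeriv ℝ m (fun X => jet Θ k (F X)) X‖ ≤ C}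
  add_mem' := by
    intro F G hF hG k
    let a : 𝓢(Ξ, ContinuousMultilinearMap ℝ (fun _ : Fin k => Ξ) A) :=
      ⟨fun X => jet Θ k (F X), (hF k).1, (hF k).2⟩
    let b : 𝓢(Ξ, ContinuousMultilinearMap ℝ (fun _ : Fin k => Ξ) A) :=
      ⟨fun X => jet Θ k (G X), (hG k).1, (hG k).2⟩
    have h : (fun X => jet Θ k ((F + G) X)) = (a + b : 𝓢(Ξ, _)) := by
      funext X
      exact map_add _ _ _
    rw [h]
    exact ⟨(a + b).smooth', (a + b).decay'⟩
  zero_mem' := by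
    intro k
    have h : (fun X => jet Θ k ((0 : Ξ → smoothVectors Θ) X)) =
        (0 : 𝓢(Ξ, ContinuousMultilinearMap ℝ (fun _ : Fin k => Ξ) A)) := by
      funext X
      simp
    rw [h]
    exact ⟨SchwartzMap.smooth' 0, SchwartzMap.decay' 0⟩
  smul_mem' := by
    intro c F hF k
    let a : 𝓢(Ξ, ContinuousMultilinearMap ℝ (fun _ : Fin k => Ξ) A) :=
      ⟨fun X => jet Θ k (F X), (hF k).1, (hF k).2⟩
    have h : (fun X => jet Θ k ((c • F) X)) = (c • a : 𝓢(Ξ, _)) := by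
      funext X
      exact (jet Θ k).map_smul c (F X)
    rw [h]
    exact ⟨(c • a).smooth', (c • a).decay'⟩

/-- The Schwartz space `𝒮(Ξ; A^∞)`. It is a type of its own, so that it carries its Fréchet
topology and not the one of pointwise convergence. -/
def SchwartzSpace (Θ : VectorAction Ξ A) : Type _ := ↥(schwartzSubmodule Θ)

instance (Θ : VectorAction Ξ A) : AddCommGroup (SchwartzSpace Θ) :=
  inferInstanceAs (AddCommGroup ↥(schwartzSubmodule Θ))

instance (Θ : VectorAction Ξ A) : Module ℂ (SchwartzSpace Θ) :=
  inferInstanceAs (Module ℂ ↥(schwartzSubmodule Θ))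

/-- An element of `𝒮(Ξ; A^∞)` as a function on `Ξ` with values in `A`. -/
def SchwartzSpace.eval {Θ : VectorAction Ξ A} (F : SchwartzSpace Θ) (X : Ξ) : A :=
  ((F.1 X : smoothVectors Θ) : A)

instance (Θ : VectorAction Ξ A) : CoeFun (SchwartzSpace Θ) (fun _ => Ξ → A) where
  coe F := F.eval

/-- `F ↦ jet Θ k ∘ F` as a Banach-space-valued Schwartz function. -/
def SchwartzSpace.toSchwartz {Θ : VectorAction Ξ A} (k : ℕ) (F : SchwartzSpace Θ) :
    𝓢(Ξ, ContinuousMultilinearMap ℝ (fun _ : Fin k => Ξ) A) where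
  toFun X := jet Θ k (F.1 X)
  smooth' := (F.2 k).1
  decay' := (F.2 k).2

/-- The topology of `𝒮(Ξ; A^∞)`: the one defined by the seminorms
`sup_X ‖X‖ ^ N * ‖∂^m (jet Θ k ∘ F) (X)‖`, `k, m, N ∈ ℕ`. -/
instance (Θ : VectorAction Ξ A) : TopologicalSpace (SchwartzSpace Θ) :=
  ⨅ k : ℕ, TopologicalSpace.induced (SchwartzSpace.toSchwartz k) inferInstance

/-! ### Fréchet `*`-algebras -/

/-- A complex Fréchet space: a complete metrizable locally convex topological vector space. -/
structure IsFrechetSpace (V : Type*) [AddCommGroup V] [Module ℂ V] [TopologicalSpace V] :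
    Prop where
  isTopologicalAddGroup : IsTopologicalAddGroup V
  continuousSMul : ContinuousSMul ℂ V
  locallyConvexSpace : LocallyConvexSpace ℝ V
  metrizableSpace : TopologicalSpace.MetrizableSpace V
  completeSpace : @CompleteSpace V (IsTopologicalAddGroup.rightUniformSpace V)

/-- The product `mul` and the involution `inv` turn the topological vector space `V` into a
(not necessarily unital) Fréchet `*`-algebra. -/
structure IsFrechetStarAlgebra (V : Type*) [AddCommGroup V] [Module ℂ V] [TopologicalSpace V]
    (mul : V → V → V) (inv : V → V) : Prop where
  isFrechetSpace : IsFrechetSpace V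
  add_mul : ∀ a b c, mul (a + b) c = mul a c + mul b c
  mul_add : ∀ a b c, mul a (b + c) = mul a b + mul a c
  smul_mul : ∀ (z : ℂ) a b, mul (z • a) b = z • mul a b
  mul_smul : ∀ (z : ℂ) a b, mul a (z • b) = z • mul a b
  mul_assoc : ∀ a b c, mul (mul a b) c = mul a (mul b c)
  continuous_mul : Continuous fun p : V × V => mul p.1 p.2
  inv_add : ∀ a b, inv (a + b) = inv a + inv b
  inv_smul : ∀ (z : ℂ) a, inv (z • a) = (starRingEnd ℂ z) • inv a
  inv_inv : ∀ a, inv (inv a) = a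
  inv_mul : ∀ a b, inv (mul a b) = mul (inv b) (inv a)
  continuous_inv : Continuous inv

/-! ### The normalized measure, the products and the canonical mappings -/

variable [FiniteDimensional ℝ Ξ] [MeasurableSpace Ξ] [BorelSpace Ξ]

/-- The Lebesgue measure `dY` on the symplectic space `(Ξ, σ)`, `dim Ξ = 2 n`, for which the
symplectic Fourier transform is `L²`-unitary (and hence an involution): it is
`(2π)^{-n} dx dξ` in Darboux coordinates. In an arbitrary basis `b` this is
`(2π)^{-n} |det (σ (b i) (b j))|^{1/2}` times the Lebesgue measure of `b`, independently of `b`. -/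
def sympMeasure (σ : LinearMap.BilinForm ℝ Ξ) : Measure Ξ :=
  ENNReal.ofReal ((2 * Real.pi) ^ (-(Module.finrank ℝ Ξ : ℝ) / 2) *
    √|(Matrix.of fun i j =>
      σ (Module.finBasis ℝ Ξ i) (Module.finBasis ℝ Ξ j)).det|) •
  (Module.finBasis ℝ Ξ).addHaar

/-- The oscillatory integral `∫∫ dY dZ e^{2 i σ(Y,Z)} a(Y,Z)` exists and is equal to `L`: for
every Schwartz cut-off `χ` with `χ(0) = 1`, the absolutely convergent integrals
`∫∫ dY dZ χ(εY,εZ) e^{2 i σ(Y,Z)} a(Y,Z)` tend to `L` when `ε → 0+`. -/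
def HasOscIntegral (σ : LinearMap.BilinForm ℝ Ξ) (a : Ξ × Ξ → A) (L : A) : Prop :=
  ∀ χ : 𝓢(Ξ × Ξ, ℂ), χ 0 = 1 →
    Tendsto (fun ε : ℝ => ∫ p : Ξ × Ξ,
        (χ (ε • p) * Complex.exp (2 * Complex.I * (σ p.1 p.2 : ℂ))) • a p
          ∂((sympMeasure σ).prod (sympMeasure σ)))
      (𝓝[>] 0) (𝓝 L)

open Classical in
/-- The value of the oscillatory integral (zero if it does not exist). -/
def oscIntegral (σ : LinearMap.BilinForm ℝ Ξ) (a : Ξ × Ξ → A) : A :=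
  if h : ∃ L, HasOscIntegral σ a L then h.choose else 0

/-- The Rieffel product
`f # g = 2^{2n} ∫∫ dY dZ e^{2 i σ(Y,Z)} Θ_Y(f) Θ_Z(g)`. -/
def rieffelMul (σ : LinearMap.BilinForm ℝ Ξ) (Θ : VectorAction Ξ A) (f g : A) : A :=
  (2 : ℂ) ^ Module.finrank ℝ Ξ • oscIntegral σ fun p => Θ.aut p.1 f * Θ.aut p.2 g

/-- The integrand `e^{-2 i σ(S,T)} F(X - S) # G(X - T)` of the product `□`. -/
def boxIntegrand (σ : LinearMap.BilinForm ℝ Ξ) (Θ : VectorAction Ξ A) (F G : Ξ → A) (X : Ξ)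
    (p : Ξ × Ξ) : A :=
  Complex.exp (-2 * Complex.I * (σ p.1 p.2 : ℂ)) • rieffelMul σ Θ (F (X - p.1)) (G (X - p.2))

/-- `(F □ G)(X) = 2^{2n} ∫∫ dS dT e^{-2 i σ(S,T)} F(X - S) # G(X - T)`. -/
def boxMul (σ : LinearMap.BilinForm ℝ Ξ) (Θ : VectorAction Ξ A) (F G : Ξ → A) (X : Ξ) : A :=
  (2 : ℂ) ^ Module.finrank ℝ Ξ •
    ∫ p, boxIntegrand σ Θ F G X p ∂((sympMeasure σ).prod (sympMeasure σ))

/-- `F^□(X) = F(X)^*`. -/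
def boxStar (F : Ξ → A) (X : Ξ) : A := star (F X)

/-- The cocycle `κ(X,Y) = exp(-(i/2) σ(X,Y))`. -/
def cocycle (σ : LinearMap.BilinForm ℝ Ξ) (X Y : Ξ) : ℂ :=
  Complex.exp (-(Complex.I / 2) * (σ X Y : ℂ))

/-- The integrand `κ(X,Y) Θ_{(Y-X)/2}[F(Y)] Θ_{Y/2}[G(X-Y)]` of the product `⋄`. -/
def diamondIntegrand (σ : LinearMap.BilinForm ℝ Ξ) (Θ : VectorAction Ξ A) (F G : Ξ → A)
    (X Y : Ξ) : A :=
  cocycle σ X Y • (Θ.aut ((1 / 2 : ℝ) • (Y - X)) (F Y) * Θ.aut ((1 / 2 : ℝ) • Y) (G (X - Y)))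

/-- `(F ⋄ G)(X) = ∫ dY κ(X,Y) Θ_{(Y-X)/2}[F(Y)] Θ_{Y/2}[G(X-Y)]`. -/
def diamondMul (σ : LinearMap.BilinForm ℝ Ξ) (Θ : VectorAction Ξ A) (F G : Ξ → A) (X : Ξ) : A :=
  ∫ Y, diamondIntegrand σ Θ F G X Y ∂(sympMeasure σ)

/-- `G^⋄(X) = G(-X)^*`. -/
def diamondStar (G : Ξ → A) (X : Ξ) : A := star (G (-X))

/-- `[C(F)](X) = Θ_X[F(X)]`. -/
def twist (Θ : VectorAction Ξ A) (F : Ξ → A) (X : Ξ) : A := Θ.aut X (F X)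

/-- The partial symplectic Fourier transform `(𝔉 F)(X) = ∫ dY e^{-i σ(X,Y)} F(Y)`. -/
def sympFourier (σ : LinearMap.BilinForm ℝ Ξ) (F : Ξ → A) (X : Ξ) : A :=
  ∫ Y, Complex.exp (-Complex.I * (σ X Y : ℂ)) • F Y ∂(sympMeasure σ)

/-- The canonical mapping `M = 𝔉 ∘ C`, i.e. `[M(F)](X) = ∫ dY e^{-i σ(X,Y)} Θ_Y[F(Y)]`. -/
def canonicalMap (σ : LinearMap.BilinForm ℝ Ξ) (Θ : VectorAction Ξ A) (F : Ξ → A) : Ξ → A :=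
  sympFourier σ (twist Θ F)

/-- The inverse mapping `[M⁻¹(G)](X) = ∫ dY e^{-i σ(X,Y)} Θ_{-X}[G(Y)]`. -/
def canonicalMapInv (σ : LinearMap.BilinForm ℝ Ξ) (Θ : VectorAction Ξ A) (G : Ξ → A)
    (X : Ξ) : A :=
  ∫ Y, Complex.exp (-Complex.I * (σ X Y : ℂ)) • Θ.aut (-X) (G Y) ∂(sympMeasure σ)

end RieffelCrossed

end

/-!
# The Rieffel product and the twisted crossed product of Schwartz functions

A Schwartz function `F` with values in the smooth vectors is encoded by the function of two
variables `(X, Y) ↦ Θ_Y(F(X))` (`SchwartzSpace.lift`). The derivatives of `F` in `X` and the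
generators of the action, applied to the values of `F`, act on it as partial derivatives. So a
family of functions is bounded in `𝒮(Ξ; A^∞)` if and only if all the derivatives of its lifts
decrease rapidly in `X`, uniformly in `Y` (`IsBoundedFamily.isSymbol_lift`, `exists_of_isSymbol`).
Such families of estimates are expressed by `IsSymbol`. Since `𝒮(Ξ; A^∞)` is a Fréchet space
(`SchwartzSpace.isFrechetSpace`), linear and bilinear mappings that preserve bounded families are
continuous (`continuous_of_isBoundedFamily`, `continuous_of_isBoundedFamily₂`).

* The twist `C` is the linear change of variables `(X, Y) ↦ (X, X + Y)` in the lift, and the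
  symplectic Fourier transform acts on each jet as the one of Banach-space-valued Schwartz functions,
  which is an involution for the chosen measure. So `M = 𝔉 ∘ C` is a linear homeomorphism
  (`exists_canonicalMap`).
* The product `⋄` is an integral with a parameter of products of two lifts, with a phase whose
  derivatives grow polynomially only (`exists_diamond`). Its associativity is Fubini's theorem and the
  cocycle identity (`diamondMul_assoc`).
* Oscillatory integrals of bounded symbols with a nondegenerate quadratic phase are made absolutely
  convergent by repeated integration by parts. This gives the limit of the regularized integrals, with
  a rate that is uniform over families (`exists_oscillatory_limit`). Applied to
  `(Y, Z) ↦ Θ_Y(f) Θ_Z(g)` and its derivatives along the diagonal, it shows that `f # g` exists and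
  is a smooth vector (`exists_hasOscIntegral_mem`); applied to the family of the values of two
  Schwartz functions, it gives the absolute convergence of `F □ G` (`exists_rieffelMul_bounds`).
* It remains to see that `F □ G = M⁻¹(M F ⋄ M G)`; then all properties of `□` follow from those of
  `⋄`. In the regularized fourfold integral for `F □ G`, a shift of the two variables of `#` by those
  of `□` separates the latter, and leaves the product of two Fourier transforms of cut-off copies
  of `C F` and `C G` (`integral_boxKernel`). These decrease rapidly, uniformly in the regularization,
  so it can be removed under the integral (`boxMul_eq_integral_boxLimit`). A scaling by two turns the
  remaining double integral into the one that defines `M⁻¹(M F ⋄ M G)`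
  (`canonicalMapInv_diamondMul`).
-/


noncomputable section

namespace RieffelCrossed

/-! ### Taylor series of limits and of parametric integrals -/

section Calculus

variable {E F : Type*} [NormedAddCommGroup E] [NormedSpace ℝ E]
  [NormedAddCommGroup F] [NormedSpace ℝ F]

/-- If all the derivatives of the smooth functions `u n` converge uniformly, then the limits of the
derivatives form a Taylor series of the limit. -/
theorem hasFTaylorSeriesUpTo_of_tendstoUniformly {ι : Type*} {l : Filter ι} [l.NeBot]
    {u : ι → E → F} {f : E → F} {P : E → FormalMultilinearSeries ℝ E F}
    (hu : ∀ n, ContDiff ℝ ∞ (u n)) (hf : ∀ x, (P x 0).curry0 = f x)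
    (hP : ∀ k : ℕ, TendstoUniformly (fun n x => iteratedFDeriv ℝ k (u n) x) (fun x => P x k) l) :
    HasFTaylorSeriesUpTo ∞ f P where
  zero_eq := hf
  fderiv m _ x := by
    refine hasFDerivAt_of_tendstoUniformly (l := l)
      (f := fun n x => iteratedFDeriv ℝ m (u n) x)
      (f' := fun n x => (iteratedFDeriv ℝ (m + 1) (u n) x).curryLeft)
      (g' := fun x => (P x m.succ).curryLeft) ?_ ?_ ?_ x
    · exact (continuousMultilinearCurryLeftEquiv ℝ (fun _ : Fin (m + 1) => E)
        F).isometry.uniformContinuous.comp_tendstoUniformly (hP (m + 1))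
    · intro n x
      exact (contDiff_iff_ftaylorSeries.1 (hu n)).fderiv m (by exact_mod_cast WithTop.coe_lt_top _) x
    · intro x
      exact (hP m).tendsto_at x
  cont m _ := by
    refine (hP m).continuous (Frequently.of_forall fun n => ?_)
    exact (hu n).continuous_iteratedFDeriv (by exact_mod_cast le_top)

/-- Differentiation under the integral sign, to all orders. -/
theorem hasFTaylorSeriesUpTo_integral [CompleteSpace F] {Ω : Type*} [MeasurableSpace Ω] {μ : Measure Ω}
    {g : E → Ω → F} (hg : ∀ z, ContDiff ℝ ∞ fun x => g x z)
    (hmeas : ∀ (k : ℕ) (x : E),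
      AEStronglyMeasurable (fun z => iteratedFDeriv ℝ k (fun x => g x z) x) μ)
    (hbound : ∀ (k : ℕ) (x₀ : E), ∃ b : Ω → ℝ, Integrable b μ ∧
      ∀ᶠ x in 𝓝 x₀, ∀ z, ‖iteratedFDeriv ℝ k (fun x => g x z) x‖ ≤ b z) :
    HasFTaylorSeriesUpTo ∞ (fun x => ∫ z, g x z ∂μ)
      (fun x k => ∫ z, iteratedFDeriv ℝ k (fun x => g x z) x ∂μ) := by
  have hint : ∀ (k : ℕ) (x : E),
      Integrable (fun z => iteratedFDeriv ℝ k (fun x => g x z) x) μ := by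
    intro k x
    obtain ⟨b, hb, h⟩ := hbound k x
    exact hb.mono' (hmeas k x) (ae_of_all _ h.self_of_nhds)
  have hder : ∀ (m : ℕ) (x : E), HasFDerivAt
      (fun y => ∫ z, iteratedFDeriv ℝ m (fun x => g x z) y ∂μ)
      (∫ z, iteratedFDeriv ℝ (m + 1) (fun x => g x z) x ∂μ).curryLeft x := by
    intro m x
    obtain ⟨b, hb, h⟩ := hbound (m + 1) x
    have e : (∫ z, iteratedFDeriv ℝ (m + 1) (fun x => g x z) x ∂μ).curryLeft =
        ∫ z, (iteratedFDeriv ℝ (m + 1) (fun x => g x z) x).curryLeft ∂μ := by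
      let L : ContinuousMultilinearMap ℝ (fun _ : Fin (m + 1) => E) F →L[ℝ]
          (E →L[ℝ] ContinuousMultilinearMap ℝ (fun _ : Fin m => E) F) :=
        (continuousMultilinearCurryLeftEquiv ℝ (fun _ : Fin (m + 1) => E)
          F).toContinuousLinearEquiv.toContinuousLinearMap
      exact (ContinuousLinearMap.integral_comp_comm (𝕜 := ℝ)
        (Fₗ := E →L[ℝ] ContinuousMultilinearMap ℝ (fun _ : Fin m => E) F) L (hint (m + 1) x)).symm
    rw [e]
    refine hasFDerivAt_integral_of_dominated_of_fderiv_le (bound := b) h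
      (F' := fun x z => (iteratedFDeriv ℝ (m + 1) (fun x => g x z) x).curryLeft)
      (Eventually.of_forall (hmeas m)) (hint m x) ?_ ?_ hb ?_
    · exact (continuousMultilinearCurryLeftEquiv ℝ (fun _ : Fin (m + 1) => E)
        F).continuous.comp_aestronglyMeasurable (hmeas (m + 1) x)
    · refine ae_of_all _ fun z y hy => ?_
      rw [ContinuousMultilinearMap.curryLeft_norm]
      exact hy z
    · refine ae_of_all _ fun z y _ => ?_
      exact (contDiff_iff_ftaylorSeries.1 (hg z)).fderiv m (by exact_mod_cast WithTop.coe_lt_top _) y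
  refine ⟨fun x => ?_, fun m _ x => hder m x, fun m _ => ?_⟩
  · let L : ContinuousMultilinearMap ℝ (fun _ : Fin 0 => E) F →L[ℝ] F :=
      (continuousMultilinearCurryFin0 ℝ E F).toContinuousLinearEquiv.toContinuousLinearMap
    exact (L.integral_comp_comm (hint 0 x)).symm
  · exact continuous_iff_continuousAt.2 fun x => (hder m x).continuousAt

/-- The space of Schwartz functions with values in a Banach space is complete. -/
instance instCompleteSpaceSchwartzMap [CompleteSpace F] : CompleteSpace 𝓢(E, F) := by
  have : (uniformity 𝓢(E, F)).IsCountablyGenerated :=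
    IsUniformAddGroup.uniformity_countably_generated
  refine UniformSpace.complete_of_cauchySeq_tendsto fun u hu => ?_
  have hC : ∀ (N m : ℕ) (ε : ℝ), 0 < ε → ∃ n₀, ∀ i ≥ n₀, ∀ j ≥ n₀, ∀ x : E,
      ‖x‖ ^ N * ‖iteratedFDeriv ℝ m (u i) x - iteratedFDeriv ℝ m (u j) x‖ < ε := by
    intro N m ε hε
    have hV : {p : 𝓢(E, F) × 𝓢(E, F) | SchwartzMap.seminorm ℝ N m (p.1 - p.2) < ε} ∈
        uniformity 𝓢(E, F) := by
      rw [uniformity_eq_comap_nhds_zero_swapped]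
      refine ⟨{f | SchwartzMap.seminorm ℝ N m f < ε}, ?_, fun p hp => hp⟩
      have := ((schwartz_withSeminorms ℝ E F).continuous_seminorm (N, m)).tendsto 0
      rw [map_zero] at this
      exact this (Iio_mem_nhds hε)
    obtain ⟨n₀, h⟩ := cauchySeq_iff.1 hu _ hV
    refine ⟨n₀, fun i hi j hj x => lt_of_le_of_lt ?_ (h i hi j hj)⟩
    have h2 := SchwartzMap.le_seminorm ℝ N m (u i - u j) x
    have h3 : iteratedFDeriv ℝ m (u i - u j : 𝓢(E, F)) x =
        iteratedFDeriv ℝ m (u i) x - iteratedFDeriv ℝ m (u j) x := by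
      have : ((u i - u j : 𝓢(E, F)) : E → F) = (u i : E → F) - u j := by
        ext y; simp
      rw [this]
      exact iteratedFDeriv_sub_apply (((u i).smooth m).contDiffAt) (((u j).smooth m).contDiffAt)
    rwa [h3] at h2
  have hUC : ∀ m : ℕ, UniformCauchySeqOn (fun n x => iteratedFDeriv ℝ m (u n) x) atTop Set.univ := by
    intro m
    rw [Metric.uniformCauchySeqOn_iff]
    intro ε hε
    obtain ⟨n₀, h⟩ := hC 0 m ε hε
    refine ⟨n₀, fun i hi j hj x _ => ?_⟩
    simpa [dist_eq_norm] using h i hi j hj x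
  choose P hP using fun (m : ℕ) (x : E) =>
    cauchySeq_tendsto_of_complete ((hUC m).cauchySeq (Set.mem_univ x))
  have hPU : ∀ m : ℕ, TendstoUniformly (fun n x => iteratedFDeriv ℝ m (u n) x) (P m) atTop := by
    intro m
    rw [← tendstoUniformlyOn_univ]
    exact (hUC m).tendstoUniformlyOn_of_tendsto fun x _ => hP m x
  have hT := hasFTaylorSeriesUpTo_of_tendstoUniformly (P := fun x m => P m x)
    (f := fun x => (P 0 x).curry0) (fun n => (u n).smooth') (fun x => rfl) hPU
  have hD : ∀ m x, iteratedFDeriv ℝ m (fun x => (P 0 x).curry0) x = P m x := fun m x =>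
    (hT.eq_iteratedFDeriv (by exact_mod_cast le_top) x).symm
  have hlim : ∀ (N m : ℕ) (ε : ℝ), 0 < ε → ∃ n₀, ∀ i ≥ n₀, ∀ x : E,
      ‖x‖ ^ N * ‖iteratedFDeriv ℝ m (u i) x - P m x‖ ≤ ε := by
    intro N m ε hε
    obtain ⟨n₀, h⟩ := hC N m ε hε
    refine ⟨n₀, fun i hi x => ?_⟩
    have ht : Tendsto (fun j => ‖x‖ ^ N * ‖iteratedFDeriv ℝ m (u i) x - iteratedFDeriv ℝ m (u j) x‖)
        atTop (𝓝 (‖x‖ ^ N * ‖iteratedFDeriv ℝ m (u i) x - P m x‖)) :=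
      ((tendsto_const_nhds.sub (hP m x)).norm).const_mul _
    exact le_of_tendsto ht (eventually_atTop.2 ⟨n₀, fun j hj => (h i hi j hj x).le⟩)
  let f : 𝓢(E, F) :=
    { toFun := fun x => (P 0 x).curry0
      smooth' := hT.contDiff
      decay' := by
        intro N m
        obtain ⟨n₀, h⟩ := hlim N m 1 one_pos
        obtain ⟨C, hC⟩ := (u n₀).decay' N m
        refine ⟨C + 1, fun x => ?_⟩
        rw [hD]
        calc ‖x‖ ^ N * ‖P m x‖
            ≤ ‖x‖ ^ N * (‖iteratedFDeriv ℝ m (u n₀) x‖ +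
                ‖iteratedFDeriv ℝ m (u n₀) x - P m x‖) := by
              gcongr
              exact norm_le_insert _ _
          _ ≤ C + 1 := by
              rw [mul_add]
              exact add_le_add (hC x) (h n₀ le_rfl x) }
  refine ⟨f, ((schwartz_withSeminorms ℝ E F).tendsto_nhds_atTop u f).2 ?_⟩
  rintro ⟨N, m⟩ ε hε
  obtain ⟨n₀, h⟩ := hlim N m (ε / 2) (half_pos hε)
  refine ⟨n₀, fun i hi => lt_of_le_of_lt ?_ (half_lt_self hε)⟩
  refine SchwartzMap.seminorm_le_bound ℝ N m _ (half_pos hε).le fun x => ?_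
  have h3 : iteratedFDeriv ℝ m (u i - f : 𝓢(E, F)) x = iteratedFDeriv ℝ m (u i) x - P m x := by
    have : ((u i - f : 𝓢(E, F)) : E → F) = (u i : E → F) - f := by
      ext y; simp
    rw [this, iteratedFDeriv_sub_apply (((u i).smooth m).contDiffAt) ((f.smooth m).contDiffAt)]
    congr 1
    exact hD m x
  rw [h3]
  exact h i hi x

end Calculus

/-! ### Weighted bounds on all derivatives -/

section Symbols

variable {ι κ W W' E F G : Type*} [NormedAddCommGroup W] [NormedSpace ℝ W]
  [NormedAddCommGroup W'] [NormedSpace ℝ W']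
  [NormedAddCommGroup E] [NormedSpace ℝ E] [NormedAddCommGroup F] [NormedSpace ℝ F]
  [NormedAddCommGroup G] [NormedSpace ℝ G]

/-- A family `u i : W → E` of smooth functions whose derivatives of order at most `n` are bounded
by multiples of the weights `ρ i`, with constants that depend on the order only and not on `i`. -/
structure IsSymbol (n : ℕ∞) (ρ : ι → W → ℝ) (u : ι → W → E) : Prop where
  smooth : ∀ i, ContDiff ℝ ∞ (u i)
  nonneg : ∀ i x, 0 ≤ ρ i x
  bound : ∀ k : ℕ, (k : ℕ∞) ≤ n →
    ∃ C : ℝ, 0 ≤ C ∧ ∀ i x, ‖iteratedFDeriv ℝ k (u i) x‖ ≤ C * ρ i x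

namespace IsSymbol

variable {n : ℕ∞} {ρ ρ' : ι → W → ℝ} {u v : ι → W → E}

lemma of_le (h : IsSymbol n ρ u) {m : ℕ∞} (hm : m ≤ n) : IsSymbol m ρ u :=
  ⟨h.smooth, h.nonneg, fun k hk => h.bound k (hk.trans hm)⟩

lemma of_forall_nat (h : ∀ m : ℕ, IsSymbol (m : ℕ∞) ρ u) : IsSymbol ⊤ ρ u :=
  ⟨(h 0).smooth, (h 0).nonneg, fun k _ => (h k).bound k le_rfl⟩

lemma mono (h : IsSymbol n ρ u) (C : ℝ) (h' : ∀ i x, ρ i x ≤ C * ρ' i x)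
    (h0 : ∀ i x, 0 ≤ ρ' i x) : IsSymbol n ρ' u := by
  refine ⟨h.smooth, h0, fun k hk => ?_⟩
  obtain ⟨K, hK, hb⟩ := h.bound k hk
  refine ⟨K * |C|, by positivity, fun i x => (hb i x).trans ?_⟩
  rw [mul_assoc]
  gcongr
  exact (h' i x).trans (mul_le_mul_of_nonneg_right (le_abs_self C) (h0 i x))

lemma norm_le (h : IsSymbol n ρ u) : ∃ C : ℝ, 0 ≤ C ∧ ∀ i x, ‖u i x‖ ≤ C * ρ i x := by
  obtain ⟨C, hC, hb⟩ := h.bound 0 (by simp)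
  exact ⟨C, hC, fun i x => by simpa using hb i x⟩

lemma continuous (h : IsSymbol n ρ u) (i : ι) : Continuous (u i) := (h.smooth i).continuous

lemma differentiable (h : IsSymbol n ρ u) (i : ι) : Differentiable ℝ (u i) :=
  (h.smooth i).differentiable (by simp)

lemma add (hu : IsSymbol n ρ u) (hv : IsSymbol n ρ v) :
    IsSymbol n ρ (fun i x => u i x + v i x) := by
  refine ⟨fun i => (hu.smooth i).add (hv.smooth i), hu.nonneg, fun k hk => ?_⟩
  obtain ⟨C, hC, hb⟩ := hu.bound k hk
  obtain ⟨C', hC', hb'⟩ := hv.bound k hk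
  refine ⟨C + C', by positivity, fun i x => ?_⟩
  have e : iteratedFDeriv ℝ k (fun x => u i x + v i x) x =
      iteratedFDeriv ℝ k (u i) x + iteratedFDeriv ℝ k (v i) x :=
    iteratedFDeriv_add_apply (((hu.smooth i).of_le (by exact_mod_cast le_top)).contDiffAt)
      (((hv.smooth i).of_le (by exact_mod_cast le_top)).contDiffAt)
  rw [e, add_mul]
  exact (norm_add_le _ _).trans (add_le_add (hb i x) (hb' i x))

lemma clm (hu : IsSymbol n ρ u) (L : E →L[ℝ] F) : IsSymbol n ρ (fun i x => L (u i x)) := by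
  refine ⟨fun i => L.contDiff.comp (hu.smooth i), hu.nonneg, fun k hk => ?_⟩
  obtain ⟨C, hC, hb⟩ := hu.bound k hk
  refine ⟨‖L‖ * C, by positivity, fun i x => ?_⟩
  have e : iteratedFDeriv ℝ k (fun x => L (u i x)) x =
      L.compContinuousMultilinearMap (iteratedFDeriv ℝ k (u i) x) :=
    L.iteratedFDeriv_comp_left ((hu.smooth i).contDiffAt) (by exact_mod_cast le_top)
  rw [e, mul_assoc]
  exact (L.norm_compContinuousMultilinearMap_le _).trans (by gcongr; exact hb i x)

lemma zero (h0 : ∀ i x, 0 ≤ ρ i x) : IsSymbol n ρ (fun (_ : ι) (_ : W) => (0 : E)) :=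
  ⟨fun _ => contDiff_const, h0, fun k _ => ⟨0, le_rfl, fun i x => by simp⟩⟩

lemma sum (h0 : ∀ i x, 0 ≤ ρ i x) {J : Type*} (s : Finset J) {w : J → ι → W → E}
    (hw : ∀ j ∈ s, IsSymbol n ρ (w j)) : IsSymbol n ρ (fun i x => ∑ j ∈ s, w j i x) := by
  classical
  induction s using Finset.induction_on with
  | empty => simpa using zero h0
  | insert a s ha ih =>
    simp only [Finset.sum_insert ha]
    exact (hw a (Finset.mem_insert_self _ _)).add
      (ih fun j hj => hw j (Finset.mem_insert_of_mem hj))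

/-- The Leibniz rule: weights multiply. -/
lemma bilin (B : E →L[ℝ] F →L[ℝ] G) {w : ι → W → F} (hu : IsSymbol n ρ u)
    (hw : IsSymbol n ρ' w) :
    IsSymbol n (fun i x => ρ i x * ρ' i x) (fun i x => B (u i x) (w i x)) := by
  refine ⟨fun i => (B.contDiff.comp (hu.smooth i)).clm_apply (hw.smooth i),
    fun i x => mul_nonneg (hu.nonneg i x) (hw.nonneg i x), fun k hk => ?_⟩
  choose! C hC hb using hu.bound
  choose! C' hC' hb' using hw.bound
  have hle : ∀ j ∈ Finset.range (k + 1), (j : ℕ∞) ≤ n ∧ ((k - j : ℕ) : ℕ∞) ≤ n := by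
    intro j hj
    have h1 : j ≤ k := Nat.lt_succ_iff.1 (Finset.mem_range.1 hj)
    exact ⟨le_trans (by exact_mod_cast h1) hk, le_trans (by exact_mod_cast Nat.sub_le k j) hk⟩
  refine ⟨‖B‖ * ∑ j ∈ Finset.range (k + 1), (k.choose j : ℝ) * C j * C' (k - j), ?_, ?_⟩
  · refine mul_nonneg (norm_nonneg B) (Finset.sum_nonneg fun j hj => ?_)
    have h1 := hC j (hle j hj).1
    have h2 := hC' (k - j) (hle j hj).2
    positivity
  · intro i x
    refine (B.norm_iteratedFDeriv_le_of_bilinear (hu.smooth i) (hw.smooth i) x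
      (by exact_mod_cast le_top)).trans ?_
    rw [mul_assoc, Finset.sum_mul]
    refine mul_le_mul_of_nonneg_left (Finset.sum_le_sum fun j hj => ?_) (norm_nonneg B)
    have h1 := hb j (hle j hj).1 i x
    have h2 := hb' (k - j) (hle j hj).2 i x
    calc (k.choose j : ℝ) * ‖iteratedFDeriv ℝ j (u i) x‖ * ‖iteratedFDeriv ℝ (k - j) (w i) x‖
        ≤ (k.choose j : ℝ) * (C j * ρ i x) * (C' (k - j) * ρ' i x) := by
          have := (norm_nonneg _).trans h1
          gcongr
      _ = _ := by ring

lemma fderiv (hu : IsSymbol (n + 1) ρ u) : IsSymbol n ρ (fun i => fderiv ℝ (u i)) := by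
  refine ⟨fun i => (hu.smooth i).fderiv_right (by simp), hu.nonneg, fun k hk => ?_⟩
  obtain ⟨C, hC, hb⟩ := hu.bound (k + 1) (by push_cast; gcongr)
  refine ⟨C, hC, fun i x => ?_⟩
  rw [norm_iteratedFDeriv_fderiv]
  exact hb i x

lemma of_fderiv (hs : ∀ i, ContDiff ℝ ∞ (u i)) {C : ℝ}
    (hb : ∀ i x, ‖u i x‖ ≤ C * ρ i x) (hu : IsSymbol n ρ (fun i => _root_.fderiv ℝ (u i))) :
    IsSymbol (n + 1) ρ u := by
  refine ⟨hs, hu.nonneg, fun k hk => ?_⟩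
  cases k with
  | zero =>
    refine ⟨|C|, abs_nonneg _, fun i x => ?_⟩
    rw [norm_iteratedFDeriv_zero]
    exact (hb i x).trans (mul_le_mul_of_nonneg_right (le_abs_self C) (hu.nonneg i x))
  | succ k =>
    obtain ⟨C, hC, hb⟩ := hu.bound k (by
      push_cast at hk
      exact (ENat.add_le_add_iff_right ENat.one_ne_top).1 hk)
    refine ⟨C, hC, fun i x => ?_⟩
    rw [← norm_iteratedFDeriv_fderiv]
    exact hb i x

/-- The derivatives themselves, as functions with values in multilinear maps. -/
lemma iteratedFDeriv (hu : IsSymbol ⊤ ρ u) (k : ℕ) :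
    IsSymbol ⊤ ρ (fun i => iteratedFDeriv ℝ k (u i)) := by
  induction k with
  | zero =>
    have := hu.clm (continuousMultilinearCurryFin0 ℝ W
      E).symm.toContinuousLinearEquiv.toContinuousLinearMap
    exact this
  | succ k ih =>
    have := (fderiv (n := ⊤) ih).clm ((continuousMultilinearCurryLeftEquiv ℝ
      (fun _ : Fin (k + 1) => W) E).symm.toContinuousLinearEquiv.toContinuousLinearMap)
    exact this

/-- Change of variables by a uniformly bounded family of affine maps. -/
lemma comp_affine (hu : IsSymbol n ρ u) (f : κ → ι) (L : κ → W' →L[ℝ] W) (a : κ → W) {K : ℝ}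
    (hL : ∀ j, ‖L j‖ ≤ K) :
    IsSymbol n (fun j x => ρ (f j) (L j x + a j)) (fun j x => u (f j) (L j x + a j)) := by
  have hs : ∀ j, ContDiff ℝ ∞ fun y => u (f j) (y + a j) := fun j =>
    (hu.smooth (f j)).comp (contDiff_id.add contDiff_const)
  refine ⟨fun j => (hs j).comp (L j).contDiff, fun j x => hu.nonneg _ _, fun k hk => ?_⟩
  obtain ⟨C, hC, hb⟩ := hu.bound k hk
  refine ⟨C * |K| ^ k, by positivity, fun j x => ?_⟩
  have e : _root_.iteratedFDeriv ℝ k (fun x => u (f j) (L j x + a j)) x =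
      (_root_.iteratedFDeriv ℝ k (fun y => u (f j) (y + a j)) (L j x)).compContinuousLinearMap
        fun _ => L j :=
    (L j).iteratedFDeriv_comp_right (hs j) x (by exact_mod_cast le_top)
  rw [e, iteratedFDeriv_comp_add_right]
  refine (ContinuousMultilinearMap.norm_compContinuousLinearMap_le _ _).trans ?_
  rw [Finset.prod_const, Finset.card_univ, Fintype.card_fin]
  have h1 := hb (f j) (L j x + a j)
  calc _ ≤ C * ρ (f j) (L j x + a j) * |K| ^ k := by
        have := (norm_nonneg _).trans h1
        gcongr
        exact (hL j).trans (le_abs_self K)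
    _ = _ := by ring

lemma comp_clm (hu : IsSymbol n ρ u) (L : W' →L[ℝ] W) :
    IsSymbol n (fun i x => ρ i (L x)) (fun i x => u i (L x)) := by
  simpa using hu.comp_affine id (fun _ => L) (fun _ => 0) (fun _ => le_rfl)

lemma reindex (hu : IsSymbol n ρ u) (f : κ → ι) : IsSymbol n (fun j => ρ (f j)) (fun j => u (f j)) :=
  ⟨fun j => hu.smooth _, fun j => hu.nonneg _, fun k hk => by
    obtain ⟨C, hC, hb⟩ := hu.bound k hk
    exact ⟨C, hC, fun j => hb _⟩⟩

/-- A factor that depends on the index of the family only. -/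
lemma const_smul (hu : IsSymbol n ρ u) (c : ι → ℝ) :
    IsSymbol n (fun i x => |c i| * ρ i x) (fun i x => c i • u i x) := by
  refine ⟨fun i => contDiff_const.smul (hu.smooth i),
    fun i x => mul_nonneg (abs_nonneg _) (hu.nonneg i x), fun k hk => ?_⟩
  obtain ⟨C, hC, hb⟩ := hu.bound k hk
  refine ⟨C, hC, fun i x => ?_⟩
  have e : _root_.iteratedFDeriv ℝ k (fun x => c i • u i x) x =
      c i • _root_.iteratedFDeriv ℝ k (u i) x :=
    iteratedFDeriv_const_smul_apply (((hu.smooth i).of_le (by exact_mod_cast le_top)).contDiffAt)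
  rw [e, norm_smul, Real.norm_eq_abs]
  calc _ ≤ |c i| * (C * ρ i x) := by gcongr; exact hb i x
    _ = _ := by ring

/-- Inverses of elliptic symbols. -/
lemma inv {q : ι → W → ℝ} (hq : IsSymbol ⊤ ρ q) {c : ℝ} (hc : 0 < c)
    (hρ : ∀ i x, 0 < ρ i x) (hlow : ∀ i x, c * ρ i x ≤ q i x) :
    IsSymbol ⊤ (fun i x => (ρ i x)⁻¹) (fun i x => (q i x)⁻¹) := by
  have hpos : ∀ i x, 0 < q i x := fun i x => (mul_pos hc (hρ i x)).trans_le (hlow i x)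
  have hs : ∀ i, ContDiff ℝ ∞ fun x => (q i x)⁻¹ := fun i =>
    (hq.smooth i).inv fun x => (hpos i x).ne'
  have h0 : ∀ i x, 0 ≤ (ρ i x)⁻¹ := fun i x => (inv_pos.2 (hρ i x)).le
  have hb : ∀ i x, ‖(q i x)⁻¹‖ ≤ c⁻¹ * (ρ i x)⁻¹ := by
    intro i x
    rw [Real.norm_of_nonneg (inv_pos.2 (hpos i x)).le, ← mul_inv]
    exact inv_anti₀ (mul_pos hc (hρ i x)) (hlow i x)
  refine of_forall_nat fun m => ?_
  induction m with
  | zero =>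
    refine ⟨hs, h0, fun k hk => ⟨c⁻¹, by positivity, fun i x => ?_⟩⟩
    obtain rfl : k = 0 := by simpa using hk
    rw [norm_iteratedFDeriv_zero]
    exact hb i x
  | succ m ih =>
    push_cast
    refine of_fderiv hs hb ?_
    have h1 := bilin (ContinuousLinearMap.lsmul ℝ ℝ : ℝ →L[ℝ] (W →L[ℝ] ℝ) →L[ℝ] (W →L[ℝ] ℝ))
      (bilin (ContinuousLinearMap.mul ℝ ℝ) ih ih) ((fderiv (n := ⊤) hq).of_le le_top)
    have h2 := (h1.const_smul fun _ => (-1 : ℝ)).mono (ρ' := fun i x => (ρ i x)⁻¹) 1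
      (fun i x => by
        have := (hρ i x).ne'
        simp only [abs_neg, abs_one, one_mul]
        apply le_of_eq
        field_simp) h0
    convert h2 using 2 with i
    ext1 x
    have h3 := ((hasDerivAt_inv (hpos i x).ne').comp_hasFDerivAt x
      (hq.differentiable i x).hasFDerivAt).fderiv
    refine h3.trans ?_
    ext y
    simp [pow_two]

lemma const {c : ι → E} {K : ℝ} (h0 : ∀ i x, 0 ≤ ρ i x) (hc : ∀ i x, ‖c i‖ ≤ K * ρ i x) :
    IsSymbol n ρ (fun i (_ : W) => c i) := by
  refine ⟨fun _ => contDiff_const, h0, fun k _ => ?_⟩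
  rcases Nat.eq_zero_or_pos k with rfl | hk
  · refine ⟨|K|, abs_nonneg _, fun i x => ?_⟩
    rw [norm_iteratedFDeriv_zero]
    exact (hc i x).trans (mul_le_mul_of_nonneg_right (le_abs_self K) (h0 i x))
  · refine ⟨0, le_rfl, fun i x => ?_⟩
    rw [iteratedFDeriv_const_of_ne hk.ne']
    simp

lemma linear (L : W →L[ℝ] E) : IsSymbol ⊤ (fun (_ : ι) x => 1 + ‖x‖) (fun _ x => L x) := by
  have h : IsSymbol (⊤ + 1) (fun (_ : ι) (x : W) => 1 + ‖x‖) (fun _ x => L x) := by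
    refine of_fderiv (C := ‖L‖) (fun _ => L.contDiff) (fun _ x => (L.le_opNorm x).trans ?_) ?_
    · gcongr
      linarith
    · have : (fun (_ : ι) => _root_.fderiv ℝ fun x => L x) = fun _ _ => L := by
        funext i x
        exact L.fderiv
      rw [this]
      refine const (K := ‖L‖) (fun _ _ => by positivity) fun i x => ?_
      exact le_mul_of_one_le_right (norm_nonneg _) (by linarith [norm_nonneg x])
  exact h.of_le le_top

lemma of_schwartz (f : 𝓢(W, E)) (N : ℕ) :
    IsSymbol ⊤ (fun (_ : ι) x => ((1 + ‖x‖) ^ N)⁻¹) (fun _ => f) := by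
  refine ⟨fun _ => f.smooth', fun _ x => by positivity, fun k _ => ?_⟩
  have h := fun x => SchwartzMap.one_add_le_sup_seminorm_apply (𝕜 := ℝ) (m := (N, k)) le_rfl le_rfl f x
  refine ⟨_, (by positivity : (0 : ℝ) ≤ _).trans (h 0), fun i x => ?_⟩
  rw [← div_eq_mul_inv, le_div_iff₀ (by positivity), mul_comm]
  exact h x

/-- Integrals over a parameter of symbols are symbols. -/
lemma integral [CompleteSpace E] {Y : Type*} [NormedAddCommGroup Y] [NormedSpace ℝ Y]
    [FiniteDimensional ℝ Y] [MeasurableSpace Y] [BorelSpace Y] {μ : Measure Y}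
    {g : ι → W × Y → E} {r : Y → ℝ} (hg : IsSymbol ⊤ (fun i p => ρ i p.1 * r p.2) g)
    (hρ : ∀ i, Continuous (ρ i)) (h0 : ∀ i x, 0 ≤ ρ i x) (hr : Integrable r μ) :
    IsSymbol ⊤ ρ (fun i x => ∫ y, g i (x, y) ∂μ) := by
  have hin : ‖ContinuousLinearMap.inl ℝ W Y‖ ≤ 1 := ContinuousLinearMap.norm_inl_le_one ℝ W Y
  have hs : ∀ i y, ContDiff ℝ ∞ fun x => g i (x, y) := fun i y =>
    (hg.smooth i).comp (contDiff_id.prodMk contDiff_const)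
  have hD : ∀ i (k : ℕ) x y, _root_.iteratedFDeriv ℝ k (fun x => g i (x, y)) x =
      (_root_.iteratedFDeriv ℝ k (g i) (x, y)).compContinuousLinearMap
        fun _ => ContinuousLinearMap.inl ℝ W Y := by
    intro i k x y
    have e : (fun x => g i (x, y)) =
        (fun p => g i (p + (0, y))) ∘ ContinuousLinearMap.inl ℝ W Y := by
      funext x
      simp
    have hs' : ContDiff ℝ ∞ fun p => g i (p + (0, y)) :=
      (hg.smooth i).comp (contDiff_id.add contDiff_const)
    rw [e, (ContinuousLinearMap.inl ℝ W Y).iteratedFDeriv_comp_right hs' x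
      (by exact_mod_cast le_top),
      iteratedFDeriv_comp_add_right]
    simp
  have hDn : ∀ i (k : ℕ) x y, ‖_root_.iteratedFDeriv ℝ k (fun x => g i (x, y)) x‖ ≤
      ‖_root_.iteratedFDeriv ℝ k (g i) (x, y)‖ := by
    intro i k x y
    rw [hD]
    refine (ContinuousMultilinearMap.norm_compContinuousLinearMap_le _ _).trans ?_
    refine mul_le_of_le_one_right (norm_nonneg _) ?_
    exact Finset.prod_le_one (fun _ _ => norm_nonneg _) fun _ _ => hin
  have hb : ∀ k : ℕ, ∃ C : ℝ, 0 ≤ C ∧ ∀ i x y,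
      ‖_root_.iteratedFDeriv ℝ k (fun x => g i (x, y)) x‖ ≤ C * (ρ i x * |r y|) := by
    intro k
    obtain ⟨C, hC, hb⟩ := hg.bound k le_top
    refine ⟨C, hC, fun i x y => (hDn i k x y).trans ((hb i (x, y)).trans ?_)⟩
    gcongr
    exacts [h0 i x, le_abs_self _]
  have hT : ∀ i, HasFTaylorSeriesUpTo ∞ (fun x => ∫ y, g i (x, y) ∂μ)
      (fun x k => ∫ y, _root_.iteratedFDeriv ℝ k (fun x => g i (x, y)) x ∂μ) := by
    intro i
    refine hasFTaylorSeriesUpTo_integral (hs i) (fun k x => ?_) fun k x₀ => ?_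
    · have e : (fun y => _root_.iteratedFDeriv ℝ k (fun x => g i (x, y)) x) = fun y =>
          ContinuousMultilinearMap.compContinuousLinearMapL
            (fun _ : Fin k => ContinuousLinearMap.inl ℝ W Y)
            (_root_.iteratedFDeriv ℝ k (g i) (x, y)) := by
        funext y
        exact hD i k x y
      rw [e]
      exact ((ContinuousLinearMap.continuous _).comp
        (((hg.smooth i).continuous_iteratedFDeriv (by exact_mod_cast le_top)).comp
          (Continuous.prodMk_right x))).aestronglyMeasurable
    · obtain ⟨C, hC, hb⟩ := hb k
      refine ⟨fun y => C * ((ρ i x₀ + 1) * |r y|), (hr.abs.const_mul _).const_mul _, ?_⟩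
      filter_upwards [((hρ i).tendsto x₀).eventually (gt_mem_nhds (lt_add_one (ρ i x₀)))]
        with x hx y
      refine (hb i x y).trans ?_
      gcongr
  refine ⟨fun i => (hT i).contDiff, h0, fun k _ => ?_⟩
  obtain ⟨C, hC, hb⟩ := hb k
  refine ⟨C * ∫ y, |r y| ∂μ, by positivity, fun i x => ?_⟩
  rw [← (hT i).eq_iteratedFDeriv (by exact_mod_cast le_top) x]
  calc ‖∫ y, _root_.iteratedFDeriv ℝ k (fun x => g i (x, y)) x ∂μ‖
      ≤ ∫ y, C * (ρ i x * |r y|) ∂μ :=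
        norm_integral_le_of_norm_le ((hr.abs.const_mul _).const_mul _) (ae_of_all _ (hb i x))
    _ = _ := by
        rw [integral_const_mul, integral_const_mul]
        ring

end IsSymbol

end Symbols

/-! ### Oscillatory integrals with a nondegenerate quadratic phase -/

section Oscillatory

variable {ι V E : Type*} [NormedAddCommGroup V] [NormedSpace ℝ V]
  [NormedAddCommGroup E] [NormedSpace ℂ E]

/-- The oscillating factor `e^{i Q(p,p)/2}`. -/
def quadPhase (Q : V →L[ℝ] V →L[ℝ] ℝ) (p : V) : ℂ :=
  Complex.exp (Complex.I * ((Q p p / 2 : ℝ) : ℂ))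

variable {Q : V →L[ℝ] V →L[ℝ] ℝ}

lemma norm_quadPhase (p : V) : ‖quadPhase Q p‖ = 1 := by
  rw [quadPhase, mul_comm, Complex.norm_exp_ofReal_mul_I]

lemma contDiff_quadPhase : ContDiff ℝ ∞ (quadPhase Q) := by
  have h1 : ContDiff ℝ ∞ fun p : V => Q p p / 2 :=
    (Q.contDiff.clm_apply contDiff_id).div_const _
  have h2 : ContDiff ℝ ∞ fun p : V => ((Q p p / 2 : ℝ) : ℂ) := Complex.ofRealCLM.contDiff.comp h1
  exact (contDiff_const.mul h2).cexp

lemma fderiv_quadPhase (hQ : ∀ p q, Q p q = Q q p) (p v : V) :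
    fderiv ℝ (quadPhase Q) p v = (Complex.I * (Q p v : ℂ)) * quadPhase Q p := by
  have h1 : HasFDerivAt (fun p : V => Q p p) _ p := Q.hasFDerivAt.clm_apply (hasFDerivAt_id p)
  have h2 := Complex.ofRealCLM.hasFDerivAt.comp p (h1.const_mul (2⁻¹ : ℝ))
  have h3 := (h2.const_mul Complex.I).cexp
  have e : quadPhase Q = fun p => Complex.exp
      (Complex.I * (Complex.ofRealCLM ∘ fun y => 2⁻¹ * (Q y) y) p) := by
    funext p
    simp [quadPhase, div_eq_inv_mul]
  rw [e, h3.fderiv]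
  simp [hQ v p]
  ring

/-- The difference quotients `ε⁻¹ (χ(εp) - 1)` of a cut-off with `χ(0) = 1` are symbols of order
one, uniformly in `ε ∈ (0,1]`. -/
lemma isSymbol_cutoff (χ : 𝓢(V, ℂ)) (h1 : χ 0 = 1) :
    IsSymbol ⊤ (fun (_ : Set.Ioc (0 : ℝ) 1) (p : V) => 1 + ‖p‖)
      (fun ε p => (ε : ℝ)⁻¹ • (χ ((ε : ℝ) • p) - 1)) := by
  have hd : IsSymbol ⊤ (fun (_ : Set.Ioc (0 : ℝ) 1) (_ : V) => (1 : ℝ)) fun _ => fderiv ℝ χ :=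
    IsSymbol.fderiv (n := ⊤) ((IsSymbol.of_schwartz χ 0).mono 1 (by simp) (by simp))
  have hL : ∀ ε : Set.Ioc (0 : ℝ) 1, ‖(ε : ℝ) • ContinuousLinearMap.id ℝ V‖ ≤ 1 := by
    intro ε
    rw [norm_smul, Real.norm_of_nonneg ε.2.1.le]
    exact mul_le_one₀ ε.2.2 (norm_nonneg _) ContinuousLinearMap.norm_id_le
  obtain ⟨C, hC, hb⟩ := hd.norm_le
  have hder : ∀ (ε : Set.Ioc (0 : ℝ) 1) (p : V),
      HasFDerivAt (fun p => (ε : ℝ)⁻¹ • (χ ((ε : ℝ) • p) - 1)) (fderiv ℝ χ ((ε : ℝ) • p)) p := by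
    intro ε p
    have h2 : HasFDerivAt (fun p => χ ((ε : ℝ) • p))
        ((fderiv ℝ χ ((ε : ℝ) • p)).comp ((ε : ℝ) • ContinuousLinearMap.id ℝ V)) p :=
      (χ.differentiable ((ε : ℝ) • p)).hasFDerivAt.comp p
        ((hasFDerivAt_id p).const_smul (ε : ℝ))
    have h3 : HasFDerivAt (fun p => (ε : ℝ)⁻¹ • (χ ((ε : ℝ) • p) - 1)) _ p :=
      (h2.sub_const 1).const_smul (ε : ℝ)⁻¹
    have e : fderiv ℝ χ ((ε : ℝ) • p) = (ε : ℝ)⁻¹ •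
        (fderiv ℝ χ ((ε : ℝ) • p)).comp ((ε : ℝ) • ContinuousLinearMap.id ℝ V) := by
      have : (ε : ℝ) ≠ 0 := ε.2.1.ne'
      ext v
      simp [this]
    rw [e]
    exact h3
  have hdx : IsSymbol ⊤ (fun (_ : Set.Ioc (0 : ℝ) 1) (_ : V) => (1 : ℝ))
      fun ε p => fderiv ℝ χ ((ε : ℝ) • p) := by
    have := hd.comp_affine id (fun ε : Set.Ioc (0 : ℝ) 1 =>
      (ε : ℝ) • ContinuousLinearMap.id ℝ V) (fun _ => 0) hL
    simpa using this
  have hs : ∀ ε : Set.Ioc (0 : ℝ) 1, ContDiff ℝ ∞ fun p => (ε : ℝ)⁻¹ • (χ ((ε : ℝ) • p) - 1) :=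
    fun ε => ContDiff.smul (f := fun _ => (ε : ℝ)⁻¹) (g := fun p => χ ((ε : ℝ) • p) - 1)
      contDiff_const ((χ.smooth'.comp (contDiff_id.const_smul (ε : ℝ))).sub contDiff_const)
  have h : IsSymbol (⊤ + 1) (fun (_ : Set.Ioc (0 : ℝ) 1) (p : V) => 1 + ‖p‖)
      (fun ε p => (ε : ℝ)⁻¹ • (χ ((ε : ℝ) • p) - 1)) := by
    refine IsSymbol.of_fderiv (C := C) hs (fun ε p => ?_) ?_
    · have h4 := Convex.norm_image_sub_le_of_norm_hasFDerivWithin_le (𝕜 := ℝ) (C := C)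
        (s := Set.univ) (fun x _ => (hder ε x).hasFDerivWithinAt)
        (fun x _ => by simpa using hb ε ((ε : ℝ) • x)) convex_univ (Set.mem_univ 0)
        (Set.mem_univ p)
      simp only [smul_zero, h1, sub_self, sub_zero] at h4
      exact h4.trans (by gcongr; linarith)
    · have e : (fun ε : Set.Ioc (0 : ℝ) 1 => fderiv ℝ
          fun p => (ε : ℝ)⁻¹ • (χ ((ε : ℝ) • p) - 1)) =
            fun (ε : Set.Ioc (0 : ℝ) 1) p => fderiv ℝ χ ((ε : ℝ) • p) := by
        funext ε p
        exact (hder ε p).fderiv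
      rw [e]
      refine hdx.mono 1 (fun _ p => ?_) fun _ p => by positivity
      linarith [norm_nonneg p]
  exact h.of_le le_top

variable [FiniteDimensional ℝ V]

/-- The function `1 + ∑ⱼ (∂ⱼ φ)²` for the phase `φ(p) = Q(p,p)/2` and the derivatives along a
basis. -/
def ellipticWeight (Q : V →L[ℝ] V →L[ℝ] ℝ) (p : V) : ℝ :=
  1 + ∑ j, (Q p (Module.finBasis ℝ V j)) ^ 2

/-- The formal transpose `T u = u / w + i ∑ⱼ ∂ⱼ ((∂ⱼ φ / w) u)`, `w = 1 + ∑ⱼ (∂ⱼ φ)²`, of the first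
order differential operator `w⁻¹ (1 - i ∑ⱼ (∂ⱼ φ) ∂ⱼ)` that fixes `e^{iφ}`. -/
def oscOp (Q : V →L[ℝ] V →L[ℝ] ℝ) (u : V → E) (p : V) : E :=
  (ellipticWeight Q p)⁻¹ • u p + Complex.I • ∑ j, fderiv ℝ
    (fun q => (Q q (Module.finBasis ℝ V j) * (ellipticWeight Q q)⁻¹) • u q) p
      (Module.finBasis ℝ V j)

lemma ellipticWeight_pos (p : V) : 0 < ellipticWeight Q p := by
  have : 0 ≤ ∑ j, (Q p (Module.finBasis ℝ V j)) ^ 2 := Finset.sum_nonneg fun _ _ => sq_nonneg _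
  rw [ellipticWeight]
  positivity

lemma exists_le_ellipticWeight (hQ : ∀ p, (∀ v, Q p v = 0) → p = 0) :
    ∃ c : ℝ, 0 < c ∧ ∀ p : V, c * (1 + ‖p‖) ^ 2 ≤ ellipticWeight Q p := by
  let L : V →ₗ[ℝ] (Fin (Module.finrank ℝ V) → ℝ) :=
    LinearMap.pi fun j => ((Q.flip (Module.finBasis ℝ V j) : V →L[ℝ] ℝ) : V →ₗ[ℝ] ℝ)
  have hL : LinearMap.ker L = ⊥ := by
    rw [LinearMap.ker_eq_bot']
    intro p hp
    refine hQ p fun v => ?_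
    have h1 : (Q p : V →ₗ[ℝ] ℝ) = 0 := (Module.finBasis ℝ V).ext fun j => congrFun hp j
    exact LinearMap.congr_fun h1 v
  obtain ⟨K, hK, h⟩ := L.exists_antilipschitzWith hL
  have hK' : (0 : ℝ) < K := by exact_mod_cast hK
  have hle : ∀ p : V, ‖p‖ ^ 2 ≤ (K : ℝ) ^ 2 * (ellipticWeight Q p - 1) := by
    intro p
    have h1 : ‖p‖ ≤ K * ‖L p‖ := by
      have := h.le_mul_dist p 0
      simpa [dist_eq_norm] using this
    have h2 : ‖L p‖ ^ 2 ≤ ellipticWeight Q p - 1 := by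
      have h3 : ‖L p‖ ≤ √(ellipticWeight Q p - 1) := by
        refine (pi_norm_le_iff_of_nonneg (Real.sqrt_nonneg _)).2 fun j => Real.abs_le_sqrt ?_
        rw [ellipticWeight, add_sub_cancel_left]
        exact Finset.single_le_sum (f := fun j => (Q p (Module.finBasis ℝ V j)) ^ 2)
          (fun _ _ => sq_nonneg _) (Finset.mem_univ j)
      have h4 : 0 ≤ ellipticWeight Q p - 1 := by
        rw [ellipticWeight, add_sub_cancel_left]
        exact Finset.sum_nonneg fun _ _ => sq_nonneg _
      calc ‖L p‖ ^ 2 ≤ √(ellipticWeight Q p - 1) ^ 2 := by gcongr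
        _ = _ := Real.sq_sqrt h4
    calc ‖p‖ ^ 2 ≤ (K * ‖L p‖) ^ 2 := by gcongr
      _ = K ^ 2 * ‖L p‖ ^ 2 := by ring
      _ ≤ _ := by gcongr
  refine ⟨(2 * (1 + (K : ℝ) ^ 2))⁻¹, by positivity, fun p => ?_⟩
  rw [inv_mul_le_iff₀ (by positivity)]
  have h1 := hle p
  have h2 : 0 ≤ ellipticWeight Q p - 1 := by
    rw [ellipticWeight, add_sub_cancel_left]
    exact Finset.sum_nonneg fun _ _ => sq_nonneg _
  nlinarith [sq_nonneg (1 - ‖p‖), sq_nonneg (K : ℝ)]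

lemma isSymbol_ellipticWeight_inv (hQ : ∀ p, (∀ v, Q p v = 0) → p = 0) :
    IsSymbol ⊤ (fun (_ : ι) p => (1 + ‖p‖) ^ (-2 : ℤ)) fun _ p => (ellipticWeight Q p)⁻¹ := by
  obtain ⟨c, hc, h⟩ := exists_le_ellipticWeight hQ
  have h1 : IsSymbol ⊤ (fun (_ : ι) (p : V) => (1 + ‖p‖) ^ 2) fun _ p => ellipticWeight Q p := by
    have h0 : ∀ (_ : ι) (p : V), 0 ≤ (1 + ‖p‖) ^ 2 := fun _ _ => by positivity
    refine (IsSymbol.const (K := 1) h0 fun _ p => ?_).add (IsSymbol.sum h0 _ fun j _ => ?_)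
    · rw [norm_one, one_mul]
      exact one_le_pow₀ (by linarith [norm_nonneg p])
    · have h2 := IsSymbol.linear (ι := ι) (Q.flip (Module.finBasis ℝ V j))
      simpa [pow_two] using h2.bilin (ContinuousLinearMap.mul ℝ ℝ) h2
  have h2 := h1.inv hc (fun _ _ => by positivity) fun _ p => h p
  have e : (fun (_ : ι) (p : V) => (1 + ‖p‖) ^ (-2 : ℤ)) = fun _ p => ((1 + ‖p‖) ^ 2)⁻¹ := by
    funext _ p
    rw [zpow_neg]
    rfl
  rw [e]
  exact h2

lemma isSymbol_oscCoeff (hQ : ∀ p, (∀ v, Q p v = 0) → p = 0) (v : V) :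
    IsSymbol ⊤ (fun (_ : ι) p => (1 + ‖p‖) ^ (-1 : ℤ))
      fun _ p => Q p v * (ellipticWeight Q p)⁻¹ := by
  have h := (IsSymbol.linear (ι := ι) (Q.flip v)).bilin (ContinuousLinearMap.mul ℝ ℝ)
    (isSymbol_ellipticWeight_inv hQ)
  refine h.mono 1 (fun _ p => ?_) fun _ p => by positivity
  have : (1 + ‖p‖) ≠ 0 := by positivity
  rw [one_mul, ← zpow_one_add₀ this]
  norm_num

/-- The operator `oscOp` lowers the order of a symbol by one. -/
lemma IsSymbol.oscOp (hQ : ∀ p, (∀ v, Q p v = 0) → p = 0) {c : ι → ℝ} (hc : ∀ i, 0 ≤ c i) {m : ℤ}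
    {u : ι → V → E} (hu : IsSymbol ⊤ (fun i p => c i * (1 + ‖p‖) ^ m) u) :
    IsSymbol ⊤ (fun i p => c i * (1 + ‖p‖) ^ (m - 1)) (fun i => oscOp Q (u i)) := by
  have h0 : ∀ i (p : V), 0 ≤ c i * (1 + ‖p‖) ^ (m - 1) := fun i p =>
    mul_nonneg (hc i) (by positivity)
  have h1 := (isSymbol_ellipticWeight_inv (ι := ι) hQ).bilin
    (ContinuousLinearMap.lsmul ℝ ℝ : ℝ →L[ℝ] E →L[ℝ] E) hu
  have h2 := fun v => (IsSymbol.fderiv (n := ⊤) ((isSymbol_oscCoeff (ι := ι) hQ v).bilin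
    (ContinuousLinearMap.lsmul ℝ ℝ : ℝ →L[ℝ] E →L[ℝ] E) hu)).clm
      (ContinuousLinearMap.apply ℝ E v)
  refine (h1.mono 1 (fun i p => ?_) h0).add ?_
  · rw [one_mul, mul_left_comm, ← zpow_add₀ (by positivity)]
    refine mul_le_mul_of_nonneg_left ?_ (hc i)
    exact zpow_le_zpow_right₀ (by linarith [norm_nonneg p]) (by lia)
  · have h3 := (IsSymbol.sum h0 Finset.univ fun j _ =>
      (h2 (Module.finBasis ℝ V j)).mono 1 (fun i p => by
        rw [one_mul, mul_left_comm, ← zpow_add₀ (by positivity), neg_add_eq_sub]) h0).clm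
      ((Complex.I • ContinuousLinearMap.id ℂ E).restrictScalars ℝ)
    exact h3

lemma IsSymbol.oscOp_iterate (hQ : ∀ p, (∀ v, Q p v = 0) → p = 0) {c : ι → ℝ}
    (hc : ∀ i, 0 ≤ c i) {m : ℤ} {u : ι → V → E}
    (hu : IsSymbol ⊤ (fun i p => c i * (1 + ‖p‖) ^ m) u) (k : ℕ) :
    IsSymbol ⊤ (fun i p => c i * (1 + ‖p‖) ^ (m - k)) (fun i => (RieffelCrossed.oscOp Q)^[k] (u i)) := by
  induction k with
  | zero => simpa using hu
  | succ k ih =>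
    simp only [Function.iterate_succ_apply']
    have := ih.oscOp hQ hc
    rwa [sub_sub, ← Nat.cast_succ] at this

lemma contDiff_oscOp {u : V → E} (hu : ContDiff ℝ ∞ u) : ContDiff ℝ ∞ (oscOp Q u) := by
  have hw : ContDiff ℝ ∞ fun p => (ellipticWeight Q p)⁻¹ := by
    refine ContDiff.inv ?_ fun p => (ellipticWeight_pos p).ne'
    refine contDiff_const.add (ContDiff.sum fun j _ => ?_)
    exact (Q.contDiff.clm_apply contDiff_const).pow 2
  refine (hw.smul hu).add (contDiff_const.smul (ContDiff.sum fun j _ => ?_))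
  exact (((Q.contDiff.clm_apply contDiff_const).mul hw).smul hu).fderiv_right (m := ∞) (by simp)
    |>.clm_apply contDiff_const

lemma oscOp_add_smul {u v : V → E} (hu : ContDiff ℝ ∞ u) (hv : ContDiff ℝ ∞ v) (c : ℝ) :
    oscOp Q (fun p => u p + c • v p) = fun p => oscOp Q u p + c • oscOp Q v p := by
  have hw : ContDiff ℝ ∞ fun p => (ellipticWeight Q p)⁻¹ := by
    refine ContDiff.inv ?_ fun p => (ellipticWeight_pos p).ne'
    refine contDiff_const.add (ContDiff.sum fun j _ => ?_)
    exact (Q.contDiff.clm_apply contDiff_const).pow 2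
  funext p
  have hd : ∀ j {u : V → E}, ContDiff ℝ ∞ u → DifferentiableAt ℝ
      (fun q => (Q q (Module.finBasis ℝ V j) * (ellipticWeight Q q)⁻¹) • u q) p := fun j u hu =>
    ((((Q.contDiff.clm_apply contDiff_const).mul hw).smul hu).differentiable (by simp)) p
  have e : ∀ j, fderiv ℝ (fun q => (Q q (Module.finBasis ℝ V j) * (ellipticWeight Q q)⁻¹) •
      (u q + c • v q)) p = fderiv ℝ
        (fun q => (Q q (Module.finBasis ℝ V j) * (ellipticWeight Q q)⁻¹) • u q) p +
      c • fderiv ℝ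
        (fun q => (Q q (Module.finBasis ℝ V j) * (ellipticWeight Q q)⁻¹) • v q) p := by
    intro j
    rw [← fderiv_const_smul (hd j hv), ← fderiv_add (hd j hu) ((hd j hv).const_smul c)]
    congr 1
    funext q
    simp only [smul_add, Pi.add_apply, Pi.smul_apply]
    rw [smul_comm c]
  simp only [oscOp, e]
  simp only [add_apply, smul_apply, Finset.sum_add_distrib, ← Finset.smul_sum, smul_add]
  rw [smul_comm c (Complex.I), smul_comm c ((ellipticWeight Q p)⁻¹)]
  abel

lemma contDiff_oscOp_iterate {u : V → E} (hu : ContDiff ℝ ∞ u) (k : ℕ) :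
    ContDiff ℝ ∞ ((oscOp Q)^[k] u) := by
  induction k with
  | zero => exact hu
  | succ k ih =>
    rw [Function.iterate_succ_apply']
    exact contDiff_oscOp ih

lemma oscOp_iterate_add_smul {u v : V → E} (hu : ContDiff ℝ ∞ u) (hv : ContDiff ℝ ∞ v) (c : ℝ)
    (k : ℕ) : (oscOp Q)^[k] (fun p => u p + c • v p) =
      fun p => (oscOp Q)^[k] u p + c • (oscOp Q)^[k] v p := by
  induction k with
  | zero => rfl
  | succ k ih =>
    rw [Function.iterate_succ_apply', ih, oscOp_add_smul (contDiff_oscOp_iterate hu k)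
      (contDiff_oscOp_iterate hv k), Function.iterate_succ_apply', Function.iterate_succ_apply']

variable [MeasurableSpace V] [BorelSpace V] {μ : Measure V} [μ.IsAddHaarMeasure]

lemma integrable_zpow {m : ℤ} (hm : m ≤ -(Module.finrank ℝ V + 1 : ℤ)) :
    Integrable (fun p : V => (1 + ‖p‖) ^ m) μ := by
  have h := integrable_one_add_norm (E := V) (μ := μ) (r := ((-m : ℤ) : ℝ)) (by
    have : (Module.finrank ℝ V : ℤ) < -m := by lia
    exact_mod_cast this)
  refine h.congr (ae_of_all _ fun p => ?_)
  simp only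
  rw [← Int.cast_neg, neg_neg, Real.rpow_intCast]

lemma integrable_of_norm_le_zpow {E : Type*} [NormedAddCommGroup E] {f : V → E} (hf : Continuous f) {m : ℤ}
    (hm : m ≤ -(Module.finrank ℝ V + 1 : ℤ)) {C : ℝ} (hC : ∀ p, ‖f p‖ ≤ C * (1 + ‖p‖) ^ m) :
    Integrable f μ :=
  ((integrable_zpow hm).const_mul C).mono' hf.aestronglyMeasurable (ae_of_all _ hC)

lemma IsSymbol.integrable_quadPhase_smul {n : ℕ∞} {c : ι → ℝ} {m : ℤ}
    (hm : m ≤ -(Module.finrank ℝ V + 1 : ℤ)) {u : ι → V → E}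
    (hu : IsSymbol n (fun i p => c i * (1 + ‖p‖) ^ m) u) (i : ι) :
    Integrable (fun p => quadPhase Q p • u i p) μ := by
  obtain ⟨C, hC, h⟩ := hu.norm_le
  refine integrable_of_norm_le_zpow (C := C * c i)
    (contDiff_quadPhase.continuous.smul (hu.continuous i)) hm fun p => ?_
  rw [norm_smul, norm_quadPhase, one_mul, mul_assoc]
  exact h i p

/-- Integration by parts. -/
lemma integral_quadPhase_smul_oscOp (hs : ∀ p q, Q p q = Q q p)
    (hQ : ∀ p, (∀ v, Q p v = 0) → p = 0) {c : ι → ℝ} (hc : ∀ i, 0 ≤ c i) {m : ℤ}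
    (hm : m ≤ -(Module.finrank ℝ V + 1 : ℤ)) {u : ι → V → E}
    (hu : IsSymbol ⊤ (fun i p => c i * (1 + ‖p‖) ^ m) u) (i : ι) :
    ∫ p, quadPhase Q p • oscOp Q (u i) p ∂μ = ∫ p, quadPhase Q p • u i p ∂μ := by
  set b := Module.finBasis ℝ V with hb
  have h0 : ∀ i (p : V), 0 ≤ c i * (1 + ‖p‖) ^ m := fun i p => mul_nonneg (hc i) (by positivity)
  have hlow : ∀ {k : ℤ} (_ : k ≤ 0) (i : ι) (p : V),
      (1 + ‖p‖) ^ k * (c i * (1 + ‖p‖) ^ m) ≤ 1 * (c i * (1 + ‖p‖) ^ m) := by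
    intro k hk i p
    refine mul_le_mul_of_nonneg_right ?_ (h0 i p)
    exact zpow_le_one_of_nonpos₀ (by linarith [norm_nonneg p]) hk
  have hw := ((isSymbol_ellipticWeight_inv (ι := ι) hQ).bilin
    (ContinuousLinearMap.lsmul ℝ ℝ : ℝ →L[ℝ] E →L[ℝ] E) hu).mono 1 (hlow (by norm_num)) h0
  have hg := fun v => ((isSymbol_oscCoeff (ι := ι) hQ v).bilin
    (ContinuousLinearMap.lsmul ℝ ℝ : ℝ →L[ℝ] E →L[ℝ] E) hu).mono 1 (hlow (by norm_num)) h0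
  have hdg := fun v => (IsSymbol.fderiv (n := ⊤) (hg v)).clm (ContinuousLinearMap.apply ℝ E v)
  have hlg := fun v => (((IsSymbol.linear (ι := ι) (Q.flip v)).bilin
    (ContinuousLinearMap.mul ℝ ℝ) (isSymbol_oscCoeff (ι := ι) hQ v)).bilin
    (ContinuousLinearMap.lsmul ℝ ℝ : ℝ →L[ℝ] E →L[ℝ] E) hu).mono (ρ' := fun i p =>
      c i * (1 + ‖p‖) ^ m) 1 (fun i p => by
        rw [← zpow_one_add₀ (by positivity)]
        norm_num) h0
  have iw := hw.integrable_quadPhase_smul (Q := Q) (μ := μ) hm i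
  have ig := fun v => (hg v).integrable_quadPhase_smul (Q := Q) (μ := μ) hm i
  have idg := fun v => (hdg v).integrable_quadPhase_smul (Q := Q) (μ := μ) hm i
  have ilg := fun v => (hlg v).integrable_quadPhase_smul (Q := Q) (μ := μ) hm i
  simp only [ContinuousLinearMap.lsmul_apply, ContinuousLinearMap.apply_apply,
    ContinuousLinearMap.mul_apply', ContinuousLinearMap.flip_apply] at iw ig idg ilg
  have hpt : ∀ v p, fderiv ℝ (quadPhase Q) p v • ((Q p v * (ellipticWeight Q p)⁻¹) • u i p) =
      Complex.I • quadPhase Q p • (Q p v * (Q p v * (ellipticWeight Q p)⁻¹)) • u i p := by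
    intro v p
    rw [fderiv_quadPhase hs]
    simp only [← Complex.coe_smul, smul_smul]
    congr 1
    push_cast
    ring
  have hparts : ∀ v, ∫ p, quadPhase Q p • fderiv ℝ
      (fun q => (Q q v * (ellipticWeight Q q)⁻¹) • u i q) p v ∂μ =
      -(Complex.I • ∫ p, quadPhase Q p •
        (Q p v * (Q p v * (ellipticWeight Q p)⁻¹)) • u i p ∂μ) := by
    intro v
    rw [integral_smul_fderiv_eq_neg_fderiv_smul_of_integrable]
    · simp only [hpt, integral_smul]
    · simp only [hpt]
      exact (ilg v).smul Complex.I
    · exact idg v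
    · exact ig v
    · exact fun x _ => (contDiff_quadPhase.differentiable (by simp)) x
    · exact fun x _ => ((hg v).differentiable i) x
  have e1 : ∀ p, quadPhase Q p • oscOp Q (u i) p =
      quadPhase Q p • (ellipticWeight Q p)⁻¹ • u i p +
      Complex.I • ∑ j, quadPhase Q p • fderiv ℝ
        (fun q => (Q q (b j) * (ellipticWeight Q q)⁻¹) • u i q) p (b j) := by
    intro p
    rw [oscOp, smul_add, smul_comm (quadPhase Q p) Complex.I, Finset.smul_sum]
  simp only [e1]
  have isum : Integrable (fun p => Complex.I • ∑ j, quadPhase Q p • fderiv ℝ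
      (fun q => (Q q (b j) * (ellipticWeight Q q)⁻¹) • u i q) p (b j)) μ :=
    (integrable_finsetSum _ fun j _ => idg (b j)).smul Complex.I
  rw [integral_add iw isum,
    integral_smul, integral_finsetSum _ fun j _ => idg (b j)]
  simp only [hparts, Finset.sum_neg_distrib, ← Finset.smul_sum, smul_neg, smul_smul,
    Complex.I_mul_I, neg_smul, one_smul, neg_neg]
  rw [← integral_finsetSum _ fun j _ => ilg (b j), ← integral_add iw
    (integrable_finsetSum _ fun j _ => ilg (b j))]
  refine integral_congr_ae (ae_of_all _ fun p => ?_)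
  simp only
  rw [← Finset.smul_sum, ← smul_add, ← Finset.sum_smul, ← add_smul]
  congr 1
  have h1 : (ellipticWeight Q p)⁻¹ + ∑ j, Q p (b j) * (Q p (b j) * (ellipticWeight Q p)⁻¹) =
      1 := by
    have h2 : ∑ j, Q p (b j) * (Q p (b j) * (ellipticWeight Q p)⁻¹) =
        (∑ j, Q p (b j) ^ 2) * (ellipticWeight Q p)⁻¹ := by
      rw [Finset.sum_mul]
      exact Finset.sum_congr rfl fun j _ => by ring
    rw [h2, ← one_add_mul]
    exact mul_inv_cancel₀ (ellipticWeight_pos p).ne'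
  rw [h1, one_smul]

lemma integral_quadPhase_smul_oscOp_iterate (hs : ∀ p q, Q p q = Q q p)
    (hQ : ∀ p, (∀ v, Q p v = 0) → p = 0) {c : ι → ℝ} (hc : ∀ i, 0 ≤ c i) {m : ℤ}
    (hm : m ≤ -(Module.finrank ℝ V + 1 : ℤ)) {u : ι → V → E}
    (hu : IsSymbol ⊤ (fun i p => c i * (1 + ‖p‖) ^ m) u) (i : ι) (k : ℕ) :
    ∫ p, quadPhase Q p • (oscOp Q)^[k] (u i) p ∂μ = ∫ p, quadPhase Q p • u i p ∂μ := by
  induction k with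
  | zero => rfl
  | succ k ih =>
    rw [← ih, Function.iterate_succ_apply']
    exact integral_quadPhase_smul_oscOp hs hQ hc (by lia) (hu.oscOp_iterate hQ hc k) i

/-- Oscillatory integrals of bounded symbols: the regularized integrals converge to an absolutely
convergent integral, at a rate that is uniform over families. -/
theorem exists_oscillatory_limit (hs : ∀ p q, Q p q = Q q p)
    (hQ : ∀ p, (∀ v, Q p v = 0) → p = 0) {c : ι → ℝ} (hc : ∀ i, 0 ≤ c i) {u : ι → V → E}
    (hu : IsSymbol ⊤ (fun i _ => c i) u) :
    ∃ I : ι → E, (∃ K, ∀ i, ‖I i‖ ≤ K * c i) ∧ ∀ χ : 𝓢(V, ℂ), χ 0 = 1 →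
      ∃ K, ∀ i, ∀ ε ∈ Set.Ioc (0 : ℝ) 1,
        ‖∫ p, (χ (ε • p) * quadPhase Q p) • u i p ∂μ - I i‖ ≤ K * c i * ε := by
  set d := Module.finrank ℝ V with hd
  have hbd : ∀ {κ : Type _} {a : κ → ℝ} (_ : ∀ j, 0 ≤ a j) {v : κ → V → E} {m : ℤ}
      (_ : m ≤ -(d + 1 : ℤ)) (_ : IsSymbol ⊤ (fun j p => a j * (1 + ‖p‖) ^ m) v),
      ∃ K, ∀ j, ‖∫ p, quadPhase Q p • v j p ∂μ‖ ≤ K * a j := by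
    intro κ a ha v m hm hv
    obtain ⟨C, hC, hb⟩ := hv.norm_le
    refine ⟨C * ∫ p : V, (1 + ‖p‖) ^ m ∂μ, fun j => ?_⟩
    calc ‖∫ p, quadPhase Q p • v j p ∂μ‖ ≤ ∫ p, C * a j * (1 + ‖p‖) ^ m ∂μ := by
          refine norm_integral_le_of_norm_le ((integrable_zpow hm).const_mul _)
            (ae_of_all _ fun p => ?_)
          rw [norm_smul, norm_quadPhase, one_mul, mul_assoc]
          exact hb j p
      _ = _ := by
          rw [integral_const_mul]
          ring
  have hu0 : IsSymbol ⊤ (fun i (p : V) => c i * (1 + ‖p‖) ^ (0 : ℤ)) u := by simpa using hu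
  have huK := hu0.oscOp_iterate hQ hc (d + 2)
  refine ⟨fun i => ∫ p, quadPhase Q p • (oscOp Q)^[d + 2] (u i) p ∂μ,
    hbd hc (by push_cast; lia) huK, fun χ h1 => ?_⟩
  -- the remainder `u_ε - u = ε v_ε`, where `v` is a family of symbols of order one
  have hv : IsSymbol ⊤ (fun (j : ι × Set.Ioc (0 : ℝ) 1) (p : V) => c j.1 * (1 + ‖p‖) ^ (1 : ℤ))
      fun j p => ((j.2 : ℝ)⁻¹ • (χ ((j.2 : ℝ) • p) - 1)) • u j.1 p := by
    have h2 := ((isSymbol_cutoff χ h1).reindex (Prod.snd : ι × Set.Ioc (0 : ℝ) 1 → _)).bilin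
      (ContinuousLinearMap.lsmul ℝ ℂ : ℂ →L[ℝ] E →L[ℝ] E) (hu.reindex Prod.fst)
    refine h2.mono 1 (fun j p => ?_) fun j p => mul_nonneg (hc _) (by positivity)
    rw [zpow_one, one_mul, mul_comm]
  have hvK := hv.oscOp_iterate (Q := Q) hQ (fun j => hc _) (d + 2)
  obtain ⟨K, hK⟩ := hbd (fun j => hc _) (by push_cast; lia) hvK
  refine ⟨K, fun i ε hε => ?_⟩
  have huε : IsSymbol ⊤ (fun i (p : V) => c i * (1 + ‖p‖) ^ (-(d + 1 : ℤ)))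
      fun i p => χ (ε • p) • u i p := by
    have h2 := (((IsSymbol.of_schwartz (ι := ι) χ (d + 1)).comp_clm
      (ε • ContinuousLinearMap.id ℝ V))).bilin
      (ContinuousLinearMap.lsmul ℝ ℂ : ℂ →L[ℝ] E →L[ℝ] E) hu
    refine h2.mono ((ε ^ (d + 1))⁻¹) (fun j p => ?_) fun j p => mul_nonneg (hc _) (by positivity)
    rw [mul_comm, ← mul_assoc, mul_comm _ (c j), mul_assoc]
    refine mul_le_mul_of_nonneg_left ?_ (hc j)
    have e : (1 + ‖p‖) ^ (-(d + 1 : ℤ)) = ((1 + ‖p‖) ^ (d + 1))⁻¹ := by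
      rw [zpow_neg]
      norm_cast
    have hε0 : 0 < ε := hε.1
    rw [e, ← mul_inv, ← mul_pow]
    refine inv_anti₀ (by positivity) (pow_le_pow_left₀ (by positivity) ?_ _)
    simp only [smul_apply, ContinuousLinearMap.id_apply, norm_smul,
      Real.norm_of_nonneg hε0.le, mul_add, mul_one]
    linarith [hε.2]
  have e1 : ∀ p, (χ (ε • p) * quadPhase Q p) • u i p = quadPhase Q p • χ (ε • p) • u i p := by
    intro p
    rw [mul_comm, mul_smul]
  have e2 : (fun p => χ (ε • p) • u i p) =
      fun p => u i p + ε • ((ε⁻¹ • (χ (ε • p) - 1)) • u i p) := by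
    funext p
    rw [← smul_assoc, smul_inv_smul₀ hε.1.ne', sub_smul, one_smul]
    abel
  have e3 := integral_quadPhase_smul_oscOp_iterate (μ := μ) hs hQ hc le_rfl huε i (d + 2)
  simp only [e1]
  rw [← e3, e2, oscOp_iterate_add_smul (hu.smooth i) (hv.smooth (i, ⟨ε, hε⟩))]
  have e4 : ∀ p, quadPhase Q p • ((oscOp Q)^[d + 2] (u i) p + ε • (oscOp Q)^[d + 2]
      (fun p => (ε⁻¹ • (χ (ε • p) - 1)) • u i p) p) =
      quadPhase Q p • (oscOp Q)^[d + 2] (u i) p + ε • quadPhase Q p • (oscOp Q)^[d + 2]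
        (fun p => (ε⁻¹ • (χ (ε • p) - 1)) • u i p) p := by
    intro p
    rw [smul_add, smul_comm ε]
  have i1 := huK.integrable_quadPhase_smul (Q := Q) (μ := μ) (by push_cast; lia) i
  have i2 := hvK.integrable_quadPhase_smul (Q := Q) (μ := μ) (by push_cast; lia) (i, ⟨ε, hε⟩)
  have i3 : Integrable (fun p => ε • quadPhase Q p • (oscOp Q)^[d + 2]
      (fun p => (ε⁻¹ • (χ (ε • p) - 1)) • u i p) p) μ := i2.smul ε
  simp only [e4]
  rw [integral_add i1 i3, add_sub_cancel_left, integral_smul, norm_smul,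
    Real.norm_of_nonneg hε.1.le, mul_comm]
  exact mul_le_mul_of_nonneg_right (hK (i, ⟨ε, hε⟩)) hε.1.le

end Oscillatory

/-! ### The symplectic Fourier transform on vector-valued Schwartz functions -/

section Fourier

open scoped FourierTransform RealInnerProductSpace

variable {Ξ E : Type*} [NormedAddCommGroup Ξ] [NormedSpace ℝ Ξ] [FiniteDimensional ℝ Ξ]
  [NormedAddCommGroup E] [NormedSpace ℂ E]

/-- The Euclidean coordinates of the symplectic space in the basis that normalizes its measure. -/
def coordEquiv (Ξ : Type*) [NormedAddCommGroup Ξ] [NormedSpace ℝ Ξ] [FiniteDimensional ℝ Ξ] :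
    EuclideanSpace ℝ (Fin (Module.finrank ℝ Ξ)) ≃L[ℝ] Ξ :=
  (EuclideanSpace.equiv (Fin (Module.finrank ℝ Ξ)) ℝ).trans
    (Module.finBasis ℝ Ξ).equivFunL.symm

lemma coordEquiv_apply (y : EuclideanSpace ℝ (Fin (Module.finrank ℝ Ξ))) :
    coordEquiv Ξ y = ∑ i, y i • Module.finBasis ℝ Ξ i := by
  exact (Module.finBasis ℝ Ξ).equivFun_symm_apply _

/-- The operator `A` with `2π ⟪y, A z⟫ = σ(z, y)` in coordinates. -/
def sympOperator (σ : LinearMap.BilinForm ℝ Ξ) :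
    EuclideanSpace ℝ (Fin (Module.finrank ℝ Ξ)) →ₗ[ℝ]
      EuclideanSpace ℝ (Fin (Module.finrank ℝ Ξ)) where
  toFun z := WithLp.toLp 2 fun i => (2 * Real.pi)⁻¹ * σ (coordEquiv Ξ z) (Module.finBasis ℝ Ξ i)
  map_add' x y := by
    ext i
    simp [mul_add]
  map_smul' c x := by
    ext i
    simp
    ring

variable (σ : LinearMap.BilinForm ℝ Ξ)

lemma inner_sympOperator (y z : EuclideanSpace ℝ (Fin (Module.finrank ℝ Ξ))) :
    2 * Real.pi * ⟪y, sympOperator σ z⟫ = σ (coordEquiv Ξ z) (coordEquiv Ξ y) := by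
  have h : ⟪y, sympOperator σ z⟫ = ∑ i, y i * ((2 * Real.pi)⁻¹ *
      σ (coordEquiv Ξ z) (Module.finBasis ℝ Ξ i)) := by
    simp [PiLp.inner_apply, sympOperator, mul_comm]
  rw [h, coordEquiv_apply y, map_sum, Finset.mul_sum]
  refine Finset.sum_congr rfl fun i _ => ?_
  rw [map_smul, smul_eq_mul]
  field_simp

lemma det_sympOperator : LinearMap.det (sympOperator σ) =
    (2 * Real.pi) ^ (-(Module.finrank ℝ Ξ : ℝ)) *
      (Matrix.of fun i j => σ (Module.finBasis ℝ Ξ i) (Module.finBasis ℝ Ξ j)).det := by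
  have h : LinearMap.toMatrix (EuclideanSpace.basisFun _ ℝ).toBasis
      (EuclideanSpace.basisFun _ ℝ).toBasis (sympOperator σ) = (2 * Real.pi)⁻¹ •
      (Matrix.of fun i j => σ (Module.finBasis ℝ Ξ i) (Module.finBasis ℝ Ξ j)).transpose := by
    ext i j
    have h1 : coordEquiv Ξ (EuclideanSpace.single j 1) = Module.finBasis ℝ Ξ j := by
      rw [coordEquiv_apply, Finset.sum_eq_single j]
      · simp
      · intro i _ hi
        simp [hi]
      · simp
    simp [LinearMap.toMatrix_apply, sympOperator, h1]
  rw [← LinearMap.det_toMatrix (EuclideanSpace.basisFun _ ℝ).toBasis, h, Matrix.det_smul,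
    Matrix.det_transpose, Fintype.card_fin, Real.rpow_neg (by positivity), Real.rpow_natCast,
    inv_pow]

variable {σ}

lemma det_gram_ne_zero (hσ : σ.Nondegenerate) :
    (Matrix.of fun i j => σ (Module.finBasis ℝ Ξ i) (Module.finBasis ℝ Ξ j)).det ≠ 0 := by
  have h := (LinearMap.BilinForm.nondegenerate_iff_det_ne_zero (Module.finBasis ℝ Ξ)).1 hσ
  convert h using 2
  ext i j
  simp [LinearMap.BilinForm.toMatrix_apply]

lemma det_sympOperator_ne_zero (hσ : σ.Nondegenerate) : LinearMap.det (sympOperator σ) ≠ 0 := by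
  rw [det_sympOperator]
  exact mul_ne_zero (by positivity) (det_gram_ne_zero hσ)

variable (σ) in
/-- The density of `sympMeasure` with respect to the Lebesgue measure in coordinates. -/
def sympDensity : ℝ := √|LinearMap.det (sympOperator σ)|

lemma sympDensity_pos (hσ : σ.Nondegenerate) : 0 < sympDensity σ :=
  Real.sqrt_pos.2 (abs_pos.2 (det_sympOperator_ne_zero hσ))

/-- The symplectic Fourier transform of an `E`-valued Schwartz function. -/
def fourierSymp (hσ : σ.Nondegenerate) : 𝓢(Ξ, E) →L[ℂ] 𝓢(Ξ, E) :=
  (sympDensity σ : ℂ) • ((SchwartzMap.compCLMOfContinuousLinearEquiv ℂ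
    ((coordEquiv Ξ).symm.trans
      ((sympOperator σ).equivOfDetNeZero (det_sympOperator_ne_zero hσ)).toContinuousLinearEquiv)).comp
    ((SchwartzMap.fourierTransformCLM ℂ).comp
      (SchwartzMap.compCLMOfContinuousLinearEquiv ℂ (coordEquiv Ξ))))

lemma fourierSymp_eq_fourier (hσ : σ.Nondegenerate) (f : 𝓢(Ξ, E)) (X : Ξ) :
    fourierSymp hσ f X = sympDensity σ •
      𝓕 (fun y => f (coordEquiv Ξ y)) (sympOperator σ ((coordEquiv Ξ).symm X)) := by
  rw [← Complex.coe_smul]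
  rfl

/-- With the normalization of `sympMeasure` the symplectic Fourier transform is an involution. -/
theorem fourierSymp_fourierSymp [CompleteSpace E] (hσ_alt : σ.IsAlt) (hσ : σ.Nondegenerate)
    (f : 𝓢(Ξ, E)) : fourierSymp hσ (fourierSymp hσ f) = f := by
  have hdet := det_sympOperator_ne_zero hσ
  ext X
  obtain ⟨z, rfl⟩ := (coordEquiv Ξ).surjective X
  set fe : 𝓢(EuclideanSpace ℝ (Fin (Module.finrank ℝ Ξ)), E) :=
    SchwartzMap.compCLMOfContinuousLinearEquiv ℂ (coordEquiv Ξ) f with hfe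
  have h1 : ∀ v, fourierSymp hσ f (coordEquiv Ξ v) = sympDensity σ • (𝓕 fe) (sympOperator σ v) := by
    intro v
    rw [fourierSymp_eq_fourier, ContinuousLinearEquiv.symm_apply_apply]
    rfl
  have h2 : ∀ v, ⟪v, sympOperator σ z⟫ = -⟪sympOperator σ v, z⟫ := by
    intro v
    have e1 := inner_sympOperator σ v z
    have e2 := inner_sympOperator σ z v
    rw [← hσ_alt.neg_eq, ← e2, ← mul_neg] at e1
    rw [real_inner_comm z]
    exact mul_left_cancel₀ (by positivity) e1
  let h : EuclideanSpace ℝ (Fin (Module.finrank ℝ Ξ)) → E :=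
    fun w => Complex.exp ((2 * Real.pi * ⟪w, z⟫ : ℝ) * Complex.I) • (𝓕 fe) w
  have h3 : ∫ v, h (sympOperator σ v) = |(LinearMap.det (sympOperator σ))⁻¹| • ∫ v, h v := by
    have e := MeasureTheory.Measure.map_linearMap_addHaar_eq_smul_addHaar
      (volume : Measure (EuclideanSpace ℝ (Fin (Module.finrank ℝ Ξ)))) hdet
    have e2 := ((sympOperator σ).equivOfDetNeZero
      hdet).toContinuousLinearEquiv.toHomeomorph.measurableEmbedding.integral_map
        (μ := volume) h
    have e3 : ∫ v, h v ∂(Measure.map (sympOperator σ) volume) = ∫ v, h (sympOperator σ v) := e2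
    rw [← e3, e, integral_smul_measure, ENNReal.toReal_ofReal (abs_nonneg _)]
  have h4 : ∫ v, h v = f (coordEquiv Ξ z) := by
    have e : 𝓕⁻ (𝓕 fe) = fe := FourierTransform.fourierInv_fourier_eq fe
    have e2 := congrArg (fun g : 𝓢(_, E) => g z) e
    simp only [SchwartzMap.fourierInv_coe, Real.fourierInv_eq'] at e2
    exact e2
  rw [fourierSymp_eq_fourier, ContinuousLinearEquiv.symm_apply_apply, Real.fourier_eq']
  have h5 : ∀ v, Complex.exp (((-2 * Real.pi * ⟪v, sympOperator σ z⟫ : ℝ) : ℂ) * Complex.I) •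
      fourierSymp hσ f (coordEquiv Ξ v) = sympDensity σ • h (sympOperator σ v) := by
    intro v
    rw [h1, h2, smul_comm]
    simp only [h]
    congr 5
    ring
  simp only [h5]
  rw [integral_smul, h3, h4, smul_smul, smul_smul, sympDensity,
    Real.mul_self_sqrt (abs_nonneg _), abs_inv, mul_inv_cancel₀ (abs_ne_zero.2 hdet), one_smul]

variable [MeasurableSpace Ξ] [BorelSpace Ξ]

lemma sympMeasure_eq : sympMeasure σ =
    ENNReal.ofReal (sympDensity σ) • Measure.map (coordEquiv Ξ) volume := by
  have h1 : Measure.map (coordEquiv Ξ) volume = (Module.finBasis ℝ Ξ).addHaar := by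
    rw [← (EuclideanSpace.basisFun (Fin (Module.finrank ℝ Ξ)) ℝ).addHaar_eq_volume,
      Module.Basis.map_addHaar]
    congr 1
    ext i
    simp only [Module.Basis.map_apply, OrthonormalBasis.coe_toBasis, EuclideanSpace.basisFun_apply]
    refine (coordEquiv_apply _).trans ?_
    rw [Finset.sum_eq_single i]
    · simp
    · intro j _ hj
      simp [hj]
    · simp
  have h2 : sympDensity σ = (2 * Real.pi) ^ (-(Module.finrank ℝ Ξ : ℝ) / 2) *
      √|(Matrix.of fun i j => σ (Module.finBasis ℝ Ξ i) (Module.finBasis ℝ Ξ j)).det| := by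
    rw [sympDensity, det_sympOperator, abs_mul, Real.sqrt_mul (abs_nonneg _),
      abs_of_pos (by positivity), Real.sqrt_eq_rpow, ← Real.rpow_mul (by positivity)]
    congr 2
    ring
  rw [sympMeasure, h1, h2]

lemma isAddHaarMeasure_sympMeasure (hσ : σ.Nondegenerate) : (sympMeasure σ).IsAddHaarMeasure := by
  have h := sympDensity_pos hσ
  rw [sympMeasure_eq]
  have : (Measure.map (coordEquiv Ξ) volume).IsAddHaarMeasure :=
    (coordEquiv Ξ).isAddHaarMeasure_map volume
  exact Measure.IsAddHaarMeasure.smul _ (by simpa using h) ENNReal.ofReal_ne_top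

lemma integral_sympMeasure (f : Ξ → E) :
    ∫ Y, f Y ∂(sympMeasure σ) = sympDensity σ • ∫ y, f (coordEquiv Ξ y) := by
  have h : ∫ Y, f Y ∂(Measure.map (coordEquiv Ξ) volume) = ∫ y, f (coordEquiv Ξ y) :=
    (coordEquiv Ξ).toHomeomorph.measurableEmbedding.integral_map f
  rw [sympMeasure_eq, integral_smul_measure, h, ENNReal.toReal_ofReal]
  exact Real.sqrt_nonneg _

theorem fourierSymp_apply (hσ : σ.Nondegenerate) (f : 𝓢(Ξ, E)) (X : Ξ) :
    fourierSymp hσ f X =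
      ∫ Y, Complex.exp (-Complex.I * (σ X Y : ℂ)) • f Y ∂(sympMeasure σ) := by
  rw [fourierSymp_eq_fourier, integral_sympMeasure, Real.fourier_eq']
  congr 2
  funext y
  congr 2
  have := inner_sympOperator σ y ((coordEquiv Ξ).symm X)
  rw [ContinuousLinearEquiv.apply_symm_apply] at this
  rw [← this]
  push_cast
  ring

end Fourier

/-! ### Smooth vectors -/

section SmoothVectors

variable {Ξ A : Type*} [NormedAddCommGroup Ξ] [NonUnitalCStarAlgebra A]

namespace VectorAction

variable (Θ : VectorAction Ξ A)

lemma norm_aut (X : Ξ) (a : A) : ‖Θ.aut X a‖ = ‖a‖ := StarAlgEquiv.norm_map (Θ.aut X) a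

/-- The automorphism `Θ_X` as a continuous linear map. -/
def autL (X : Ξ) : A →L[ℂ] A :=
  LinearMap.mkContinuous
    { toFun := Θ.aut X
      map_add' := map_add _
      map_smul' := fun c a => map_smul (Θ.aut X) c a } 1
    fun a => by simp [Θ.norm_aut]

/-- The automorphism `Θ_X` as a continuous real-linear map. -/
def autR (X : Ξ) : A →L[ℝ] A := (Θ.autL X).restrictScalars ℝ

@[simp] lemma autL_apply (X : Ξ) (a : A) : Θ.autL X a = Θ.aut X a := rfl

@[simp] lemma autR_apply (X : Ξ) (a : A) : Θ.autR X a = Θ.aut X a := rfl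

lemma norm_autR_le (X : Ξ) : ‖Θ.autR X‖ ≤ 1 :=
  ContinuousLinearMap.opNorm_le_bound _ zero_le_one fun a => by simp [Θ.norm_aut]

lemma aut_neg_aut (X : Ξ) (a : A) : Θ.aut (-X) (Θ.aut X a) = a := by
  rw [← Θ.aut_add, neg_add_cancel, Θ.aut_zero]

lemma aut_aut_neg (X : Ξ) (a : A) : Θ.aut X (Θ.aut (-X) a) = a := by
  rw [← Θ.aut_add, add_neg_cancel, Θ.aut_zero]

/-- The action is jointly continuous. -/
lemma continuous_aut {T : Type*} [TopologicalSpace T] {y : T → Ξ} {f : T → A}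
    (hy : Continuous y) (hf : Continuous f) : Continuous fun t => Θ.aut (y t) (f t) := by
  refine continuous_iff_continuousAt.2 fun t₀ => ?_
  rw [ContinuousAt, tendsto_iff_norm_sub_tendsto_zero]
  have h1 : Tendsto (fun t => ‖f t - f t₀‖ + ‖Θ.aut (y t) (f t₀) - Θ.aut (y t₀) (f t₀)‖) (𝓝 t₀)
      (𝓝 0) := by
    have e1 := tendsto_iff_norm_sub_tendsto_zero.1 (hf.tendsto t₀)
    have e2 := tendsto_iff_norm_sub_tendsto_zero.1
      (((Θ.continuous_orbit (f t₀)).comp hy).tendsto t₀)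
    simpa using e1.add e2
  refine squeeze_zero (fun _ => norm_nonneg _) (fun t => ?_) h1
  rw [← Θ.norm_aut (y t) (f t - f t₀), map_sub]
  exact norm_sub_le_norm_sub_add_norm_sub _ _ _

end VectorAction

variable [NormedSpace ℝ Ξ] {Θ : VectorAction Ξ A}

lemma contDiff_orbit (f : smoothVectors Θ) : ContDiff ℝ ∞ fun X => Θ.aut X (f : A) := f.2

/-- The derivatives of the orbit are the translates of the jets. -/
lemma iteratedFDeriv_orbit (f : smoothVectors Θ) (k : ℕ) (Y : Ξ) :
    iteratedFDeriv ℝ k (fun X => Θ.aut X (f : A)) Y =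
      (Θ.autR Y).compContinuousMultilinearMap (jet Θ k f) := by
  have h1 : iteratedFDeriv ℝ k (fun X => Θ.aut (Y + X) (f : A)) 0 =
      iteratedFDeriv ℝ k (fun X => Θ.aut X (f : A)) Y := by
    rw [iteratedFDeriv_comp_add_left k Y 0 (f := fun X => Θ.aut X (f : A)), add_zero]
  have h2 : (fun X => Θ.aut (Y + X) (f : A)) = Θ.autR Y ∘ fun X => Θ.aut X (f : A) := by
    funext X
    simp [Θ.aut_add]
  rw [← h1, h2, (Θ.autR Y).iteratedFDeriv_comp_left (contDiff_orbit f).contDiffAt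
    (by exact_mod_cast le_top)]
  rfl

lemma norm_autR_comp_le {k : ℕ} (Y : Ξ) (m : ContinuousMultilinearMap ℝ (fun _ : Fin k => Ξ) A) :
    ‖(Θ.autR Y).compContinuousMultilinearMap m‖ ≤ ‖m‖ :=
  ((Θ.autR Y).norm_compContinuousMultilinearMap_le m).trans
    (mul_le_of_le_one_left (norm_nonneg _) (Θ.norm_autR_le Y))

lemma jet_zero_curry0 (f : smoothVectors Θ) : (jet Θ 0 f).curry0 = (f : A) := by
  change Θ.aut 0 (f : A) = f
  exact Θ.aut_zero _

lemma norm_jet_zero (f : smoothVectors Θ) : ‖jet Θ 0 f‖ = ‖(f : A)‖ := by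
  rw [← jet_zero_curry0 f, ContinuousMultilinearMap.curry0_norm]

/-- A vector is smooth, with given jets, if the translates of the jets form a Taylor series of its
orbit. -/
lemma jet_of_hasFTaylorSeriesUpTo {f : A} {J : FormalMultilinearSeries ℝ Ξ A}
    (h : HasFTaylorSeriesUpTo ∞ (fun X => Θ.aut X f)
      (fun X k => (Θ.autR X).compContinuousMultilinearMap (J k))) :
    ∃ hf : f ∈ smoothVectors Θ, ∀ k, jet Θ k ⟨f, hf⟩ = J k := by
  refine ⟨h.contDiff, fun k => ?_⟩
  have := h.eq_iteratedFDeriv (m := k) (by exact_mod_cast le_top) 0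
  refine this.symm.trans ?_
  ext m
  exact Θ.aut_zero _

/-- The jets identify the smooth vectors with a closed subspace of a product of Banach spaces. -/
theorem exists_jet_eq_of_tendsto {ι : Type*} {l : Filter ι} [l.NeBot] {f : ι → smoothVectors Θ}
    {J : FormalMultilinearSeries ℝ Ξ A} (h : ∀ k, Tendsto (fun n => jet Θ k (f n)) l (𝓝 (J k))) :
    ∃ g : smoothVectors Θ, ∀ k, jet Θ k g = J k := by
  obtain ⟨hg, h⟩ := jet_of_hasFTaylorSeriesUpTo (Θ := Θ) (f := (J 0).curry0) (J := J) <| by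
    refine hasFTaylorSeriesUpTo_of_tendstoUniformly (l := l)
      (u := fun n X => Θ.aut X (f n : A)) (fun n => contDiff_orbit (f n)) (fun x => rfl) fun k => ?_
    rw [Metric.tendstoUniformly_iff]
    intro ε hε
    filter_upwards [(Metric.tendsto_nhds.1 (h k)) ε hε] with n hn X
    rw [iteratedFDeriv_orbit, dist_eq_norm]
    have e : (Θ.autR X).compContinuousMultilinearMap (J k) -
        (Θ.autR X).compContinuousMultilinearMap (jet Θ k (f n)) =
        (Θ.autR X).compContinuousMultilinearMap (J k - jet Θ k (f n)) := by
      ext m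
      simp
    rw [e]
    refine (norm_autR_comp_le X _).trans_lt ?_
    rwa [dist_comm, dist_eq_norm] at hn
  exact ⟨⟨_, hg⟩, h⟩

/-- Integrals of smooth vectors, with integrable jets, are smooth vectors. -/
theorem exists_jet_eq_integral {Ω : Type*} [MeasurableSpace Ω] {μ : Measure Ω}
    {f : Ω → smoothVectors Θ} (h : ∀ k, Integrable (fun z => jet Θ k (f z)) μ) :
    ∃ g : smoothVectors Θ, (g : A) = ∫ z, (f z : A) ∂μ ∧
      ∀ k, jet Θ k g = ∫ z, jet Θ k (f z) ∂μ := by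
  have hcomp : ∀ k X, ∫ z, (Θ.autR X).compContinuousMultilinearMap (jet Θ k (f z)) ∂μ =
      (Θ.autR X).compContinuousMultilinearMap (∫ z, jet Θ k (f z) ∂μ) := fun k X =>
    ContinuousLinearMap.integral_comp_comm (𝕜 := ℝ)
      (ContinuousLinearMap.compContinuousMultilinearMapL ℝ (fun _ : Fin k => Ξ) A A (Θ.autR X)) (h k)
  have hint : Integrable (fun z => (f z : A)) μ := by
    have := (continuousMultilinearCurryFin0 ℝ Ξ
      A).toContinuousLinearEquiv.toContinuousLinearMap.integrable_comp (h 0)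
    refine this.congr (ae_of_all _ fun z => ?_)
    exact jet_zero_curry0 (f z)
  have hT := hasFTaylorSeriesUpTo_integral (μ := μ) (g := fun X z => Θ.aut X (f z : A))
    (fun z => contDiff_orbit (f z))
    (fun k X => by
      simp only [iteratedFDeriv_orbit]
      exact (ContinuousLinearMap.compContinuousMultilinearMapL ℝ (fun _ : Fin k => Ξ) A A
        (Θ.autR X)).continuous.comp_aestronglyMeasurable (h k).aestronglyMeasurable)
    (fun k X => ⟨fun z => ‖jet Θ k (f z)‖, (h k).norm, Eventually.of_forall fun Y z => by
      rw [iteratedFDeriv_orbit]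
      exact norm_autR_comp_le Y _⟩)
  simp only [iteratedFDeriv_orbit, hcomp] at hT
  have e : (fun X => ∫ z, Θ.aut X (f z : A) ∂μ) = fun X => Θ.aut X (∫ z, (f z : A) ∂μ) := by
    funext X
    exact (Θ.autR X).integral_comp_comm hint
  rw [e] at hT
  obtain ⟨hg, h⟩ := jet_of_hasFTaylorSeriesUpTo hT
  exact ⟨⟨_, hg⟩, rfl, h⟩

end SmoothVectors

/-! ### The Fréchet space of Schwartz functions with values in the smooth vectors -/

section SchwartzTopology

open scoped BoundedContinuousFunction Pointwise

universe u v

variable {Ξ : Type u} {A : Type v} [NormedAddCommGroup Ξ] [NonUnitalCStarAlgebra A]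
  [NormedSpace ℝ Ξ]
  {Θ : VectorAction Ξ A}

namespace SchwartzSpace

lemma add_eval (F G : SchwartzSpace Θ) (X : Ξ) : (F + G) X = F X + G X := rfl

lemma smul_eval (c : ℂ) (F : SchwartzSpace Θ) (X : Ξ) : (c • F) X = c • F X := rfl

lemma ext_eval {F G : SchwartzSpace Θ} (h : ∀ X, F X = G X) : F = G :=
  Subtype.ext (funext fun X => Subtype.ext (h X))

variable (Θ) in
/-- `SchwartzSpace.toSchwartz` as a linear map. -/
def toSchwartzₗ (k : ℕ) :
    SchwartzSpace Θ →ₗ[ℂ] 𝓢(Ξ, ContinuousMultilinearMap ℝ (fun _ : Fin k => Ξ) A) where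
  toFun := toSchwartz k
  map_add' F G := by
    ext1 X
    exact map_add (jet Θ k) (F.1 X) (G.1 X)
  map_smul' c F := by
    ext1 X
    exact map_smul (jet Θ k) c (F.1 X)

/-- A function with values in the smooth vectors whose jets are Schwartz functions. -/
def ofJets (f : Ξ → smoothVectors Θ)
    (h : ∀ k, ∃ s : 𝓢(Ξ, ContinuousMultilinearMap ℝ (fun _ : Fin k => Ξ) A),
      ∀ X, s X = jet Θ k (f X)) : SchwartzSpace Θ :=
  ⟨f, fun k => by
    obtain ⟨s, hs⟩ := h k
    have e : (fun X => jet Θ k (f X)) = s := funext fun X => (hs X).symm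
    rw [e]
    exact ⟨s.smooth', s.decay'⟩⟩

instance : IsTopologicalAddGroup (SchwartzSpace Θ) :=
  topologicalAddGroup_iInf fun k => topologicalAddGroup_induced (toSchwartzₗ Θ k)

instance : ContinuousSMul ℂ (SchwartzSpace Θ) :=
  continuousSMul_iInf fun k => continuousSMul_induced (toSchwartzₗ Θ k)

instance : LocallyConvexSpace ℝ (SchwartzSpace Θ) :=
  LocallyConvexSpace.iInf fun k => LocallyConvexSpace.induced ((toSchwartzₗ Θ k).restrictScalars ℝ)

lemma continuous_toSchwartz (k : ℕ) :
    Continuous (toSchwartz k : SchwartzSpace Θ → _) :=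
  continuous_iInf_dom continuous_induced_dom

lemma continuous_iff {T : Type*} [TopologicalSpace T] {f : T → SchwartzSpace Θ} :
    Continuous f ↔ ∀ k, Continuous fun t => toSchwartz k (f t) := by
  rw [continuous_iInf_rng]
  simp only [continuous_induced_rng]
  rfl

variable (Θ) in
/-- All jets at once. -/
def jets : SchwartzSpace Θ →+
    ((k : ℕ) → 𝓢(Ξ, ContinuousMultilinearMap ℝ (fun _ : Fin k => Ξ) A)) where
  toFun F k := toSchwartz k F
  map_zero' := funext fun k => map_zero (toSchwartzₗ Θ k)
  map_add' F G := funext fun k => map_add (toSchwartzₗ Θ k) F G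

lemma isInducing_jets : IsInducing (jets Θ) := by
  refine ⟨?_⟩
  rw [Pi.topologicalSpace, induced_iInf]
  refine iInf_congr fun k => ?_
  rw [induced_compose]
  rfl

lemma injective_jets : Function.Injective (jets Θ) := by
  intro F G h
  refine ext_eval fun X => ?_
  have h1 := congrArg (fun s => (s 0 X).curry0) h
  change (jet Θ 0 (F.1 X)).curry0 = (jet Θ 0 (G.1 X)).curry0 at h1
  rwa [jet_zero_curry0, jet_zero_curry0] at h1

instance : TopologicalSpace.MetrizableSpace (SchwartzSpace Θ) := by
  have h : ∀ k : ℕ, (uniformity 𝓢(Ξ,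
      ContinuousMultilinearMap ℝ (fun _ : Fin k => Ξ) A)).IsCountablyGenerated := fun k =>
    IsUniformAddGroup.uniformity_countably_generated
  have : TopologicalSpace.MetrizableSpace
      ((k : ℕ) → 𝓢(Ξ, ContinuousMultilinearMap ℝ (fun _ : Fin k => Ξ) A)) :=
    UniformSpace.metrizableSpace
  exact (IsEmbedding.mk isInducing_jets injective_jets).metrizableSpace

lemma isClosed_range_jets : IsClosed (Set.range (jets Θ)) := by
  refine isClosed_of_closure_subset fun ψ hψ => ?_
  have hl : (comap (jets Θ) (𝓝 ψ)).NeBot :=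
    comap_neBot_iff_frequently.2 (mem_closure_iff_frequently.1 hψ)
  have ht : ∀ (k : ℕ) (X : Ξ), Tendsto (fun F : SchwartzSpace Θ => jet Θ k (F.1 X))
      (comap (jets Θ) (𝓝 ψ)) (𝓝 (ψ k X)) := by
    intro k X
    have h1 : Tendsto (fun F : SchwartzSpace Θ => jets Θ F k) (comap (jets Θ) (𝓝 ψ)) (𝓝 (ψ k)) :=
      ((continuous_apply k).tendsto ψ).comp tendsto_comap
    have h2 : Continuous fun s : 𝓢(Ξ, ContinuousMultilinearMap ℝ (fun _ : Fin k => Ξ) A) => s X :=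
      (continuous_eval_const (F := Ξ →ᵇ _) X).comp
        (SchwartzMap.toBoundedContinuousFunctionCLM ℝ Ξ _).continuous
    exact (h2.tendsto (ψ k)).comp h1
  choose f hf using fun X => exists_jet_eq_of_tendsto (J := fun k => ψ k X) fun k => ht k X
  refine ⟨ofJets f fun k => ⟨ψ k, fun X => (hf X k).symm⟩, ?_⟩
  funext k
  ext1 X
  exact hf X k

theorem isFrechetSpace : IsFrechetSpace (SchwartzSpace Θ) where
  isTopologicalAddGroup := inferInstance
  continuousSMul := inferInstance
  locallyConvexSpace := inferInstance
  metrizableSpace := inferInstance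
  completeSpace := by
    let _ : UniformSpace (SchwartzSpace Θ) := IsTopologicalAddGroup.rightUniformSpace _
    have : IsUniformAddGroup (SchwartzSpace Θ) := isUniformAddGroup_of_addCommGroup
    exact (AddMonoidHom.isUniformInducing_of_isInducing isInducing_jets).completeSpace
      isClosed_range_jets.isComplete

/-! ### Bounded families -/

/-- A family in `𝒮(Ξ; A^∞)` that is bounded for all the seminorms that define the topology. -/
def IsBoundedFamily {ι : Type*} (F : ι → SchwartzSpace Θ) : Prop :=
  ∀ k N m : ℕ, ∃ C : ℝ, ∀ i X,
    ‖X‖ ^ N * ‖iteratedFDeriv ℝ m (toSchwartz k (F i)) X‖ ≤ C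

variable (Θ) in
lemma withSeminorms : WithSeminorms (SeminormFamily.sigma fun k : ℕ =>
    (schwartzSeminormFamily ℂ Ξ (ContinuousMultilinearMap ℝ (fun _ : Fin k => Ξ) A)).comp
      (toSchwartzₗ Θ k)) :=
  withSeminorms_iInf fun k =>
    LinearMap.withSeminorms_induced (schwartz_withSeminorms ℂ Ξ _) (toSchwartzₗ Θ k)

lemma isBoundedFamily_iff {ι : Type*} {F : ι → SchwartzSpace Θ} :
    IsBoundedFamily F ↔ Bornology.IsVonNBounded ℂ (Set.range F) := by
  rw [(withSeminorms Θ).isVonNBounded_iff_seminorm_bounded]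
  constructor
  · rintro h ⟨k, N, m⟩
    obtain ⟨C, hC⟩ := h k N m
    refine ⟨|C| + 1, by positivity, ?_⟩
    rintro _ ⟨i, rfl⟩
    refine lt_of_le_of_lt (SchwartzMap.seminorm_le_bound ℂ N m _ (abs_nonneg C) fun X => ?_)
      (lt_add_one _)
    exact (hC i X).trans (le_abs_self C)
  · intro h k N m
    obtain ⟨C, _, hC⟩ := h ⟨k, N, m⟩
    exact ⟨C, fun i X => (SchwartzMap.le_seminorm ℂ N m (toSchwartz k (F i)) X).trans
      (hC _ ⟨i, rfl⟩).le⟩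

lemma IsBoundedFamily.comp {ι κ : Type*} {F : ι → SchwartzSpace Θ} (h : IsBoundedFamily F)
    (f : κ → ι) : IsBoundedFamily (F ∘ f) := fun k N m => by
  obtain ⟨C, hC⟩ := h k N m
  exact ⟨C, fun i => hC (f i)⟩

lemma isBoundedFamily_const {ι : Type*} (F : SchwartzSpace Θ) :
    IsBoundedFamily fun _ : ι => F := fun k N m => by
  obtain ⟨C, hC⟩ := (toSchwartz k F).decay' N m
  exact ⟨C, fun _ => hC⟩

/-- A linear map that preserves bounded families is continuous. -/
lemma continuous_of_isBoundedFamily (T : SchwartzSpace Θ →ₗ[ℂ] SchwartzSpace Θ)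
    (h : ∀ {ι : Type (max u v)} (F : ι → SchwartzSpace Θ), IsBoundedFamily F →
      IsBoundedFamily fun i => T (F i)) : Continuous T := by
  refine LinearMap.continuous_of_locally_bounded T fun s hs => ?_
  have h1 : IsBoundedFamily (fun F : s => (F : SchwartzSpace Θ)) := by
    rw [isBoundedFamily_iff]
    simpa using hs
  have h2 := isBoundedFamily_iff.1 (h _ h1)
  rwa [Set.image_eq_range]

/-- A bilinear map that preserves bounded families is jointly continuous. -/
lemma continuous_of_isBoundedFamily₂
    (T : SchwartzSpace Θ →ₗ[ℂ] SchwartzSpace Θ →ₗ[ℂ] SchwartzSpace Θ)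
    (h : ∀ {ι : Type (max u v)} (F G : ι → SchwartzSpace Θ), IsBoundedFamily F → IsBoundedFamily G →
      IsBoundedFamily fun i => T (F i) (G i)) :
    Continuous fun p : SchwartzSpace Θ × SchwartzSpace Θ => T p.1 p.2 := by
  have hl : ∀ F, Continuous (T F) := fun F =>
    continuous_of_isBoundedFamily (T F) fun G hG => h _ G (isBoundedFamily_const F) hG
  have hr : ∀ G, Continuous (T.flip G) := fun G =>
    continuous_of_isBoundedFamily (T.flip G) fun F hF => h F _ hF (isBoundedFamily_const G)
  let f : SchwartzSpace Θ →+ SchwartzSpace Θ →+ SchwartzSpace Θ :=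
    AddMonoidHom.mk' (fun F => (T F).toAddMonoidHom) fun F F' => by
      ext1 G
      simp
  refine continuous_of_continuousAt_zero₂ f ?_ (fun F => (hl F).continuousAt)
    fun G => (hr G).continuousAt
  have h00 : f 0 0 = 0 := by simp
  have hT : ∀ F G, f F G = T F G := fun F G => rfl
  rw [ContinuousAt]
  simp only [h00]
  rw [(nhds_basis_balanced ℂ _).tendsto_right_iff]
  rintro W ⟨hW, hWb⟩
  obtain ⟨U, hU⟩ := (𝓝 (0 : SchwartzSpace Θ)).exists_antitone_basis
  -- some `U n` is mapped into a multiple of `W`: otherwise two null sequences, which are bounded,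
  -- would have an unbounded image
  obtain ⟨n, hn⟩ : ∃ n : ℕ, ∀ F ∈ U n, ∀ G ∈ U n, T F G ∈ ((n : ℂ) + 1) • W := by
    by_contra! hcon
    choose F hF G hG hFG using hcon
    have hF0 : Tendsto F atTop (𝓝 0) := hU.tendsto hF
    have hG0 : Tendsto G atTop (𝓝 0) := hU.tendsto hG
    have hb := isBoundedFamily_iff.1 (h (F ∘ ULift.down) (G ∘ ULift.down)
      ((isBoundedFamily_iff.2 (hF0.isVonNBounded_range ℂ)).comp ULift.down)
      ((isBoundedFamily_iff.2 (hG0.isVonNBounded_range ℂ)).comp ULift.down))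
    obtain ⟨r, hr⟩ := (hb hW).exists_pos
    obtain ⟨n, hn⟩ := exists_nat_ge r
    refine hFG n (hr.2 ((n : ℂ) + 1) ?_ ⟨⟨n⟩, rfl⟩)
    have e : ‖(n : ℂ) + 1‖ = n + 1 := by
      exact_mod_cast Complex.norm_natCast (n + 1)
    rw [e]
    linarith
  have hn0 : (n : ℂ) + 1 ≠ 0 := by exact_mod_cast Nat.succ_ne_zero n
  have hV : ((n : ℂ) + 1)⁻¹ • U n ∈ 𝓝 (0 : SchwartzSpace Θ) :=
    (set_smul_mem_nhds_zero_iff (inv_ne_zero hn0)).2 (hU.mem n)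
  rw [nhds_prod_eq]
  filter_upwards [prod_mem_prod hV (hU.mem n)]
  rintro ⟨F, G⟩ ⟨⟨F', hF', rfl⟩, hG⟩
  obtain ⟨w, hw, e⟩ := hn F' hF' G hG
  simp only [hT, map_smul, LinearMap.smul_apply]
  rw [← e]
  simpa [smul_smul, hn0] using hw

end SchwartzSpace

end SchwartzTopology

/-! ### Schwartz functions as functions of two variables -/

section Lift

variable {Ξ A : Type*} [NormedAddCommGroup Ξ] [NonUnitalCStarAlgebra A]

/-- The weight `(1 + ‖X‖) ^ (-N)`. -/
def decay (N : ℕ) (X : Ξ) : ℝ := ((1 + ‖X‖) ^ N)⁻¹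

lemma decay_pos (N : ℕ) (X : Ξ) : 0 < decay N X := by
  unfold decay
  positivity

lemma decay_nonneg (N : ℕ) (X : Ξ) : 0 ≤ decay N X := (decay_pos N X).le

lemma continuous_decay (N : ℕ) : Continuous (decay N : Ξ → ℝ) := by
  unfold decay
  exact Continuous.inv₀ (by fun_prop) fun X => by positivity

lemma decay_add (M N : ℕ) (X : Ξ) : decay (M + N) X = decay M X * decay N X := by
  unfold decay
  rw [pow_add, mul_inv]

@[simp] lemma decay_neg (N : ℕ) (X : Ξ) : decay N (-X) = decay N X := by
  unfold decay
  rw [norm_neg]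

@[simp] lemma decay_zero_left (X : Ξ) : decay 0 X = 1 := by simp [decay]

/-- Peetre's inequality. -/
lemma decay_mul_decay_le (N : ℕ) (X Y : Ξ) : decay N X * decay N Y ≤ decay N (X + Y) := by
  unfold decay
  rw [← mul_inv, ← mul_pow]
  gcongr
  nlinarith [norm_add_le X Y, norm_nonneg X, norm_nonneg Y]

lemma le_mul_decay {N : ℕ} {X : Ξ} {a C D : ℝ} (ha : 0 ≤ a) (hC : ‖X‖ ^ 0 * a ≤ C)
    (hD : ‖X‖ ^ N * a ≤ D) : a ≤ 2 ^ (N - 1) * (C + D) * decay N X := by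
  rw [decay, ← div_eq_mul_inv, le_div_iff₀ (by positivity), mul_comm]
  calc (1 + ‖X‖) ^ N * a ≤ 2 ^ (N - 1) * (1 ^ N + ‖X‖ ^ N) * a := by
        gcongr
        exact add_pow_le zero_le_one (norm_nonneg X) N
    _ = 2 ^ (N - 1) * (‖X‖ ^ 0 * a + ‖X‖ ^ N * a) := by ring
    _ ≤ 2 ^ (N - 1) * (C + D) := by gcongr

lemma norm_pow_mul_le_of_le_mul_decay {N : ℕ} {X : Ξ} {a C : ℝ} (ha : 0 ≤ a)
    (h : a ≤ C * decay N X) : ‖X‖ ^ N * a ≤ C := by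
  rw [decay, ← div_eq_mul_inv, le_div_iff₀ (by positivity), mul_comm] at h
  refine le_trans ?_ h
  gcongr
  linarith

variable [NormedSpace ℝ Ξ] {Θ : VectorAction Ξ A}

/-- Rapid decrease in terms of `IsSymbol` implies the bounds that define Schwartz functions. -/
lemma IsSymbol.norm_pow_mul_le {ι E : Type*} [NormedAddCommGroup E] [NormedSpace ℝ E]
    {u : ι → Ξ → E} {N : ℕ} (h : IsSymbol ⊤ (fun _ => decay N) u) (m : ℕ) :
    ∃ C : ℝ, 0 ≤ C ∧ ∀ i X, ‖X‖ ^ N * ‖_root_.iteratedFDeriv ℝ m (u i) X‖ ≤ C := by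
  obtain ⟨C, hC, hb⟩ := h.bound m le_top
  exact ⟨C, hC, fun i X => norm_pow_mul_le_of_le_mul_decay (norm_nonneg _) (hb i X)⟩

namespace SchwartzSpace

/-- `F` as a function of two variables, `(X, Y) ↦ Θ_Y (F X)`. -/
def lift (F : SchwartzSpace Θ) (p : Ξ × Ξ) : A := Θ.aut p.2 (F p.1)

lemma isBoundedFamily_iff_isSymbol {ι : Type*} {F : ι → SchwartzSpace Θ} :
    IsBoundedFamily F ↔
      ∀ k N, IsSymbol ⊤ (fun _ => decay N) fun i => ⇑(toSchwartz k (F i)) := by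
  constructor
  · intro h k N
    refine ⟨fun i => (toSchwartz k (F i)).smooth', fun _ => decay_nonneg N, fun m _ => ?_⟩
    obtain ⟨C, hC⟩ := h k 0 m
    obtain ⟨C', hC'⟩ := h k N m
    refine ⟨|2 ^ (N - 1) * (C + C')|, abs_nonneg _, fun i X => ?_⟩
    exact (le_mul_decay (norm_nonneg _) (hC i X) (hC' i X)).trans
      (mul_le_mul_of_nonneg_right (le_abs_self _) (decay_nonneg N X))
  · intro h k N m
    obtain ⟨C, -, hC⟩ := (h k N).norm_pow_mul_le m
    exact ⟨C, hC⟩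

end SchwartzSpace

/-! ### The generators of the action and the partial derivatives -/

/-- The derivative of the orbit of a smooth vector in the direction `v`. -/
lemma exists_generator (v : Ξ) (f : smoothVectors Θ) :
    ∃ g : smoothVectors Θ, (∀ Y, HasFDerivAt (fun Y => Θ.aut Y (f : A))
      (fderiv ℝ (fun Y => Θ.aut Y (f : A)) Y) Y ∧
        fderiv ℝ (fun Y => Θ.aut Y (f : A)) Y v = Θ.aut Y g) ∧
      ∀ k, jet Θ k g = (ContinuousLinearMap.compContinuousMultilinearMapL ℝ (fun _ : Fin k => Ξ)
        (Ξ →L[ℝ] A) A (ContinuousLinearMap.apply ℝ A v))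
          (continuousMultilinearCurryRightEquiv' ℝ k Ξ A (jet Θ (k + 1) f)) := by
  set u : Ξ → A := fun Y => Θ.aut Y (f : A) with hu
  have hu' : ContDiff ℝ ∞ u := contDiff_orbit f
  have hd : ∀ Y, HasFDerivAt u (fderiv ℝ u Y) Y := fun Y =>
    (hu'.differentiable (by simp) Y).hasFDerivAt
  have hD : ContDiff ℝ ∞ (fderiv ℝ u) := hu'.fderiv_right (by simp)
  have h1 : ∀ Y, fderiv ℝ u Y v = Θ.aut Y (fderiv ℝ u 0 v) := by
    intro Y
    have e : fderiv ℝ (fun X => u (Y + X)) 0 = fderiv ℝ u Y := by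
      rw [fderiv_comp_add_left, add_zero]
    have e2 : (fun X => u (Y + X)) = Θ.autR Y ∘ u := by
      funext X
      simp [hu, Θ.aut_add]
    rw [← e, e2, ((Θ.autR Y).hasFDerivAt.comp 0 (hd 0)).fderiv]
    rfl
  have h2 : (fun Y => Θ.aut Y (fderiv ℝ u 0 v)) = ContinuousLinearMap.apply ℝ A v ∘ fderiv ℝ u :=
    funext fun Y => (h1 Y).symm
  have h3 : fderiv ℝ u 0 v ∈ smoothVectors Θ := by
    change ContDiff ℝ ∞ fun Y => Θ.aut Y (fderiv ℝ u 0 v)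
    rw [h2]
    exact (ContinuousLinearMap.apply ℝ A v).contDiff.comp hD
  refine ⟨⟨_, h3⟩, fun Y => ⟨hd Y, h1 Y⟩, fun k => ?_⟩
  change iteratedFDeriv ℝ k (fun Y => Θ.aut Y (fderiv ℝ u 0 v)) 0 = _
  rw [h2, (ContinuousLinearMap.apply ℝ A v).iteratedFDeriv_comp_left hD.contDiffAt
    (by exact_mod_cast le_top)]
  have e : jet Θ (k + 1) f = (continuousMultilinearCurryRightEquiv' ℝ k Ξ A).symm
      (iteratedFDeriv ℝ k (fderiv ℝ u) 0) := iteratedFDeriv_succ_eq_comp_right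
  rw [e, LinearIsometryEquiv.apply_symm_apply]
  rfl

/-- The generator of the action in the direction `v`, `δ_v f = ∂_v [Θ_Y(f)]_{Y = 0}`. -/
def generator (v : Ξ) (f : smoothVectors Θ) : smoothVectors Θ := (exists_generator v f).choose

lemma fderiv_orbit_apply (v : Ξ) (f : smoothVectors Θ) (Y : Ξ) :
    fderiv ℝ (fun Y => Θ.aut Y (f : A)) Y v = Θ.aut Y (generator v f) :=
  ((exists_generator v f).choose_spec.1 Y).2

lemma hasFDerivAt_orbit (f : smoothVectors Θ) (Y : Ξ) :
    HasFDerivAt (fun Y => Θ.aut Y (f : A)) (fderiv ℝ (fun Y => Θ.aut Y (f : A)) Y) Y :=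
  ((exists_generator 0 f).choose_spec.1 Y).1

/-- The linear map that turns `jet Θ (k + 1) f` into `jet Θ k (generator v f)`. -/
def generatorJet (k : ℕ) (v : Ξ) : ContinuousMultilinearMap ℝ (fun _ : Fin (k + 1) => Ξ) A →L[ℝ]
    ContinuousMultilinearMap ℝ (fun _ : Fin k => Ξ) A :=
  (ContinuousLinearMap.compContinuousMultilinearMapL ℝ (fun _ : Fin k => Ξ)
    (Ξ →L[ℝ] A) A (ContinuousLinearMap.apply ℝ A v)).comp
    (continuousMultilinearCurryRightEquiv' ℝ k Ξ A).toContinuousLinearEquiv.toContinuousLinearMap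

lemma jet_generator (v : Ξ) (f : smoothVectors Θ) (k : ℕ) :
    jet Θ k (generator v f) = generatorJet k v (jet Θ (k + 1) f) :=
  (exists_generator v f).choose_spec.2 k

namespace SchwartzSpace

/-- The generator in the direction `v` applied to the values of `F`. -/
def gen (v : Ξ) (F : SchwartzSpace Θ) : SchwartzSpace Θ :=
  ofJets (fun X => generator v (F.1 X)) fun k =>
    ⟨SchwartzMap.postcompCLM (generatorJet k v) (toSchwartz (k + 1) F), fun X =>
      (jet_generator v (F.1 X) k).symm⟩

lemma IsBoundedFamily.gen {ι : Type*} {F : ι → SchwartzSpace Θ} (h : IsBoundedFamily F) (v : Ξ) :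
    IsBoundedFamily fun i => (F i).gen v := by
  rw [isBoundedFamily_iff_isSymbol] at h ⊢
  intro k N
  have h1 := (h (k + 1) N).clm (generatorJet k v)
  convert h1 using 2 with i
  funext X
  exact jet_generator v ((F i).1 X) k

lemma exists_partial (v : Ξ) (F : SchwartzSpace Θ) :
    ∃ G : SchwartzSpace Θ, ∀ k X, toSchwartz k G X = fderiv ℝ (toSchwartz k F) X v := by
  have hd : ∀ k X, HasFDerivAt (toSchwartz k F) (fderiv ℝ (toSchwartz k F) X) X := fun k X =>
    (toSchwartz k F).differentiableAt.hasFDerivAt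
  have h1 : ∀ X, ∃ g : smoothVectors Θ, ∀ k, jet Θ k g = fderiv ℝ (toSchwartz k F) X v := by
    intro X
    -- the difference quotients converge together with all their jets
    refine exists_jet_eq_of_tendsto (J := fun k => fderiv ℝ (toSchwartz k F) X v) (l := 𝓝[≠] (0 : ℝ))
      (f := fun t => ((t⁻¹ : ℝ) : ℂ) • (F.1 (X + t • v) - F.1 X)) fun k => ?_
    have h2 := ((hd k X).hasLineDerivAt v).tendsto_slope_zero
    refine h2.congr fun t => ?_
    rw [map_smul, map_sub, Complex.coe_smul]
    rfl
  choose g hg using h1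
  refine ⟨ofJets g fun k => ⟨SchwartzMap.evalCLM ℝ Ξ _ v
    (SchwartzMap.fderivCLM ℝ Ξ _ (toSchwartz k F)), fun X => (hg X k).symm⟩, fun k X => hg X k⟩

/-- The derivative of `F` in the direction `v`. -/
def partialDeriv (v : Ξ) (F : SchwartzSpace Θ) : SchwartzSpace Θ := (exists_partial v F).choose

lemma toSchwartz_partialDeriv (v : Ξ) (F : SchwartzSpace Θ) (k : ℕ) (X : Ξ) :
    toSchwartz k (F.partialDeriv v) X = fderiv ℝ (toSchwartz k F) X v :=
  (exists_partial v F).choose_spec k X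

lemma IsBoundedFamily.partialDeriv {ι : Type*} {F : ι → SchwartzSpace Θ} (h : IsBoundedFamily F)
    (v : Ξ) : IsBoundedFamily fun i => (F i).partialDeriv v := by
  rw [isBoundedFamily_iff_isSymbol] at h ⊢
  intro k N
  have h1 := (IsSymbol.fderiv (n := ⊤) (h k N)).clm (ContinuousLinearMap.apply ℝ _ v)
  convert h1 using 2 with i
  funext X
  exact toSchwartz_partialDeriv v (F i) k X

lemma eval_eq (F : SchwartzSpace Θ) :
    (F : Ξ → A) = fun X => continuousMultilinearCurryFin0 ℝ Ξ A (toSchwartz 0 F X) :=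
  funext fun X => (jet_zero_curry0 (F.1 X)).symm

lemma norm_toSchwartz_zero (F : SchwartzSpace Θ) (X : Ξ) : ‖toSchwartz 0 F X‖ = ‖F X‖ :=
  norm_jet_zero (F.1 X)

lemma hasFDerivAt_eval (F : SchwartzSpace Θ) (X : Ξ) : HasFDerivAt F (fderiv ℝ F X) X := by
  have : DifferentiableAt ℝ F X := by
    rw [eval_eq]
    exact (continuousMultilinearCurryFin0 ℝ Ξ A).toContinuousLinearEquiv.differentiableAt.comp X
      (toSchwartz 0 F).differentiableAt
  exact this.hasFDerivAt

lemma fderiv_eval_apply (F : SchwartzSpace Θ) (X v : Ξ) : fderiv ℝ F X v = F.partialDeriv v X := by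
  have h1 : HasFDerivAt F ((continuousMultilinearCurryFin0 ℝ Ξ
      A).toContinuousLinearEquiv.toContinuousLinearMap.comp (fderiv ℝ (toSchwartz 0 F) X)) X := by
    rw [eval_eq F]
    exact (continuousMultilinearCurryFin0 ℝ Ξ
      A).toContinuousLinearEquiv.toContinuousLinearMap.hasFDerivAt.comp X
        ((toSchwartz 0 F).differentiableAt (x := X)).hasFDerivAt
  rw [h1.fderiv, eval_eq]
  simp only [toSchwartz_partialDeriv]
  rfl

lemma continuous_eval (F : SchwartzSpace Θ) : Continuous F :=
  continuous_iff_continuousAt.2 fun X => (hasFDerivAt_eval F X).continuousAt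

lemma continuous_lift (F : SchwartzSpace Θ) : Continuous F.lift :=
  Θ.continuous_aut continuous_snd (F.continuous_eval.comp continuous_fst)

/-- A linear map with values in a Banach space, written in coordinates. -/
lemma _root_.ContinuousLinearMap.sum_smulRight_coord {V E J : Type*} [Fintype J]
    [NormedAddCommGroup V]
    [NormedSpace ℝ V] [FiniteDimensional ℝ V] [NormedAddCommGroup E] [NormedSpace ℝ E]
    (b : Module.Basis J ℝ V) (L : V →L[ℝ] E) :
    ∑ j, (LinearMap.toContinuousLinearMap (b.coord j)).smulRight (L (b j)) = L := by
  ext v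
  conv_rhs => rw [← b.sum_repr v, map_sum]
  simp

/-- A rapidly decreasing function of two variables of the form `Θ_Y (f X)` comes from a Schwartz
function. -/
theorem exists_of_isSymbol {ι : Type*} {f : ι → Ξ → A}
    (h : ∀ N, IsSymbol ⊤ (fun _ p => decay N p.1) fun i (p : Ξ × Ξ) => Θ.aut p.2 (f i p.1)) :
    ∃ F : ι → SchwartzSpace Θ, (∀ i X, F i X = f i X) ∧ IsBoundedFamily F := by
  have hsm : ∀ i X, f i X ∈ smoothVectors Θ := fun i X =>
    ((h 0).smooth i).comp (contDiff_const.prodMk contDiff_id)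
  -- the jets of the values are partial derivatives in the second variable
  have hjet : ∀ (k i X), jet Θ k ⟨f i X, hsm i X⟩ =
      ContinuousMultilinearMap.compContinuousLinearMapL
        (fun _ : Fin k => ContinuousLinearMap.inr ℝ Ξ Ξ)
        (iteratedFDeriv ℝ k (fun p : Ξ × Ξ => Θ.aut p.2 (f i p.1))
          (ContinuousLinearMap.inl ℝ Ξ Ξ X)) := by
    intro k i X
    have e : (fun Y => Θ.aut Y (f i X)) = (fun p : Ξ × Ξ => Θ.aut (p + (X, 0)).2 (f i (p + (X, 0)).1)) ∘
        ContinuousLinearMap.inr ℝ Ξ Ξ := by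
      funext Y
      simp
    have hs' : ContDiff ℝ ∞ fun p : Ξ × Ξ => Θ.aut (p + (X, 0)).2 (f i (p + (X, 0)).1) :=
      ((h 0).smooth i).comp (contDiff_id.add contDiff_const)
    change iteratedFDeriv ℝ k (fun Y => Θ.aut Y (f i X)) 0 = _
    rw [e, (ContinuousLinearMap.inr ℝ Ξ Ξ).iteratedFDeriv_comp_right hs' 0
      (by exact_mod_cast le_top),
      iteratedFDeriv_comp_add_right k (X, 0) _ (f := fun p : Ξ × Ξ => Θ.aut p.2 (f i p.1))]
    simp
  have hS : ∀ k N, IsSymbol ⊤ (fun _ => decay N) fun i X => jet Θ k ⟨f i X, hsm i X⟩ := by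
    intro k N
    simp only [hjet]
    exact (((h N).iteratedFDeriv k).comp_clm (ContinuousLinearMap.inl ℝ Ξ Ξ)).clm _
  have hdec : ∀ k i, ∀ N m : ℕ, ∃ C : ℝ, ∀ X : Ξ,
      ‖X‖ ^ N * ‖iteratedFDeriv ℝ m (fun X => jet Θ k ⟨f i X, hsm i X⟩) X‖ ≤ C := by
    intro k i N m
    obtain ⟨C, -, hC⟩ := (hS k N).norm_pow_mul_le m
    exact ⟨C, hC i⟩
  refine ⟨fun i => ⟨fun X => ⟨f i X, hsm i X⟩, fun k => ⟨(hS k 0).smooth i, hdec k i⟩⟩,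
    fun i X => rfl, isBoundedFamily_iff_isSymbol.2 fun k N => hS k N⟩

variable [FiniteDimensional ℝ Ξ]

/-- The partial derivatives of the lift of `F` are lifts of `partialDeriv v F` and `gen v F`. -/
lemma hasFDerivAt_lift (F : SchwartzSpace Θ) (p : Ξ × Ξ) :
    HasFDerivAt F.lift
      (∑ j, (((LinearMap.toContinuousLinearMap ((Module.finBasis ℝ Ξ).coord j)).comp
        (ContinuousLinearMap.fst ℝ Ξ Ξ)).smulRight
          ((F.partialDeriv (Module.finBasis ℝ Ξ j)).lift p) +
        ((LinearMap.toContinuousLinearMap ((Module.finBasis ℝ Ξ).coord j)).comp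
        (ContinuousLinearMap.snd ℝ Ξ Ξ)).smulRight
          ((F.gen (Module.finBasis ℝ Ξ j)).lift p))) p := by
  set b := Module.finBasis ℝ Ξ
  let f₁ : Ξ → Ξ → Ξ →L[ℝ] A := fun X Y => (Θ.autR Y).comp (fderiv ℝ F X)
  let f₂ : Ξ → Ξ → Ξ →L[ℝ] A := fun X Y => fderiv ℝ (fun Y => Θ.aut Y (F X)) Y
  have e₁ : ∀ X Y, f₁ X Y = ∑ j, (LinearMap.toContinuousLinearMap (b.coord j)).smulRight
      ((F.partialDeriv (b j)).lift (X, Y)) := by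
    intro X Y
    rw [← (f₁ X Y).sum_smulRight_coord b]
    refine Finset.sum_congr rfl fun j _ => ?_
    congr 1
    change Θ.aut Y (fderiv ℝ F X (b j)) = _
    rw [fderiv_eval_apply]
    rfl
  have e₂ : ∀ X Y, f₂ X Y = ∑ j, (LinearMap.toContinuousLinearMap (b.coord j)).smulRight
      ((F.gen (b j)).lift (X, Y)) := by
    intro X Y
    rw [← (f₂ X Y).sum_smulRight_coord b]
    refine Finset.sum_congr rfl fun j _ => ?_
    congr 1
    exact fderiv_orbit_apply (b j) (F.1 X) Y
  have hc : ∀ G : Fin (Module.finrank ℝ Ξ) → SchwartzSpace Θ,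
      Continuous fun q : Ξ × Ξ => ∑ j, (LinearMap.toContinuousLinearMap (b.coord j)).smulRight
      ((G j).lift q) := fun G => continuous_finsetSum _ fun j _ =>
    (ContinuousLinearMap.smulRightL ℝ Ξ A
      (LinearMap.toContinuousLinearMap (b.coord j))).continuous.comp (G j).continuous_lift
  have h := hasStrictFDerivAt_uncurry_coprod (𝕜 := ℝ) (u := p) (f := fun X Y => Θ.aut Y (F X))
    (f₁ := f₁) (f₂ := f₂) (Eventually.of_forall fun q =>
      (Θ.autR q.2).hasFDerivAt.comp q.1 (F.hasFDerivAt_eval q.1))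
    (Eventually.of_forall fun q => hasFDerivAt_orbit (F.1 q.1) q.2)
    (by
      have : (↿f₁) = fun q : Ξ × Ξ => _ := funext fun q => e₁ q.1 q.2
      rw [this]
      exact (hc fun j => F.partialDeriv (b j)).continuousAt)
    (by
      have : (↿f₂) = fun q : Ξ × Ξ => _ := funext fun q => e₂ q.1 q.2
      rw [this]
      exact (hc fun j => F.gen (b j)).continuousAt)
  refine h.hasFDerivAt.congr_fderiv ?_
  symm
  change _ = (f₁ p.1 p.2).coprod (f₂ p.1 p.2)
  rw [e₁, e₂, Finset.sum_add_distrib]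
  ext v <;> simp

lemma contDiff_lift (F : SchwartzSpace Θ) : ContDiff ℝ ∞ F.lift := by
  refine contDiff_infty.2 fun n => ?_
  induction n generalizing F with
  | zero => exact contDiff_zero.2 F.continuous_lift
  | succ n ih =>
    push_cast
    refine contDiff_succ_iff_hasFDerivAt.2 ⟨_, ?_, F.hasFDerivAt_lift⟩
    refine ContDiff.sum fun j _ => ContDiff.add ?_ ?_
    · exact (ContinuousLinearMap.smulRightL ℝ (Ξ × Ξ) A _).contDiff.comp (ih _)
    · exact (ContinuousLinearMap.smulRightL ℝ (Ξ × Ξ) A _).contDiff.comp (ih _)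

/-- Conversely, bounded families of Schwartz functions are, as functions of two variables, rapidly decreasing
in the first one, uniformly in the second one, with all their derivatives. -/
theorem IsBoundedFamily.isSymbol_lift {ι : Type*} {F : ι → SchwartzSpace Θ}
    (h : IsBoundedFamily F) (N : ℕ) :
    IsSymbol ⊤ (fun _ p => decay N p.1) fun i => (F i).lift := by
  have h0 : ∀ (i : ι) (p : Ξ × Ξ), 0 ≤ decay N p.1 := fun _ p => decay_nonneg N p.1
  have hb : ∀ F : ι → SchwartzSpace Θ, IsBoundedFamily F →
      ∃ C, ∀ i (p : Ξ × Ξ), ‖(F i).lift p‖ ≤ C * decay N p.1 := by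
    intro F h
    obtain ⟨C, hC, hb⟩ := (isBoundedFamily_iff_isSymbol.1 h 0 N).norm_le
    refine ⟨C, fun i p => ?_⟩
    rw [lift, Θ.norm_aut, ← norm_toSchwartz_zero]
    exact hb i p.1
  refine IsSymbol.of_forall_nat fun m => ?_
  induction m generalizing F with
  | zero =>
    obtain ⟨C, hC⟩ := hb F h
    refine ⟨fun i => (F i).contDiff_lift, h0, fun k hk => ⟨|C|, abs_nonneg C, fun i p => ?_⟩⟩
    obtain rfl : k = 0 := by simpa using hk
    rw [norm_iteratedFDeriv_zero]
    exact (hC i p).trans (mul_le_mul_of_nonneg_right (le_abs_self C) (h0 i p))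
  | succ m ih =>
    obtain ⟨C, hC⟩ := hb F h
    push_cast
    refine IsSymbol.of_fderiv (fun i => (F i).contDiff_lift) hC ?_
    have e : (fun i => fderiv ℝ (F i).lift) = fun i p => _ :=
      funext fun i => funext fun p => ((F i).hasFDerivAt_lift p).fderiv
    rw [e]
    refine IsSymbol.sum h0 _ fun j _ => IsSymbol.add ?_ ?_
    · exact (ih (h.partialDeriv _)).clm (ContinuousLinearMap.smulRightL ℝ (Ξ × Ξ) A _)
    · exact (ih (h.gen _)).clm (ContinuousLinearMap.smulRightL ℝ (Ξ × Ξ) A _)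

end SchwartzSpace

end Lift

/-! ### The twist, the Fourier transform, the canonical mapping and the involutions -/

section CanonicalMap

universe u v

variable {Ξ : Type u} {A : Type v} [NormedAddCommGroup Ξ] [NonUnitalCStarAlgebra A]
  [NormedSpace ℝ Ξ] {Θ : VectorAction Ξ A}

namespace SchwartzSpace

lemma isBoundedFamily_of_isSymbol_lift {ι : Type*} {G : ι → SchwartzSpace Θ}
    (h : ∀ N, IsSymbol ⊤ (fun _ p => decay N p.1) fun i => (G i).lift) : IsBoundedFamily G := by
  obtain ⟨F, hF, hb⟩ := exists_of_isSymbol (f := fun i X => G i X) h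
  have : F = G := funext fun i => ext_eval (hF i)
  rwa [← this]

/-- Construction of continuous linear operators on `𝒮(Ξ; A^∞)`. -/
theorem exists_continuousLinearMap (t : SchwartzSpace Θ → Ξ → A)
    (hadd : ∀ F G X, t (F + G) X = t F X + t G X) (hsmul : ∀ (c : ℂ) F X, t (c • F) X = c • t F X)
    (h : ∀ {ι : Type (max u v)} (F : ι → SchwartzSpace Θ), IsBoundedFamily F → ∀ N,
      IsSymbol ⊤ (fun _ p => decay N p.1) fun i (p : Ξ × Ξ) => Θ.aut p.2 (t (F i) p.1)) :
    ∃ T : SchwartzSpace Θ →L[ℂ] SchwartzSpace Θ, ∀ F X, T F X = t F X := by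
  have h1 : ∀ F : SchwartzSpace Θ, ∃ G : SchwartzSpace Θ, ∀ X, G X = t F X := by
    intro F
    obtain ⟨G, hG, -⟩ := exists_of_isSymbol (f := fun _ => t F)
      (h (fun _ : PUnit => F) (isBoundedFamily_const F))
    exact ⟨G PUnit.unit, hG _⟩
  choose T hT using h1
  let T' : SchwartzSpace Θ →ₗ[ℂ] SchwartzSpace Θ :=
    { toFun := T
      map_add' := fun F G => ext_eval fun X => by
        rw [add_eval, hT, hT, hT, hadd]
      map_smul' := fun c F => ext_eval fun X => by
        rw [RingHom.id_apply, smul_eval, hT, hT, hsmul] }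
  refine ⟨⟨T', continuous_of_isBoundedFamily T' fun F hF => isBoundedFamily_of_isSymbol_lift ?_⟩, hT⟩
  intro N
  have e : (fun i => (T' (F i)).lift) = fun i (p : Ξ × Ξ) => Θ.aut p.2 (t (F i) p.1) := by
    funext i p
    rw [lift]
    exact congrArg (Θ.aut p.2) (hT _ _)
  rw [e]
  exact h F hF N

/-! ### The involutions -/

/-- The adjoint as a real-linear map. -/
def starR (A : Type*) [NonUnitalCStarAlgebra A] : A →L[ℝ] A :=
  (starL' ℝ : A ≃L[ℝ] A).toContinuousLinearMap

@[simp] lemma starR_apply (a : A) : starR A a = star a := rfl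

lemma exists_jet_star (f : smoothVectors Θ) : ∃ g : smoothVectors Θ, (g : A) = star (f : A) ∧
    ∀ k, jet Θ k g = ContinuousLinearMap.compContinuousMultilinearMapL ℝ (fun _ : Fin k => Ξ) A A
      (starR A) (jet Θ k f) := by
  have e : (fun X => Θ.aut X (star (f : A))) = starR A ∘ fun X => Θ.aut X (f : A) := by
    funext X
    simp [map_star]
  have hs : star (f : A) ∈ smoothVectors Θ := by
    change ContDiff ℝ ∞ fun X => Θ.aut X (star (f : A))
    rw [e]
    exact (starR A).contDiff.comp (contDiff_orbit f)
  refine ⟨⟨_, hs⟩, rfl, fun k => ?_⟩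
  change iteratedFDeriv ℝ k (fun X => Θ.aut X (star (f : A))) 0 = _
  rw [e, (starR A).iteratedFDeriv_comp_left (contDiff_orbit f).contDiffAt
    (by exact_mod_cast le_top)]
  rfl

variable (Θ) in
/-- The pointwise adjoint `F ↦ F(·)^*`, a continuous operation on `𝒮(Ξ; A^∞)`. -/
theorem exists_star : ∃ S : SchwartzSpace Θ → SchwartzSpace Θ,
    Continuous S ∧ ∀ F X, S F X = star (F X) := by
  choose s hs hj using exists_jet_star (Θ := Θ)
  have h : ∀ k (F : SchwartzSpace Θ) X, SchwartzMap.postcompCLM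
      (ContinuousLinearMap.compContinuousMultilinearMapL ℝ (fun _ : Fin k => Ξ) A A (starR A))
        (toSchwartz k F) X = jet Θ k (s (F.1 X)) := fun k F X => (hj _ k).symm
  refine ⟨fun F => ofJets (fun X => s (F.1 X)) fun k => ⟨_, h k F⟩, ?_, fun F X => hs _⟩
  refine continuous_iff.2 fun k => ?_
  have e : (fun F : SchwartzSpace Θ => toSchwartz k
      (ofJets (fun X => s (F.1 X)) fun k => ⟨_, h k F⟩)) = fun F => SchwartzMap.postcompCLM
      (ContinuousLinearMap.compContinuousMultilinearMapL ℝ (fun _ : Fin k => Ξ) A A (starR A))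
        (toSchwartz k F) := by
    funext F
    ext1 X
    exact (h k F X).symm
  rw [e]
  exact (ContinuousLinearMap.continuous _).comp (continuous_toSchwartz k)

lemma exists_norm_eval_le {ι : Type*} {F : ι → SchwartzSpace Θ} (h : IsBoundedFamily F) (N : ℕ) :
    ∃ C : ℝ, 0 ≤ C ∧ ∀ i X, ‖F i X‖ ≤ C * decay N X := by
  obtain ⟨C, hC, hb⟩ := (isBoundedFamily_iff_isSymbol.1 h 0 N).norm_le
  refine ⟨C, hC, fun i X => ?_⟩
  rw [← norm_toSchwartz_zero]
  exact hb i X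

variable [FiniteDimensional ℝ Ξ]

/-- Operators that are given by a linear change of variables in the function of two variables. -/
theorem exists_comp_lift (L : (Ξ × Ξ) →L[ℝ] (Ξ × Ξ)) (hL : ∀ p, ‖(L p).1‖ = ‖p.1‖)
    (t : SchwartzSpace Θ → Ξ → A)
    (h : ∀ F (p : Ξ × Ξ), Θ.aut p.2 (t F p.1) = F.lift (L p)) :
    ∃ T : SchwartzSpace Θ →L[ℂ] SchwartzSpace Θ, ∀ F X, T F X = t F X := by
  have h0 : ∀ F X, t F X = F.lift (L (X, 0)) := fun F X => by
    rw [← h, Θ.aut_zero]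
  refine exists_continuousLinearMap t (fun F G X => ?_) (fun c F X => ?_) fun F hF N => ?_
  · simp only [h0, lift, add_eval, map_add]
  · simp only [h0, lift, smul_eval, map_smul]
  · simp only [h]
    refine ((hF.isSymbol_lift N).comp_clm L).mono 1 (fun i p => ?_) fun _ p => decay_nonneg N p.1
    rw [one_mul, decay, decay, hL]

/-! ### The twist -/

variable (Θ) in
/-- The automorphism `[C(F)](X) = Θ_X[F(X)]` of the Fréchet space `𝒮(Ξ; A^∞)`. -/
theorem exists_twist : ∃ C : SchwartzSpace Θ ≃L[ℂ] SchwartzSpace Θ,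
    (∀ F X, C F X = Θ.aut X (F X)) ∧ ∀ F X, C.symm F X = Θ.aut (-X) (F X) := by
  obtain ⟨T, hT⟩ := exists_comp_lift (Θ := Θ)
    ((ContinuousLinearMap.fst ℝ Ξ Ξ).prod
      (ContinuousLinearMap.snd ℝ Ξ Ξ + ContinuousLinearMap.fst ℝ Ξ Ξ)) (fun p => rfl)
    (fun F X => Θ.aut X (F X)) fun F p => by
      rw [← Θ.aut_add]
      rfl
  obtain ⟨S, hS⟩ := exists_comp_lift (Θ := Θ)
    ((ContinuousLinearMap.fst ℝ Ξ Ξ).prod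
      (ContinuousLinearMap.snd ℝ Ξ Ξ - ContinuousLinearMap.fst ℝ Ξ Ξ)) (fun p => rfl)
    (fun F X => Θ.aut (-X) (F X)) fun F p => by
      rw [← Θ.aut_add, ← sub_eq_add_neg]
      rfl
  refine ⟨ContinuousLinearEquiv.equivOfInverse T S
    (fun F => ext_eval fun X => ?_) (fun F => ext_eval fun X => ?_), hT, hS⟩
  · rw [hS, hT, Θ.aut_neg_aut]
  · rw [hT, hS, Θ.aut_aut_neg]

variable (Θ) in
/-- The reflection `F ↦ F(-·)`. -/
theorem exists_reflection : ∃ R : SchwartzSpace Θ →L[ℂ] SchwartzSpace Θ, ∀ F X, R F X = F (-X) :=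
  exists_comp_lift (Θ := Θ)
    ((-ContinuousLinearMap.fst ℝ Ξ Ξ).prod (ContinuousLinearMap.snd ℝ Ξ Ξ))
    (fun p => norm_neg p.1) (fun F X => F (-X)) fun _ _ => rfl

/-! ### Integrability -/

section Integrable

variable [MeasurableSpace Ξ] [BorelSpace Ξ] {μ : Measure Ξ} [μ.IsAddHaarMeasure]

lemma _root_.RieffelCrossed.integrable_decay {N : ℕ} (hN : Module.finrank ℝ Ξ + 1 ≤ N) :
    Integrable (decay N : Ξ → ℝ) μ := by
  have h := integrable_zpow (V := Ξ) (μ := μ) (m := -(N : ℤ)) (by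
    have : (Module.finrank ℝ Ξ + 1 : ℤ) ≤ N := by exact_mod_cast hN
    linarith)
  refine h.congr (ae_of_all _ fun X => ?_)
  simp [decay]

lemma integrable_eval (F : SchwartzSpace Θ) : Integrable F μ := by
  obtain ⟨C, hC, h⟩ := exists_norm_eval_le (isBoundedFamily_const (ι := Unit) F)
    (Module.finrank ℝ Ξ + 1)
  exact ((integrable_decay le_rfl).const_mul C).mono' F.continuous_eval.aestronglyMeasurable
    (ae_of_all _ (h ()))

end Integrable

/-! ### The Fourier transform -/

variable {σ : LinearMap.BilinForm ℝ Ξ}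

lemma continuous_symp {T : Type*} [TopologicalSpace T] {f g : T → Ξ} (hf : Continuous f)
    (hg : Continuous g) : Continuous fun t => (σ (f t) (g t) : ℂ) := by
  have h : Continuous fun t => σ (f t) (g t) := by
    let B : Ξ →L[ℝ] Ξ →L[ℝ] ℝ := LinearMap.toContinuousLinearMap
      ((LinearMap.toContinuousLinearMap : (Ξ →ₗ[ℝ] ℝ) ≃ₗ[ℝ] Ξ →L[ℝ] ℝ).toLinearMap.comp σ)
    exact (B.continuous.comp hf).clm_apply hg
  exact Complex.continuous_ofReal.comp h

lemma _root_.Complex.norm_exp_neg_I_mul_ofReal (x : ℝ) :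
    ‖Complex.exp (-Complex.I * (x : ℂ))‖ = 1 := by
  rw [Complex.norm_exp]
  simp

lemma continuous_fourierKernel (X : Ξ) :
    Continuous fun Y => Complex.exp (-Complex.I * (σ X Y : ℂ)) :=
  Complex.continuous_exp.comp (continuous_const.mul (continuous_symp continuous_const continuous_id))

variable [MeasurableSpace Ξ] [BorelSpace Ξ]

/-- The Fourier transform has values in the smooth vectors, since the jets can be taken under the
integral. -/
lemma exists_fourier_value (hσ : σ.Nondegenerate) (F : SchwartzSpace Θ) (X : Ξ) :
    ∃ g : smoothVectors Θ, (g : A) = sympFourier σ F X ∧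
      ∀ k, jet Θ k g = fourierSymp hσ (toSchwartz k F) X := by
  have := isAddHaarMeasure_sympMeasure hσ
  have h1 : ∀ k Y, jet Θ k (Complex.exp (-Complex.I * (σ X Y : ℂ)) • F.1 Y) =
      Complex.exp (-Complex.I * (σ X Y : ℂ)) • toSchwartz k F Y := fun k Y => map_smul _ _ _
  obtain ⟨g, hg, hj⟩ := exists_jet_eq_integral (μ := sympMeasure σ)
    (f := fun Y => Complex.exp (-Complex.I * (σ X Y : ℂ)) • F.1 Y) fun k => by
      simp only [h1]
      refine (toSchwartz k F).integrable.norm.mono' ((continuous_fourierKernel X).smul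
        (toSchwartz k F).continuous).aestronglyMeasurable (ae_of_all _ fun Y => ?_)
      rw [norm_smul, Complex.norm_exp_neg_I_mul_ofReal, one_mul]
  refine ⟨g, hg, fun k => ?_⟩
  rw [hj, fourierSymp_apply]
  simp only [h1]

/-- The partial symplectic Fourier transform on `𝒮(Ξ; A^∞)`. -/
theorem exists_fourier (hσ_alt : σ.IsAlt) (hσ : σ.Nondegenerate) :
    ∃ T : SchwartzSpace Θ ≃L[ℂ] SchwartzSpace Θ,
      (∀ F X, T F X = sympFourier σ F X) ∧ T.symm = T := by
  choose g hg hj using exists_fourier_value (Θ := Θ) hσ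
  let T : SchwartzSpace Θ → SchwartzSpace Θ := fun F =>
    ofJets (g F) fun k => ⟨fourierSymp hσ (toSchwartz k F), fun X => (hj F X k).symm⟩
  have hT : ∀ F X, T F X = sympFourier σ F X := hg
  have hTk : ∀ k F, toSchwartz k (T F) = fourierSymp hσ (toSchwartz k F) := fun k F => by
    ext1 X
    exact hj F X k
  have hext : ∀ F G : SchwartzSpace Θ, (∀ k, toSchwartz k F = toSchwartz k G) → F = G :=
    fun F G h => injective_jets (funext h)
  have hTT : ∀ F, T (T F) = F := fun F => hext _ _ fun k => by
    rw [hTk, hTk, fourierSymp_fourierSymp hσ_alt]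
  have hTc : Continuous T := continuous_iff.2 fun k => by
    simp only [hTk]
    exact (fourierSymp hσ).continuous.comp (continuous_toSchwartz k)
  let T' : SchwartzSpace Θ →L[ℂ] SchwartzSpace Θ :=
    { toFun := T
      map_add' := fun F G => hext _ _ fun k => by
        rw [hTk]
        have e := fun F G => map_add (toSchwartzₗ Θ k) F G
        refine (congrArg (fourierSymp hσ) (e F G)).trans ?_
        rw [map_add]
        refine Eq.trans ?_ (e (T F) (T G)).symm
        exact congrArg₂ (· + ·) (hTk k F).symm (hTk k G).symm
      map_smul' := fun c F => hext _ _ fun k => by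
        rw [hTk]
        have e := fun F => map_smul (toSchwartzₗ Θ k) c F
        refine (congrArg (fourierSymp hσ) (e F)).trans ?_
        rw [map_smul]
        refine Eq.trans ?_ (e (T F)).symm
        exact congrArg (c • ·) (hTk k F).symm
      cont := hTc }
  exact ⟨ContinuousLinearEquiv.equivOfInverse T' T' hTT hTT, hT, rfl⟩

/-- The canonical mapping `M = 𝔉 ∘ C` as an automorphism of the Fréchet space `𝒮(Ξ; A^∞)`. -/
theorem exists_canonicalMap (hσ_alt : σ.IsAlt) (hσ : σ.Nondegenerate) :
    ∃ M : SchwartzSpace Θ ≃L[ℂ] SchwartzSpace Θ,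
      (∀ F X, M F X = canonicalMap σ Θ F X) ∧ ∀ G X, M.symm G X = canonicalMapInv σ Θ G X := by
  have := isAddHaarMeasure_sympMeasure hσ
  obtain ⟨C, hC, hC'⟩ := exists_twist Θ
  obtain ⟨T, hT, hT'⟩ := exists_fourier (Θ := Θ) hσ_alt hσ
  refine ⟨C.trans T, fun F X => ?_, fun G X => ?_⟩
  · rw [ContinuousLinearEquiv.trans_apply, hT]
    have : (C F : Ξ → A) = twist Θ F := funext (hC F)
    rw [this]
    rfl
  · have e : (C.trans T).symm G = C.symm (T G) := by
      conv_rhs => rw [← hT']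
      rfl
    rw [e, hC', hT, sympFourier, canonicalMapInv]
    have h := (Θ.autL (-X)).integral_comp_comm (μ := sympMeasure σ)
      (φ := fun Y => Complex.exp (-Complex.I * (σ X Y : ℂ)) • G Y) (by
        refine (integrable_eval G).norm.mono' ((continuous_fourierKernel X).smul
          G.continuous_eval).aestronglyMeasurable (ae_of_all _ fun Y => ?_)
        rw [norm_smul, Complex.norm_exp_neg_I_mul_ofReal, one_mul])
    simp only [map_smul, VectorAction.autL_apply] at h
    exact h.symm

lemma integrable_twist (hσ : σ.Nondegenerate) (F : SchwartzSpace Θ) :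
    Integrable (twist Θ F) (sympMeasure σ) := by
  have := isAddHaarMeasure_sympMeasure hσ
  obtain ⟨C, hC, -⟩ := exists_twist Θ
  have : (C F : Ξ → A) = twist Θ F := funext (hC F)
  rw [← this]
  exact integrable_eval _

lemma canonicalMap_star (F : Ξ → A) (X : Ξ) :
    canonicalMap σ Θ (boxStar F) X = diamondStar (canonicalMap σ Θ F) X := by
  rw [diamondStar, canonicalMap, canonicalMap, sympFourier, sympFourier]
  have h := (starL' ℝ : A ≃L[ℝ] A).integral_comp_comm (μ := sympMeasure σ)
    (fun Y => Complex.exp (-Complex.I * (σ (-X) Y : ℂ)) • twist Θ F Y)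
  refine Eq.trans ?_ h
  congr 1
  funext Y
  rw [starL'_apply, star_smul]
  congr 1
  · rw [Complex.star_def, ← Complex.exp_conj]
    congr 1
    simp
  · simp [twist, boxStar, map_star]

end SchwartzSpace

end CanonicalMap

/-! ### The phases -/

section Phases

lemma IsSymbol.congr {ι W E : Type*} [NormedAddCommGroup W] [NormedSpace ℝ W]
    [NormedAddCommGroup E] [NormedSpace ℝ E] {n : ℕ∞} {ρ : ι → W → ℝ} {u v : ι → W → E}
    (h : IsSymbol n ρ u) (he : ∀ i x, v i x = u i x) : IsSymbol n ρ v := by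
  have : v = u := funext fun i => funext (he i)
  rwa [this]

variable {Ξ : Type*} [NormedAddCommGroup Ξ] [NormedSpace ℝ Ξ]

/-- The oscillating factors are symbols of all finite orders of differentiability, with
polynomially growing bounds. -/
lemma isSymbol_quadPhase {ι V : Type*} [NormedAddCommGroup V] [NormedSpace ℝ V]
    {Q : V →L[ℝ] V →L[ℝ] ℝ} (hs : ∀ p q, Q p q = Q q p) (m : ℕ) :
    IsSymbol (m : ℕ∞) (fun (_ : ι) p => (1 + ‖p‖) ^ m) (fun _ => quadPhase Q) := by
  have h0 : ∀ (m : ℕ) (_ : ι) (p : V), 0 ≤ (1 + ‖p‖) ^ m := fun m _ p => by positivity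
  induction m with
  | zero =>
    refine ⟨fun _ => contDiff_quadPhase, h0 0, fun k hk => ⟨1, zero_le_one, fun i p => ?_⟩⟩
    obtain rfl : k = 0 := by simpa using hk
    rw [norm_iteratedFDeriv_zero, norm_quadPhase]
    simp
  | succ m ih =>
    push_cast
    refine IsSymbol.of_fderiv (C := 1) (fun _ => contDiff_quadPhase) (fun i p => ?_) ?_
    · rw [norm_quadPhase, one_mul]
      exact one_le_pow₀ (by linarith [norm_nonneg p])
    · have h1 := (IsSymbol.linear (ι := ι) Q).of_le (m := (m : ℕ∞)) le_top
      have h2 := (h1.clm ((ContinuousLinearMap.compL ℝ V ℝ ℂ)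
        (Complex.I • Complex.ofRealCLM))).bilin
        (ContinuousLinearMap.lsmul ℝ ℂ : ℂ →L[ℝ] (V →L[ℝ] ℂ) →L[ℝ] (V →L[ℝ] ℂ)).flip ih
      refine (h2.congr fun _ p => ?_).mono 1 (fun i p => ?_) (h0 (m + 1))
      · ext v
        rw [fderiv_quadPhase hs]
        simp
        ring
      rw [one_mul, pow_succ']

/-- The cocycle identity. -/
lemma cocycle_mul_cocycle {σ : LinearMap.BilinForm ℝ Ξ} (hσ : σ.IsAlt) (X Y Z : Ξ) :
    cocycle σ X Y * cocycle σ Y Z = cocycle σ X Z * cocycle σ (X - Z) (Y - Z) := by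
  simp only [cocycle, ← Complex.exp_add, ← mul_add, ← Complex.ofReal_add]
  congr 3
  have h1 := hσ Z
  have h2 := hσ.neg_eq Z Y
  simp only [map_sub, LinearMap.sub_apply]
  linarith

variable [FiniteDimensional ℝ Ξ]

/-- The symplectic form as a continuous bilinear map. -/
def sympL (σ : LinearMap.BilinForm ℝ Ξ) : Ξ →L[ℝ] Ξ →L[ℝ] ℝ := LinearMap.toContinuousLinearMap
  ((LinearMap.toContinuousLinearMap : (Ξ →ₗ[ℝ] ℝ) ≃ₗ[ℝ] Ξ →L[ℝ] ℝ).toLinearMap.comp σ)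

/-- The symmetric bilinear form on `Ξ × Ξ` with the quadratic form `2 c σ(X, Y)`. -/
def sympQuad (σ : LinearMap.BilinForm ℝ Ξ) (c : ℝ) : Ξ × Ξ →L[ℝ] Ξ × Ξ →L[ℝ] ℝ :=
  c • ((sympL σ).bilinearComp (ContinuousLinearMap.fst ℝ Ξ Ξ) (ContinuousLinearMap.snd ℝ Ξ Ξ) +
    ((sympL σ).bilinearComp (ContinuousLinearMap.fst ℝ Ξ Ξ) (ContinuousLinearMap.snd ℝ Ξ Ξ)).flip)

lemma sympQuad_apply (σ : LinearMap.BilinForm ℝ Ξ) (c : ℝ) (p q : Ξ × Ξ) :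
    sympQuad σ c p q = c * (σ p.1 q.2 + σ q.1 p.2) := rfl

lemma sympQuad_comm (σ : LinearMap.BilinForm ℝ Ξ) (c : ℝ) (p q : Ξ × Ξ) :
    sympQuad σ c p q = sympQuad σ c q p := by
  rw [sympQuad_apply, sympQuad_apply, add_comm]

lemma quadPhase_sympQuad (σ : LinearMap.BilinForm ℝ Ξ) (c : ℝ) (p : Ξ × Ξ) :
    quadPhase (sympQuad σ c) p = Complex.exp (Complex.I * ((c * σ p.1 p.2 : ℝ) : ℂ)) := by
  rw [quadPhase, sympQuad_apply]
  congr 3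
  ring

lemma cocycle_eq (σ : LinearMap.BilinForm ℝ Ξ) (X Y : Ξ) :
    cocycle σ X Y = quadPhase (sympQuad σ (-(1 / 2))) (X, Y) := by
  rw [quadPhase_sympQuad, cocycle]
  congr 1
  push_cast
  ring

lemma norm_cocycle (σ : LinearMap.BilinForm ℝ Ξ) (X Y : Ξ) : ‖cocycle σ X Y‖ = 1 := by
  rw [cocycle_eq, norm_quadPhase]

lemma continuous_cocycle (σ : LinearMap.BilinForm ℝ Ξ) {T : Type*} [TopologicalSpace T]
    {f g : T → Ξ} (hf : Continuous f) (hg : Continuous g) :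
    Continuous fun t => cocycle σ (f t) (g t) := by
  simp only [cocycle_eq]
  exact contDiff_quadPhase.continuous.comp (hf.prodMk hg)

end Phases

/-! ### The product `⋄` -/

section Diamond

universe u v

variable {Ξ : Type u} {A : Type v} [NormedAddCommGroup Ξ] [NonUnitalCStarAlgebra A]
  [NormedSpace ℝ Ξ] {Θ : VectorAction Ξ A} {σ : LinearMap.BilinForm ℝ Ξ}

namespace SchwartzSpace

lemma aut_diamondIntegrand (F G : Ξ → A) (X Y Z : Ξ) :
    Θ.aut Z (diamondIntegrand σ Θ F G X Y) = cocycle σ X Y •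
      (Θ.aut (Z + (1 / 2 : ℝ) • (Y - X)) (F Y) * Θ.aut (Z + (1 / 2 : ℝ) • Y) (G (X - Y))) := by
  rw [diamondIntegrand, map_smul, map_mul, Θ.aut_add, Θ.aut_add]

variable [FiniteDimensional ℝ Ξ]

/-- The integrand of `⋄` and all its derivatives decrease rapidly in `X` and in the variable of
integration: the decrease of `F(Y)` and `G(X - Y)` compensates the polynomial growth of the
derivatives of the cocycle. -/
lemma isSymbol_diamondIntegrand {ι : Type*} {F G : ι → SchwartzSpace Θ} (hF : IsBoundedFamily F)
    (hG : IsBoundedFamily G) (M N : ℕ) :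
    IsSymbol ⊤ (fun _ q => decay N q.1.1 * decay M q.2) fun i (q : (Ξ × Ξ) × Ξ) =>
      Θ.aut q.1.2 (diamondIntegrand σ Θ (F i) (G i) q.1.1 q.2) := by
  refine IsSymbol.of_forall_nat fun m => ?_
  let X : (Ξ × Ξ) × Ξ →L[ℝ] Ξ :=
    (ContinuousLinearMap.fst ℝ Ξ Ξ).comp (ContinuousLinearMap.fst ℝ (Ξ × Ξ) Ξ)
  let Z : (Ξ × Ξ) × Ξ →L[ℝ] Ξ :=
    (ContinuousLinearMap.snd ℝ Ξ Ξ).comp (ContinuousLinearMap.fst ℝ (Ξ × Ξ) Ξ)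
  let Y : (Ξ × Ξ) × Ξ →L[ℝ] Ξ := ContinuousLinearMap.snd ℝ (Ξ × Ξ) Ξ
  -- powers `m` make up for the cocycle, `N` for the decrease in `X`, `M` for the one in `Y`
  have h1 := ((isSymbol_quadPhase (ι := ι) (sympQuad_comm σ (-(1 / 2))) m).comp_clm (X.prod Y))
  have h2 := (((hF.isSymbol_lift (m + N + M)).comp_clm
    (Y.prod (Z + (1 / 2 : ℝ) • (Y - X)))).of_le (m := (m : ℕ∞)) le_top)
  have h3 := (((hG.isSymbol_lift (m + N)).comp_clm
    ((X - Y).prod (Z + (1 / 2 : ℝ) • Y))).of_le (m := (m : ℕ∞)) le_top)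
  have h4 := h1.bilin (ContinuousLinearMap.lsmul ℝ ℂ : ℂ →L[ℝ] A →L[ℝ] A)
    (h2.bilin (ContinuousLinearMap.mul ℝ A) h3)
  refine (h4.congr fun i q => ?_).mono 1 (fun i q => ?_) fun _ q => mul_nonneg (decay_nonneg _ _) (decay_nonneg _ _)
  · rw [aut_diamondIntegrand, cocycle_eq]
    exact rfl
  obtain ⟨⟨x, z⟩, y⟩ := q
  change (1 + ‖(x, y)‖) ^ m * (decay (m + N + M) y * decay (m + N) (x - y)) ≤
    1 * (decay N x * decay M y)
  have k1 : decay N y * decay N (x - y) ≤ decay N x := by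
    simpa using decay_mul_decay_le N y (x - y)
  -- both `1 + ‖x‖` and `1 + ‖y‖` are at most `(1 + ‖y‖) (1 + ‖x - y‖)`
  have k2 : (1 + ‖(x, y)‖) ^ m * (decay m y * decay m (x - y)) ≤ 1 := by
    rw [decay, decay, ← mul_inv, ← mul_pow, ← div_eq_mul_inv, div_le_one (by positivity)]
    refine pow_le_pow_left₀ (by positivity) ?_ m
    have := norm_add_le y (x - y)
    rw [add_sub_cancel] at this
    rw [Prod.norm_mk]
    rcases max_choice ‖x‖ ‖y‖ with h | h <;> rw [h] <;>
      nlinarith [norm_nonneg y, norm_nonneg (x - y)]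
  rw [decay_add, decay_add, decay_add]
  calc _ = ((1 + ‖(x, y)‖) ^ m * (decay m y * decay m (x - y))) *
        ((decay N y * decay N (x - y)) * decay M y) := by ring
    _ ≤ 1 * (decay N x * decay M y) := by
        have a1 := decay_nonneg N y
        have a2 := decay_nonneg N (x - y)
        have a3 := decay_nonneg M y
        gcongr

lemma exists_norm_diamondIntegrand_le (F G : SchwartzSpace Θ) (M : ℕ) :
    ∃ C : ℝ, ∀ X Y, ‖diamondIntegrand σ Θ F G X Y‖ ≤ C * decay M Y := by
  obtain ⟨C, hC, h⟩ := (isSymbol_diamondIntegrand (σ := σ)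
    (isBoundedFamily_const (ι := Unit) F) (isBoundedFamily_const G) M 0).norm_le
  refine ⟨C, fun X Y => ?_⟩
  have := h () ((X, 0), Y)
  simpa [Θ.aut_zero] using this

lemma continuous_diamondIntegrand (F G : SchwartzSpace Θ) :
    Continuous fun p : Ξ × Ξ => diamondIntegrand σ Θ F G p.1 p.2 :=
  (continuous_cocycle σ continuous_fst continuous_snd).smul
    ((Θ.continuous_aut (by fun_prop) (F.continuous_eval.comp continuous_snd)).mul
      (Θ.continuous_aut (by fun_prop) (G.continuous_eval.comp (by fun_prop))))

variable [MeasurableSpace Ξ] [BorelSpace Ξ]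

lemma integrable_diamondIntegrand (hσ : σ.Nondegenerate) (F G : SchwartzSpace Θ) (X : Ξ) :
    Integrable (diamondIntegrand σ Θ F G X) (sympMeasure σ) := by
  have := isAddHaarMeasure_sympMeasure hσ
  obtain ⟨C, hC⟩ := exists_norm_diamondIntegrand_le (σ := σ) F G (Module.finrank ℝ Ξ + 1)
  exact ((integrable_decay le_rfl).const_mul C).mono'
    ((continuous_diamondIntegrand F G).comp (Continuous.prodMk_right X)).aestronglyMeasurable
    (ae_of_all _ (hC X))

lemma aut_diamondMul (hσ : σ.Nondegenerate) (F G : SchwartzSpace Θ) (X Z : Ξ) :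
    Θ.aut Z (diamondMul σ Θ F G X) =
      ∫ Y, Θ.aut Z (diamondIntegrand σ Θ F G X Y) ∂(sympMeasure σ) :=
  ((Θ.autR Z).integral_comp_comm (integrable_diamondIntegrand hσ F G X)).symm

lemma isSymbol_diamondMul (hσ : σ.Nondegenerate) {ι : Type*} {F G : ι → SchwartzSpace Θ}
    (hF : IsBoundedFamily F) (hG : IsBoundedFamily G) (N : ℕ) :
    IsSymbol ⊤ (fun _ p => decay N p.1) fun i (p : Ξ × Ξ) =>
      Θ.aut p.2 (diamondMul σ Θ (F i) (G i) p.1) := by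
  have := isAddHaarMeasure_sympMeasure hσ
  simp only [aut_diamondMul hσ]
  exact (isSymbol_diamondIntegrand hF hG (Module.finrank ℝ Ξ + 1) N).integral
    (ρ := fun _ p => decay N p.1) (r := decay (Module.finrank ℝ Ξ + 1))
    (g := fun i (q : (Ξ × Ξ) × Ξ) => Θ.aut q.1.2 (diamondIntegrand σ Θ (F i) (G i) q.1.1 q.2))
    (fun _ => (continuous_decay N).comp continuous_fst) (fun _ p => decay_nonneg N p.1)
    (integrable_decay le_rfl)

/-- The product `⋄` on `𝒮(Ξ; A^∞)`. -/
theorem exists_diamond (hσ : σ.Nondegenerate) :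
    ∃ T : SchwartzSpace Θ →ₗ[ℂ] SchwartzSpace Θ →ₗ[ℂ] SchwartzSpace Θ,
      (∀ F G X, T F G X = diamondMul σ Θ F G X) ∧
      Continuous fun p : SchwartzSpace Θ × SchwartzSpace Θ => T p.1 p.2 := by
  have h1 : ∀ F G : SchwartzSpace Θ, ∃ H : SchwartzSpace Θ, ∀ X, H X = diamondMul σ Θ F G X := by
    intro F G
    obtain ⟨H, hH, -⟩ := exists_of_isSymbol (f := fun _ => diamondMul σ Θ F G)
      (isSymbol_diamondMul hσ (isBoundedFamily_const (ι := Unit) F) (isBoundedFamily_const G))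
    exact ⟨H (), hH ()⟩
  choose T hT using h1
  have i := fun F G : SchwartzSpace Θ => integrable_diamondIntegrand hσ F G
  let T' : SchwartzSpace Θ →ₗ[ℂ] SchwartzSpace Θ →ₗ[ℂ] SchwartzSpace Θ :=
    LinearMap.mk₂ ℂ T
      (fun F F' G => ext_eval fun X => by
        rw [add_eval, hT, hT, hT, diamondMul, diamondMul, diamondMul,
          ← integral_add (i F G X) (i F' G X)]
        congr 1
        funext Y
        simp only [diamondIntegrand, add_eval, map_add, add_mul, smul_add])
      (fun c F G => ext_eval fun X => by
        rw [smul_eval, hT, hT, diamondMul, diamondMul, ← integral_smul]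
        congr 1
        funext Y
        simp only [diamondIntegrand, smul_eval, map_smul, smul_mul_assoc]
        rw [smul_comm])
      (fun F G G' => ext_eval fun X => by
        rw [add_eval, hT, hT, hT, diamondMul, diamondMul, diamondMul,
          ← integral_add (i F G X) (i F G' X)]
        congr 1
        funext Y
        simp only [diamondIntegrand, add_eval, map_add, mul_add, smul_add])
      (fun c F G => ext_eval fun X => by
        rw [smul_eval, hT, hT, diamondMul, diamondMul, ← integral_smul]
        congr 1
        funext Y
        simp only [diamondIntegrand, smul_eval, map_smul, mul_smul_comm]
        rw [smul_comm])
  refine ⟨T', hT, continuous_of_isBoundedFamily₂ T' fun F G hF hG =>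
    isBoundedFamily_of_isSymbol_lift fun N => ?_⟩
  have e : (fun i => (T' (F i) (G i)).lift) = fun i (p : Ξ × Ξ) =>
      Θ.aut p.2 (diamondMul σ Θ (F i) (G i) p.1) := by
    funext i p
    exact congrArg (Θ.aut p.2) (hT _ _ _)
  rw [e]
  exact isSymbol_diamondMul hσ hF hG N

/-- The double integral behind both ways of bracketing a product of three factors. -/
lemma integrable_triple (hσ : σ.Nondegenerate) (F G H : SchwartzSpace Θ) (X : Ξ) :
    Integrable (fun p : Ξ × Ξ => (cocycle σ X p.1 * cocycle σ p.1 p.2) •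
      (Θ.aut ((1 / 2 : ℝ) • (p.2 - X)) (F p.2) *
        Θ.aut ((1 / 2 : ℝ) • (p.2 + p.1 - X)) (G (p.1 - p.2)) *
        Θ.aut ((1 / 2 : ℝ) • p.1) (H (X - p.1)))) ((sympMeasure σ).prod (sympMeasure σ)) := by
  have := isAddHaarMeasure_sympMeasure hσ
  set M := Module.finrank ℝ Ξ + 1
  obtain ⟨C, hC0, hC⟩ := exists_norm_eval_le (isBoundedFamily_const (ι := Unit) F) (M + M)
  obtain ⟨C', hC0', hC'⟩ := exists_norm_eval_le (isBoundedFamily_const (ι := Unit) G) M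
  obtain ⟨K, hK0, hK⟩ := exists_norm_eval_le (isBoundedFamily_const (ι := Unit) H) 0
  have hi : Integrable (fun p : Ξ × Ξ => C * C' * K * (decay M p.1 * decay M p.2))
      ((sympMeasure σ).prod (sympMeasure σ)) :=
    ((integrable_decay le_rfl).mul_prod (integrable_decay le_rfl)).const_mul _
  refine hi.mono' (Continuous.aestronglyMeasurable ?_) (ae_of_all _ fun p => ?_)
  · refine ((continuous_cocycle σ continuous_const continuous_fst).mul
      (continuous_cocycle σ continuous_fst continuous_snd)).smul
        (((Θ.continuous_aut (by fun_prop) (F.continuous_eval.comp continuous_snd)).mul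
        (Θ.continuous_aut (by fun_prop) (G.continuous_eval.comp (by fun_prop)))).mul
        (Θ.continuous_aut (by fun_prop) (H.continuous_eval.comp (by fun_prop))))
  · obtain ⟨y, z⟩ := p
    rw [norm_smul, norm_mul, norm_cocycle, norm_cocycle, one_mul, one_mul]
    refine (norm_mul_le _ _).trans ?_
    refine (mul_le_mul_of_nonneg_right (norm_mul_le _ _) (norm_nonneg _)).trans ?_
    rw [Θ.norm_aut, Θ.norm_aut, Θ.norm_aut]
    have k1 : decay M z * decay M (y - z) ≤ decay M y := by
      simpa using decay_mul_decay_le M z (y - z)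
    have k2 := hC () z
    have k3 := hC' () (y - z)
    have k4 := hK () (X - y)
    rw [decay_add] at k2
    rw [decay_zero_left, mul_one] at k4
    have a1 := decay_nonneg M z
    have a2 := decay_nonneg M (y - z)
    calc ‖F z‖ * ‖G (y - z)‖ * ‖H (X - y)‖
        ≤ (C * (decay M z * decay M z)) * (C' * decay M (y - z)) * K := by gcongr
      _ = C * C' * K * ((decay M z * decay M (y - z)) * decay M z) := by ring
      _ ≤ C * C' * K * (decay M y * decay M z) := by gcongr

/-- Associativity: Fubini's theorem, a translation and the cocycle identity. -/
lemma diamondMul_assoc (hσ_alt : σ.IsAlt) (hσ : σ.Nondegenerate) (F G H FG GH : SchwartzSpace Θ)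
    (hFG : ∀ X, FG X = diamondMul σ Θ F G X) (hGH : ∀ X, GH X = diamondMul σ Θ G H X) (X : Ξ) :
    diamondMul σ Θ FG H X = diamondMul σ Θ F GH X := by
  have := isAddHaarMeasure_sympMeasure hσ
  have hI := integral_integral_swap (f := fun Y Z => (cocycle σ X Y * cocycle σ Y Z) •
      (Θ.aut ((1 / 2 : ℝ) • (Z - X)) (F Z) * Θ.aut ((1 / 2 : ℝ) • (Z + Y - X)) (G (Y - Z)) *
        Θ.aut ((1 / 2 : ℝ) • Y) (H (X - Y)))) (integrable_triple hσ F G H X)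
  refine Eq.trans ?_ (hI.trans ?_)
  · rw [diamondMul]
    congr 1
    funext Y
    have i1 : Integrable (fun Z => Θ.aut ((1 / 2 : ℝ) • (Y - X)) (diamondIntegrand σ Θ F G Y Z))
        (sympMeasure σ) := (Θ.autR _).integrable_comp (integrable_diamondIntegrand hσ F G Y)
    rw [diamondIntegrand, hFG, aut_diamondMul hσ, ← integral_mul_const_of_integrable i1,
      ← integral_smul]
    congr 1
    funext Z
    rw [aut_diamondIntegrand, smul_mul_assoc, smul_smul]
    congr 6
    · module
    · module
  · rw [diamondMul]
    congr 1
    funext Z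
    have i1 : Integrable (fun Y => Θ.aut ((1 / 2 : ℝ) • Z)
        (diamondIntegrand σ Θ G H (X - Z) (Y - Z))) (sympMeasure σ) :=
      (Θ.autR _).integrable_comp ((integrable_diamondIntegrand hσ G H (X - Z)).comp_sub_right Z)
    rw [diamondIntegrand, hGH, aut_diamondMul hσ, ← integral_sub_right_eq_self
      (fun Y => Θ.aut ((1 / 2 : ℝ) • Z) (diamondIntegrand σ Θ G H (X - Z) Y)) Z,
      ← integral_const_mul_of_integrable i1, ← integral_smul]
    congr 1
    funext Y
    rw [aut_diamondIntegrand, mul_smul_comm, smul_smul, cocycle_mul_cocycle hσ_alt, mul_assoc,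
      sub_sub_sub_cancel_right]
    congr 5
    · module
    · module
    · abel

lemma diamondMul_star (hσ_alt : σ.IsAlt) (hσ : σ.Nondegenerate) (F G : Ξ → A) (X : Ξ) :
    diamondStar (diamondMul σ Θ F G) X = diamondMul σ Θ (diamondStar G) (diamondStar F) X := by
  have := isAddHaarMeasure_sympMeasure hσ
  rw [diamondStar, diamondMul, diamondMul]
  have h := (starL' ℝ : A ≃L[ℝ] A).integral_comp_comm (μ := sympMeasure σ)
    (diamondIntegrand σ Θ F G (-X))
  refine h.symm.trans ?_
  rw [← integral_sub_right_eq_self _ X]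
  congr 1
  funext Y
  rw [starL'_apply, diamondIntegrand, diamondIntegrand, star_smul, star_mul, ← map_star,
    ← map_star, diamondStar, diamondStar]
  have e1 : -X - (Y - X) = -Y := by abel
  have e2 : -(X - Y) = Y - X := by abel
  have e3 : Y - X - -X = Y := by abel
  rw [e1, e2, e3]
  congr 1
  rw [Complex.star_def, cocycle, cocycle, ← Complex.exp_conj]
  congr 1
  have e4 : σ (-X) (Y - X) = -σ X Y := by simp [map_sub, hσ_alt X]
  rw [e4]
  simp only [map_mul, map_neg, map_div₀, Complex.conj_I, Complex.conj_ofReal, Complex.ofReal_neg,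
    map_ofNat]
  ring

end SchwartzSpace

end Diamond

/-! ### The Rieffel product -/

section Rieffel

variable {Ξ A : Type*} [NormedAddCommGroup Ξ] [NormedSpace ℝ Ξ]
  [NonUnitalCStarAlgebra A] {Θ : VectorAction Ξ A} {σ : LinearMap.BilinForm ℝ Ξ}

/-- Convergence at a linear rate. -/
lemma tendsto_of_norm_sub_le_mul {E : Type*} [NormedAddCommGroup E] {f : ℝ → E} {L : E} {K : ℝ}
    (h : ∀ ε ∈ Set.Ioc (0 : ℝ) 1, ‖f ε - L‖ ≤ K * ε) : Tendsto f (𝓝[>] 0) (𝓝 L) := by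
  rw [tendsto_iff_norm_sub_tendsto_zero]
  have h1 : Tendsto (fun ε : ℝ => K * ε) (𝓝[>] 0) (𝓝 0) := by
    have : Tendsto (fun ε : ℝ => K * ε) (𝓝 0) (𝓝 (K * 0)) := tendsto_id.const_mul K
    rw [mul_zero] at this
    exact this.mono_left nhdsWithin_le_nhds
  refine squeeze_zero' (Eventually.of_forall fun _ => norm_nonneg _) ?_ h1
  filter_upwards [Ioc_mem_nhdsGT (zero_lt_one (α := ℝ))] with ε hε using h ε hε

lemma isSymbol_orbit (f : smoothVectors Θ) :
    IsSymbol ⊤ (fun (_ : Unit) (_ : Ξ) => (1 : ℝ)) fun _ X => Θ.aut X (f : A) :=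
  ⟨fun _ => contDiff_orbit f, fun _ _ => zero_le_one, fun k _ => ⟨‖jet Θ k f‖, norm_nonneg _,
    fun _ X => by
      rw [iteratedFDeriv_orbit, mul_one]
      exact norm_autR_comp_le X _⟩⟩

variable [FiniteDimensional ℝ Ξ]

/-- A cut-off function on `Ξ × Ξ` of product form. -/
lemma exists_cutoff (Ξ : Type*) [NormedAddCommGroup Ξ] [NormedSpace ℝ Ξ] [FiniteDimensional ℝ Ξ] :
    ∃ (χ₁ : 𝓢(Ξ, ℂ)) (χ : 𝓢(Ξ × Ξ, ℂ)), χ₁ 0 = 1 ∧ χ 0 = 1 ∧ ∀ p, χ p = χ₁ p.1 * χ₁ p.2 := by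
  let b : ContDiffBump (0 : Ξ) := ⟨1, 2, zero_lt_one, one_lt_two⟩
  have hb : ContDiff ℝ ∞ fun X => (b X : ℂ) := Complex.ofRealCLM.contDiff.comp b.contDiff
  have hc : HasCompactSupport fun X => (b X : ℂ) := b.hasCompactSupport.comp_left Complex.ofReal_zero
  have hbb : ContDiff ℝ ∞ fun p : Ξ × Ξ => (b p.1 : ℂ) * (b p.2 : ℂ) :=
    (hb.comp contDiff_fst).mul (hb.comp contDiff_snd)
  have hcc : HasCompactSupport fun p : Ξ × Ξ => (b p.1 : ℂ) * (b p.2 : ℂ) := by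
    refine HasCompactSupport.intro (hc.isCompact.prod hc.isCompact) fun p hp => ?_
    rw [Set.mem_prod, not_and_or] at hp
    rcases hp with h | h
    · rw [image_eq_zero_of_notMem_tsupport h, zero_mul]
    · rw [image_eq_zero_of_notMem_tsupport h, mul_zero]
  have h1 : b 0 = 1 := b.one_of_mem_closedBall (by simp [b])
  refine ⟨hc.toSchwartzMap hb, hcc.toSchwartzMap hbb, ?_, ?_, fun p => rfl⟩
  · change (b 0 : ℂ) = 1
    simp [h1]
  · change (b 0 : ℂ) * (b 0 : ℂ) = 1
    simp [h1]

lemma sympQuad_nondegenerate (hσ : σ.Nondegenerate) {c : ℝ} (hc : c ≠ 0) (p : Ξ × Ξ)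
    (h : ∀ q, sympQuad σ c p q = 0) : p = 0 := by
  simp only [sympQuad_apply, mul_eq_zero, hc, false_or] at h
  ext1
  · refine hσ.1 p.1 fun Y => ?_
    simpa using h (0, Y)
  · refine hσ.2 p.2 fun Y => ?_
    simpa using h (Y, 0)

lemma exp_two_I_mul_symp (X Y : Ξ) :
    Complex.exp (2 * Complex.I * (σ X Y : ℂ)) = quadPhase (sympQuad σ 2) (X, Y) := by
  rw [quadPhase_sympQuad]
  congr 1
  push_cast
  ring

variable [MeasurableSpace Ξ] [BorelSpace Ξ]

lemma HasOscIntegral.unique {a : Ξ × Ξ → A} {L L' : A} (h : HasOscIntegral σ a L)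
    (h' : HasOscIntegral σ a L') : L = L' := by
  obtain ⟨-, χ, -, h0, -⟩ := exists_cutoff Ξ
  exact tendsto_nhds_unique (h χ h0) (h' χ h0)

lemma HasOscIntegral.oscIntegral_eq {a : Ξ × Ξ → A} {L : A} (h : HasOscIntegral σ a L) :
    oscIntegral σ a = L := by
  have h' : ∃ L, HasOscIntegral σ a L := ⟨L, h⟩
  rw [oscIntegral, dif_pos h']
  exact h'.choose_spec.unique h

/-- The regularized integrals converge to the oscillatory integral, uniformly over families. -/
lemma exists_symp_oscillatory_limit (hσ : σ.Nondegenerate) {ι E : Type*} [NormedAddCommGroup E]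
    [NormedSpace ℂ E] [CompleteSpace E] {c : ι → ℝ} (hc : ∀ i, 0 ≤ c i) {u : ι → Ξ × Ξ → E}
    (hu : IsSymbol ⊤ (fun i _ => c i) u) :
    ∃ I : ι → E, (∃ K, ∀ i, ‖I i‖ ≤ K * c i) ∧ ∀ χ : 𝓢(Ξ × Ξ, ℂ), χ 0 = 1 →
      ∃ K, ∀ i, ∀ ε ∈ Set.Ioc (0 : ℝ) 1,
        ‖∫ p : Ξ × Ξ, (χ (ε • p) * Complex.exp (2 * Complex.I * (σ p.1 p.2 : ℂ))) • u i p
          ∂((sympMeasure σ).prod (sympMeasure σ)) - I i‖ ≤ K * c i * ε := by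
  have := isAddHaarMeasure_sympMeasure hσ
  simp only [exp_two_I_mul_symp]
  exact exists_oscillatory_limit (sympQuad_comm σ 2)
    (sympQuad_nondegenerate hσ two_ne_zero) hc hu

/-- The Rieffel product of the values of two Schwartz functions: bounds, and convergence of the
regularized integrals, uniformly in the arguments. -/
theorem exists_rieffelMul_bounds (hσ : σ.Nondegenerate) (F G : SchwartzSpace Θ) (N : ℕ) :
    ∃ I : Ξ × Ξ → A, (∀ q, HasOscIntegral σ (fun p => Θ.aut p.1 (F q.1) * Θ.aut p.2 (G q.2)) (I q)) ∧
      (∃ K, ∀ q, ‖I q‖ ≤ K * (decay N q.1 * decay N q.2)) ∧ ∀ χ : 𝓢(Ξ × Ξ, ℂ), χ 0 = 1 →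
      ∃ K, ∀ q : Ξ × Ξ, ∀ ε ∈ Set.Ioc (0 : ℝ) 1,
        ‖∫ p : Ξ × Ξ, (χ (ε • p) * Complex.exp (2 * Complex.I * (σ p.1 p.2 : ℂ))) •
            (Θ.aut p.1 (F q.1) * Θ.aut p.2 (G q.2)) ∂((sympMeasure σ).prod (sympMeasure σ)) - I q‖ ≤
          K * (decay N q.1 * decay N q.2) * ε := by
  have hc : ∀ q : Ξ × Ξ, 0 ≤ decay N q.1 * decay N q.2 := fun q =>
    mul_nonneg (decay_nonneg N _) (decay_nonneg N _)
  have hF := ((SchwartzSpace.isBoundedFamily_const (ι := Unit) F).isSymbol_lift N).comp_affine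
    (fun _ : Ξ × Ξ => ()) (fun _ => (ContinuousLinearMap.inr ℝ Ξ Ξ).comp
      (ContinuousLinearMap.fst ℝ Ξ Ξ)) (fun q => (q.1, 0)) (fun _ => le_rfl)
  have hG := ((SchwartzSpace.isBoundedFamily_const (ι := Unit) G).isSymbol_lift N).comp_affine
    (fun _ : Ξ × Ξ => ()) (fun _ => (ContinuousLinearMap.inr ℝ Ξ Ξ).comp
      (ContinuousLinearMap.snd ℝ Ξ Ξ)) (fun q => (q.2, 0)) (fun _ => le_rfl)
  have hu : IsSymbol ⊤ (fun (q : Ξ × Ξ) (_ : Ξ × Ξ) => decay N q.1 * decay N q.2)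
      fun (q : Ξ × Ξ) (p : Ξ × Ξ) => Θ.aut p.1 (F q.1) * Θ.aut p.2 (G q.2) := by
    refine ((hF.bilin (ContinuousLinearMap.mul ℝ A) hG).congr fun q p => ?_).mono 1
      (fun q p => ?_) fun q _ => hc q
    · simp [SchwartzSpace.lift]
    · simp
  obtain ⟨I, hI, hlim⟩ := exists_symp_oscillatory_limit hσ hc hu
  refine ⟨I, fun q χ hχ => ?_, hI, hlim⟩
  obtain ⟨K, hK⟩ := hlim χ hχ
  exact tendsto_of_norm_sub_le_mul (hK q)

/-- The Rieffel product of two smooth vectors exists and is a smooth vector. -/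
theorem exists_hasOscIntegral_mem (hσ : σ.Nondegenerate) (f g : smoothVectors Θ) :
    ∃ L : smoothVectors Θ,
      HasOscIntegral σ (fun p => Θ.aut p.1 (f : A) * Θ.aut p.2 (g : A)) (L : A) := by
  have := isAddHaarMeasure_sympMeasure hσ
  let B : Ξ × Ξ → A := fun p => Θ.aut p.1 (f : A) * Θ.aut p.2 (g : A)
  have hB : IsSymbol ⊤ (fun (_ : Unit) (_ : Ξ × Ξ) => (1 : ℝ)) fun _ => B := by
    refine ((((isSymbol_orbit f).comp_clm (ContinuousLinearMap.fst ℝ Ξ Ξ)).bilin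
      (ContinuousLinearMap.mul ℝ A) ((isSymbol_orbit g).comp_clm
        (ContinuousLinearMap.snd ℝ Ξ Ξ))).congr fun _ _ => rfl).mono 1 (fun _ _ => by simp)
        fun _ _ => zero_le_one
  -- the orbit of `B p` is the restriction of `B` to a translate of the diagonal
  let Δ : Ξ →L[ℝ] Ξ × Ξ := (ContinuousLinearMap.id ℝ Ξ).prod (ContinuousLinearMap.id ℝ Ξ)
  have horb : ∀ p, (fun X => Θ.aut X (B p)) = (fun q => B (q + p)) ∘ Δ := by
    intro p
    funext X
    simp only [B, map_mul, ← Θ.aut_add]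
    rfl
  have hBs : ∀ p : Ξ × Ξ, ContDiff ℝ ∞ fun q => B (q + p) := fun p =>
    (hB.smooth ()).comp (contDiff_id.add contDiff_const)
  have hmem : ∀ p, B p ∈ smoothVectors Θ := by
    intro p
    change ContDiff ℝ ∞ fun X => Θ.aut X (B p)
    rw [horb]
    exact (hBs p).comp Δ.contDiff
  let Bs : Ξ × Ξ → smoothVectors Θ := fun p => ⟨B p, hmem p⟩
  have hjet : ∀ k p, jet Θ k (Bs p) = ContinuousMultilinearMap.compContinuousLinearMapL
      (fun _ : Fin k => Δ) (iteratedFDeriv ℝ k B p) := by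
    intro k p
    change iteratedFDeriv ℝ k (fun X => Θ.aut X (B p)) 0 = _
    rw [horb, Δ.iteratedFDeriv_comp_right (hBs p) 0 (by exact_mod_cast le_top),
      iteratedFDeriv_comp_add_right]
    simp
  have hjs : ∀ k, IsSymbol ⊤ (fun (_ : Unit) (_ : Ξ × Ξ) => (1 : ℝ)) fun _ p => jet Θ k (Bs p) := by
    intro k
    simp only [hjet]
    exact (hB.iteratedFDeriv k).clm _
  choose J hJ hJl using fun k => exists_symp_oscillatory_limit hσ (fun _ => zero_le_one) (hjs k)
  obtain ⟨-, χ, -, hχ, -⟩ := exists_cutoff Ξ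
  let c : ℝ → Ξ × Ξ → ℂ := fun ε p => χ (ε • p) * Complex.exp (2 * Complex.I * (σ p.1 p.2 : ℂ))
  have hci : ∀ ε ∈ Set.Ioc (0 : ℝ) 1, Integrable (c ε) ((sympMeasure σ).prod (sympMeasure σ)) := by
    intro ε hε
    have h1 : Integrable (fun p => χ (ε • p)) ((sympMeasure σ).prod (sympMeasure σ)) :=
      χ.integrable.comp_smul hε.1.ne'
    refine h1.norm.mono' (Continuous.aestronglyMeasurable ?_) (ae_of_all _ fun p => ?_)
    · refine (χ.continuous.comp (continuous_const_smul ε)).mul ?_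
      exact Complex.continuous_exp.comp (continuous_const.mul
        (SchwartzSpace.continuous_symp continuous_fst continuous_snd))
    · rw [norm_mul, exp_two_I_mul_symp, norm_quadPhase, mul_one]
  have hexist : ∀ ε ∈ Set.Ioc (0 : ℝ) 1, ∃ h : smoothVectors Θ,
      (h : A) = ∫ p, c ε p • B p ∂((sympMeasure σ).prod (sympMeasure σ)) ∧
      ∀ k, jet Θ k h = ∫ p, c ε p • jet Θ k (Bs p) ∂((sympMeasure σ).prod (sympMeasure σ)) := by
    intro ε hε
    have hk : ∀ k p, jet Θ k (c ε p • Bs p) = c ε p • jet Θ k (Bs p) := fun k p => map_smul _ _ _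
    obtain ⟨h, h1, h2⟩ := exists_jet_eq_integral (f := fun p => c ε p • Bs p)
      (μ := (sympMeasure σ).prod (sympMeasure σ)) fun k => by
        simp only [hk]
        obtain ⟨C, hC, hb⟩ := (hjs k).norm_le
        exact (hci ε hε).smul_bdd (C * 1) ((hjs k).continuous ()).aestronglyMeasurable
          (ae_of_all _ fun p => hb () p)
    refine ⟨h, h1, fun k => ?_⟩
    rw [h2]
    simp only [hk]
  choose! h h1 h2 using hexist
  obtain ⟨L, hL⟩ := exists_jet_eq_of_tendsto (l := 𝓝[>] (0 : ℝ)) (f := h) (J := fun k => J k ())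
    fun k => by
      obtain ⟨K, hK⟩ := hJl k χ hχ
      refine tendsto_of_norm_sub_le_mul (K := K * 1) fun ε hε => ?_
      rw [h2 ε hε k]
      exact hK () ε hε
  refine ⟨L, fun χ' hχ' => ?_⟩
  obtain ⟨I, -, hI⟩ := exists_symp_oscillatory_limit hσ (fun _ => zero_le_one) hB
  have hlim : ∀ χ' : 𝓢(Ξ × Ξ, ℂ), χ' 0 = 1 → Tendsto (fun ε : ℝ => ∫ p : Ξ × Ξ,
      (χ' (ε • p) * Complex.exp (2 * Complex.I * (σ p.1 p.2 : ℂ))) • B p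
        ∂((sympMeasure σ).prod (sympMeasure σ))) (𝓝[>] 0) (𝓝 (I ())) := by
    intro χ' hχ'
    obtain ⟨K, hK⟩ := hI χ' hχ'
    exact tendsto_of_norm_sub_le_mul (K := K * 1) (hK ())
  -- the cut-off that was used to construct `L` gives the common limit of all regularizations
  have hval : (L : A) = I () := by
    refine tendsto_nhds_unique ?_ (hlim χ hχ)
    rw [← jet_zero_curry0 L, hL]
    obtain ⟨K, hK⟩ := hJl 0 χ hχ
    have h3 : Tendsto (fun ε => jet Θ 0 (h ε)) (𝓝[>] (0 : ℝ)) (𝓝 (J 0 ())) := by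
      refine tendsto_of_norm_sub_le_mul (K := K * 1) fun ε hε => ?_
      rw [h2 ε hε 0]
      exact hK () ε hε
    have h4 := ((continuousMultilinearCurryFin0 ℝ Ξ A).continuous.tendsto _).comp h3
    refine h4.congr' ?_
    filter_upwards [Ioc_mem_nhdsGT (zero_lt_one (α := ℝ))] with ε hε
    exact (jet_zero_curry0 (h ε)).trans (h1 ε hε)
  rw [hval]
  exact hlim χ' hχ'

theorem rieffelMul_mem (hσ : σ.Nondegenerate) {f g : A} (hf : f ∈ smoothVectors Θ)
    (hg : g ∈ smoothVectors Θ) :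
    (∃ L, HasOscIntegral σ (fun p => Θ.aut p.1 f * Θ.aut p.2 g) L) ∧
      rieffelMul σ Θ f g ∈ smoothVectors Θ := by
  obtain ⟨L, hL⟩ := exists_hasOscIntegral_mem hσ ⟨f, hf⟩ ⟨g, hg⟩
  refine ⟨⟨_, hL⟩, ?_⟩
  rw [rieffelMul, hL.oscIntegral_eq]
  exact (smoothVectors Θ).smul_mem _ L.2

end Rieffel

/-! ### Fourier transforms of bounded families -/

section BoundedFourier

variable {Ξ E : Type*} [NormedAddCommGroup Ξ]
  [NormedAddCommGroup E] [NormedSpace ℂ E]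

lemma decay_sub_le (N : ℕ) (X Y : Ξ) : decay N (X - Y) ≤ (1 + ‖X‖) ^ N * decay N Y := by
  have h := decay_mul_decay_le N (Y - X) X
  rw [sub_add_cancel, ← neg_sub, decay_neg] at h
  rw [decay, decay, ← div_eq_mul_inv, div_le_iff₀ (by positivity)] at h
  rwa [mul_comm]

variable [NormedSpace ℝ Ξ] {σ : LinearMap.BilinForm ℝ Ξ}

/-- The family of cut-off functions `Y ↦ χ(ε (Z - Y)) f(X - Y)`. -/
lemma isSymbol_cutoff_smul {f : Ξ → E}
    (hf : ∀ N, IsSymbol ⊤ (fun _ : Unit => decay N) fun _ => f) (χ : 𝓢(Ξ, ℂ)) (X : Ξ) (N : ℕ) :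
    IsSymbol ⊤ (fun _ => decay N) fun (i : Set.Ioc (0 : ℝ) 1 × Ξ) Y =>
      χ ((i.1 : ℝ) • (i.2 - Y)) • f (X - Y) := by
  have h1 := (IsSymbol.of_schwartz (ι := Unit) χ 0).comp_affine
    (fun _ : Set.Ioc (0 : ℝ) 1 × Ξ => ()) (fun i => (-(i.1 : ℝ)) • ContinuousLinearMap.id ℝ Ξ)
    (fun i => (i.1 : ℝ) • i.2) (K := 1) fun i => by
      rw [norm_smul, norm_neg, Real.norm_of_nonneg i.1.2.1.le]
      exact mul_le_one₀ i.1.2.2 (norm_nonneg _) ContinuousLinearMap.norm_id_le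
  have h2 := (hf N).comp_affine (fun _ : Set.Ioc (0 : ℝ) 1 × Ξ => ())
    (fun _ => -ContinuousLinearMap.id ℝ Ξ) (fun _ => X) (K := 1) fun i => by
      rw [norm_neg]
      exact ContinuousLinearMap.norm_id_le
  refine ((h1.bilin (ContinuousLinearMap.lsmul ℝ ℂ : ℂ →L[ℝ] E →L[ℝ] E) h2).congr
    fun i Y => ?_).mono ((1 + ‖X‖) ^ N) (fun i Y => ?_) fun _ => decay_nonneg N
  · simp only [ContinuousLinearMap.lsmul_apply, smul_apply, neg_apply,
      ContinuousLinearMap.id_apply]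
    congr 2
    · module
    · abel
  · simp only [pow_zero, inv_one, one_mul, neg_apply, ContinuousLinearMap.id_apply]
    rw [neg_add_eq_sub]
    exact decay_sub_le N X Y

lemma exists_norm_cutoff_integrand_le {f : Ξ → E} {N : ℕ} {C : ℝ} (hC : ∀ X, ‖f X‖ ≤ C * decay N X)
    (χ : 𝓢(Ξ, ℂ)) (X : Ξ) : ∃ C : ℝ, 0 ≤ C ∧ ∀ (ε : ℝ) (Z W Y : Ξ),
      ‖Complex.exp (-Complex.I * (σ W Y : ℂ)) • χ (ε • (Z - Y)) • f (X - Y)‖ ≤ C * decay N Y := by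
  obtain ⟨D, hD, hb⟩ := (IsSymbol.of_schwartz (ι := Unit) χ 0).norm_le
  refine ⟨D * (|C| * (1 + ‖X‖) ^ N), by positivity, fun ε Z W Y => ?_⟩
  have h1 := hb () (ε • (Z - Y))
  simp only [pow_zero, inv_one, mul_one] at h1
  rw [norm_smul, Complex.norm_exp_neg_I_mul_ofReal, one_mul, norm_smul]
  have h2 := (hC (X - Y)).trans (mul_le_mul_of_nonneg_right (le_abs_self C) (decay_nonneg N _))
  have h3 := decay_sub_le N X Y
  calc ‖χ (ε • (Z - Y))‖ * ‖f (X - Y)‖ ≤ D * (|C| * ((1 + ‖X‖) ^ N * decay N Y)) := by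
        gcongr
        refine h2.trans ?_
        gcongr
    _ = _ := by ring

variable [FiniteDimensional ℝ Ξ]

lemma continuous_cutoffFourier_integrand {f : Ξ → E} (hf : Continuous f) (χ : 𝓢(Ξ, ℂ)) (X : Ξ)
    (ε : ℝ) (Z W : Ξ) : Continuous fun Y =>
      Complex.exp (-Complex.I * (σ W Y : ℂ)) • χ (ε • (Z - Y)) • f (X - Y) :=
  (SchwartzSpace.continuous_fourierKernel W).smul
    ((χ.continuous.comp (by fun_prop)).smul (hf.comp (by fun_prop)))

variable [MeasurableSpace Ξ] [BorelSpace Ξ]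

/-- The Fourier transforms of a bounded family of Schwartz functions decrease rapidly, uniformly
over the family. -/
lemma exists_norm_fourier_le (hσ : σ.Nondegenerate) {ι : Type*} {h : ι → Ξ → E}
    (hh : ∀ N, IsSymbol ⊤ (fun _ => decay N) h) (N : ℕ) :
    ∃ K, 0 ≤ K ∧ ∀ i Z, ‖∫ Y, Complex.exp (-Complex.I * (σ Z Y : ℂ)) • h i Y ∂(sympMeasure σ)‖ ≤
      K * decay N Z := by
  have hbd := fun M m : ℕ => (hh M).norm_pow_mul_le m
  let s : ι → 𝓢(Ξ, E) := fun i => ⟨h i, (hh 0).smooth i, fun M m => by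
    obtain ⟨C, -, hC⟩ := hbd M m
    exact ⟨C, hC i⟩⟩
  have hs : Bornology.IsVonNBounded ℂ (Set.range s) := by
    rw [(schwartz_withSeminorms ℂ Ξ E).isVonNBounded_iff_seminorm_bounded]
    rintro ⟨M, m⟩
    obtain ⟨C, hC0, hC⟩ := hbd M m
    refine ⟨C + 1, by positivity, ?_⟩
    rintro _ ⟨i, rfl⟩
    have h1 : SchwartzMap.seminorm ℂ M m (s i) ≤ C :=
      SchwartzMap.seminorm_le_bound ℂ M m (s i) hC0 fun X => hC i X
    exact h1.trans_lt (lt_add_one C)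
  have hT := hs.image (fourierSymp hσ : 𝓢(Ξ, E) →L[ℂ] 𝓢(Ξ, E))
  rw [(schwartz_withSeminorms ℂ Ξ E).isVonNBounded_iff_seminorm_bounded] at hT
  have hb : ∀ M : ℕ, ∃ C, 0 < C ∧ ∀ i Z, ‖Z‖ ^ M * ‖fourierSymp hσ (s i) Z‖ ≤ C := by
    intro M
    obtain ⟨C, hC0, hC⟩ := hT (M, 0)
    refine ⟨C, hC0, fun i Z => ?_⟩
    have h1 := hC (fourierSymp hσ (s i)) (Set.mem_image_of_mem _ (Set.mem_range_self i))
    exact (SchwartzMap.norm_pow_mul_le_seminorm ℂ (fourierSymp hσ (s i)) M Z).trans h1.le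
  obtain ⟨C, hC0, hC⟩ := hb N
  obtain ⟨C', hC0', hC'⟩ := hb 0
  refine ⟨2 ^ (N - 1) * (C' + C), by positivity, fun i Z => ?_⟩
  have e : ∫ Y, Complex.exp (-Complex.I * (σ Z Y : ℂ)) • h i Y ∂(sympMeasure σ) =
      fourierSymp hσ (s i) Z := (fourierSymp_apply hσ (s i) Z).symm
  rw [e]
  exact le_mul_decay (norm_nonneg _) (hC' i Z) (hC i Z)

/-- The Fourier transform of `Y ↦ χ(ε (Z - Y)) f(X - Y)`. -/
def cutoffFourier (σ : LinearMap.BilinForm ℝ Ξ) (χ : 𝓢(Ξ, ℂ)) (f : Ξ → E) (X : Ξ) (ε : ℝ)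
    (Z W : Ξ) : E :=
  ∫ Y, Complex.exp (-Complex.I * (σ W Y : ℂ)) • χ (ε • (Z - Y)) • f (X - Y) ∂(sympMeasure σ)

lemma exists_norm_cutoffFourier_le (hσ : σ.Nondegenerate) {f : Ξ → E}
    (hf : ∀ N, IsSymbol ⊤ (fun _ : Unit => decay N) fun _ => f) (χ : 𝓢(Ξ, ℂ)) (X : Ξ) (N : ℕ) :
    ∃ K, 0 ≤ K ∧ ∀ ε ∈ Set.Ioc (0 : ℝ) 1, ∀ Z W, ‖cutoffFourier σ χ f X ε Z W‖ ≤ K * decay N W := by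
  obtain ⟨K, hK0, hK⟩ := exists_norm_fourier_le hσ (isSymbol_cutoff_smul hf χ X) N
  exact ⟨K, hK0, fun ε hε Z W => hK (⟨ε, hε⟩, Z) W⟩

/-- When the cut-off is removed, the Fourier transform of the reflected translate of `f` remains. -/
lemma tendsto_cutoffFourier (hσ : σ.Nondegenerate) {f : Ξ → E} (hf : Continuous f) {C : ℝ}
    (hC : ∀ X, ‖f X‖ ≤ C * decay (Module.finrank ℝ Ξ + 1) X)
    {χ : 𝓢(Ξ, ℂ)} (hχ : χ 0 = 1) (X Z W : Ξ) :
    Tendsto (fun ε => cutoffFourier σ χ f X ε Z W) (𝓝[>] 0)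
      (𝓝 (Complex.exp (-Complex.I * (σ W X : ℂ)) •
        ∫ Y, Complex.exp (-Complex.I * (σ (-W) Y : ℂ)) • f Y ∂(sympMeasure σ))) := by
  have := isAddHaarMeasure_sympMeasure hσ
  obtain ⟨D, hD, hb⟩ := exists_norm_cutoff_integrand_le (σ := σ) hC χ X
  have e : Complex.exp (-Complex.I * (σ W X : ℂ)) •
      ∫ Y, Complex.exp (-Complex.I * (σ (-W) Y : ℂ)) • f Y ∂(sympMeasure σ) =
      ∫ Y, Complex.exp (-Complex.I * (σ W Y : ℂ)) • f (X - Y) ∂(sympMeasure σ) := by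
    rw [← integral_smul, ← integral_sub_left_eq_self _ _ X]
    congr 1
    funext Y
    rw [smul_smul, ← Complex.exp_add]
    congr 2
    simp [map_sub]
    ring
  rw [e]
  refine tendsto_integral_filter_of_dominated_convergence
    (fun Y => D * decay (Module.finrank ℝ Ξ + 1) Y)
    (Eventually.of_forall fun ε =>
      (continuous_cutoffFourier_integrand hf χ X ε Z W).aestronglyMeasurable)
    (Eventually.of_forall fun ε => ae_of_all _ fun Y => hb ε Z W Y)
    ((integrable_decay le_rfl).const_mul D) (ae_of_all _ fun Y => ?_)
  have h1 : Tendsto (fun ε : ℝ => χ (ε • (Z - Y))) (𝓝[>] 0) (𝓝 1) := by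
    have h2 : Continuous fun ε : ℝ => χ (ε • (Z - Y)) := χ.continuous.comp (by fun_prop)
    have h3 := h2.tendsto 0
    rw [zero_smul, hχ] at h3
    exact h3.mono_left nhdsWithin_le_nhds
  have h4 := (h1.smul_const (f (X - Y))).const_smul (Complex.exp (-Complex.I * (σ W Y : ℂ)))
  rwa [one_smul] at h4

end BoundedFourier

/-! ### The product `□` -/

section Box

variable {Ξ A : Type*} [NormedAddCommGroup Ξ] [NormedSpace ℝ Ξ]
  [NonUnitalCStarAlgebra A] {Θ : VectorAction Ξ A} {σ : LinearMap.BilinForm ℝ Ξ}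

namespace SchwartzSpace

lemma isSymbol_eval (F : SchwartzSpace Θ) (N : ℕ) :
    IsSymbol ⊤ (fun _ : Unit => decay N) fun _ => (F : Ξ → A) := by
  have h := (isBoundedFamily_iff_isSymbol.1 (isBoundedFamily_const (ι := Unit) F) 0 N).clm
    (continuousMultilinearCurryFin0 ℝ Ξ A).toContinuousLinearEquiv.toContinuousLinearMap
  exact h.congr fun _ X => congrFun F.eval_eq X

/-- The rapid decrease of a rescaled Schwartz function. -/
lemma exists_norm_comp_smul_le (χ : 𝓢(Ξ, ℂ)) {ε : ℝ} (hε : ε ∈ Set.Ioc (0 : ℝ) 1) (N : ℕ) :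
    ∃ C, 0 ≤ C ∧ ∀ X, ‖χ (ε • X)‖ ≤ C * decay N X := by
  obtain ⟨C, hC, h⟩ := (IsSymbol.of_schwartz (ι := Unit) χ N).norm_le
  have hε0 := hε.1
  refine ⟨C * (ε ^ N)⁻¹, by positivity, fun X => (h () (ε • X)).trans ?_⟩
  rw [mul_assoc, decay, ← mul_inv, ← mul_pow]
  gcongr
  rw [norm_smul, Real.norm_of_nonneg hε0.le]
  linarith [hε.2]

lemma norm_exp_two_I (x : ℝ) : ‖Complex.exp (2 * Complex.I * (x : ℂ))‖ = 1 := by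
  rw [Complex.norm_exp]
  simp

lemma norm_exp_neg_two_I (x : ℝ) : ‖Complex.exp (-2 * Complex.I * (x : ℂ))‖ = 1 := by
  rw [Complex.norm_exp]
  simp

/-- The function of four variables whose integral is the regularization of `F □ G`, after the
change of variables that makes the integrals over `q` a product of two Fourier transforms. -/
def boxKernel (σ : LinearMap.BilinForm ℝ Ξ) (Θ : VectorAction Ξ A) (χ : 𝓢(Ξ × Ξ, ℂ)) (F G : Ξ → A)
    (X : Ξ) (ε : ℝ) (q p : Ξ × Ξ) : A :=
  (Complex.exp (-2 * Complex.I * (σ q.1 q.2 : ℂ)) * (χ (ε • (p - q)) *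
    Complex.exp (2 * Complex.I * (σ (p - q).1 (p - q).2 : ℂ)))) •
    (Θ.aut (p - q).1 (F (X - q.1)) * Θ.aut (p - q).2 (G (X - q.2)))

/-- For fixed `ε` the cut-off makes the fourfold integral absolutely convergent. -/
lemma exists_norm_boxKernel_le {χ₁ : 𝓢(Ξ, ℂ)} {χ : 𝓢(Ξ × Ξ, ℂ)} (hχ : ∀ p, χ p = χ₁ p.1 * χ₁ p.2)
    (F G : SchwartzSpace Θ) (X : Ξ) {ε : ℝ} (hε : ε ∈ Set.Ioc (0 : ℝ) 1) (M : ℕ) :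
    ∃ C, ∀ q p : Ξ × Ξ, ‖boxKernel σ Θ χ F G X ε q p‖ ≤
      C * ((decay M q.1 * decay M q.2) * (decay M p.1 * decay M p.2)) := by
  obtain ⟨C, hC0, hC⟩ := exists_norm_eval_le (isBoundedFamily_const (ι := Unit) F) (M + M)
  obtain ⟨D, hD0, hD⟩ := exists_norm_eval_le (isBoundedFamily_const (ι := Unit) G) (M + M)
  obtain ⟨K, hK0, hK⟩ := exists_norm_comp_smul_le χ₁ hε M
  have key : ∀ (H : Ξ → A) (C : ℝ), 0 ≤ C → (∀ Y, ‖H Y‖ ≤ C * decay (M + M) Y) → ∀ q p : Ξ,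
      ‖χ₁ (ε • (p - q))‖ * ‖H (X - q)‖ ≤
        K * C * (1 + ‖X‖) ^ (M + M) * (decay M q * decay M p) := by
    intro H C hC0 hC q p
    have h1 := hC (X - q)
    have h2 := decay_sub_le (M + M) X q
    have h3 := hK (p - q)
    have h4 : decay M q * decay M (p - q) ≤ decay M p := by
      simpa using decay_mul_decay_le M q (p - q)
    rw [decay_add M M q] at h2
    have a1 := decay_nonneg M q
    have a2 := decay_nonneg M (p - q)
    calc ‖χ₁ (ε • (p - q))‖ * ‖H (X - q)‖ ≤ (K * decay M (p - q)) *
          (C * ((1 + ‖X‖) ^ (M + M) * (decay M q * decay M q))) := by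
          gcongr
          exact h1.trans (by gcongr)
      _ = K * C * (1 + ‖X‖) ^ (M + M) * (decay M q * (decay M q * decay M (p - q))) := by ring
      _ ≤ _ := by gcongr
  refine ⟨(K * C * (1 + ‖X‖) ^ (M + M)) * (K * D * (1 + ‖X‖) ^ (M + M)), fun q p => ?_⟩
  have k1 := key F C hC0 (hC ()) q.1 p.1
  have k2 := key G D hD0 (hD ()) q.2 p.2
  rw [boxKernel, norm_smul, norm_mul, norm_mul, norm_exp_neg_two_I, norm_exp_two_I, one_mul,
    mul_one, hχ, norm_mul]
  refine (mul_le_mul_of_nonneg_left (norm_mul_le _ _) (by positivity)).trans ?_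
  rw [Θ.norm_aut, Θ.norm_aut]
  have := decay_nonneg M q.1
  have := decay_nonneg M p.1
  calc _ = (‖χ₁ (ε • (p.1 - q.1))‖ * ‖F (X - q.1)‖) *
        (‖χ₁ (ε • (p.2 - q.2))‖ * ‖G (X - q.2)‖) := by
        simp only [Prod.smul_fst, Prod.smul_snd, Prod.fst_sub, Prod.snd_sub]
        ring
    _ ≤ (K * C * (1 + ‖X‖) ^ (M + M) * (decay M q.1 * decay M p.1)) *
        (K * D * (1 + ‖X‖) ^ (M + M) * (decay M q.2 * decay M p.2)) := by gcongr
    _ = _ := by ring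

variable [FiniteDimensional ℝ Ξ]

lemma continuous_exp_symp {T : Type*} [TopologicalSpace T] (c : ℂ) {f g : T → Ξ}
    (hf : Continuous f) (hg : Continuous g) :
    Continuous fun t => Complex.exp (c * (σ (f t) (g t) : ℂ)) :=
  Complex.continuous_exp.comp (continuous_const.mul (continuous_symp hf hg))

lemma continuous_boxKernel (χ : 𝓢(Ξ × Ξ, ℂ)) (F G : SchwartzSpace Θ) (X : Ξ) (ε : ℝ) :
    Continuous fun r : (Ξ × Ξ) × Ξ × Ξ => boxKernel σ Θ χ F G X ε r.1 r.2 := by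
  refine Continuous.smul ?_ ((Θ.continuous_aut (by fun_prop) (F.continuous_eval.comp
    (by fun_prop))).mul (Θ.continuous_aut (by fun_prop) (G.continuous_eval.comp (by fun_prop))))
  exact (continuous_exp_symp _ (by fun_prop) (by fun_prop)).mul
    ((χ.continuous.comp (by fun_prop)).mul (continuous_exp_symp _ (by fun_prop) (by fun_prop)))

variable [MeasurableSpace Ξ] [BorelSpace Ξ]

lemma integrable_decay_prod (hσ : σ.Nondegenerate) :
    Integrable (fun p : Ξ × Ξ => decay (Module.finrank ℝ Ξ + 1) p.1 *
      decay (Module.finrank ℝ Ξ + 1) p.2) ((sympMeasure σ).prod (sympMeasure σ)) := by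
  have := isAddHaarMeasure_sympMeasure hσ
  exact (integrable_decay le_rfl).mul_prod (integrable_decay le_rfl)

lemma integrable_boxKernel (hσ : σ.Nondegenerate) {χ₁ : 𝓢(Ξ, ℂ)} {χ : 𝓢(Ξ × Ξ, ℂ)}
    (hχ : ∀ p, χ p = χ₁ p.1 * χ₁ p.2) (F G : SchwartzSpace Θ) (X : Ξ) {ε : ℝ}
    (hε : ε ∈ Set.Ioc (0 : ℝ) 1) :
    Integrable (Function.uncurry (boxKernel σ Θ χ F G X ε))
      (((sympMeasure σ).prod (sympMeasure σ)).prod ((sympMeasure σ).prod (sympMeasure σ))) := by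
  have := isAddHaarMeasure_sympMeasure hσ
  obtain ⟨C, hC⟩ := exists_norm_boxKernel_le (σ := σ) hχ F G X hε (Module.finrank ℝ Ξ + 1)
  exact (((integrable_decay_prod hσ).mul_prod (integrable_decay_prod hσ)).const_mul C).mono'
    (continuous_boxKernel χ F G X ε).aestronglyMeasurable (ae_of_all _ fun r => hC r.1 r.2)

/-- A product of two absolutely convergent integrals. -/
lemma integral_mul_integral (hσ : σ.Nondegenerate) {f g : Ξ → A} (hf : Continuous f)
    (hg : Continuous g) {C D : ℝ} (hC : ∀ Y, ‖f Y‖ ≤ C * decay (Module.finrank ℝ Ξ + 1) Y)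
    (hD : ∀ Y, ‖g Y‖ ≤ D * decay (Module.finrank ℝ Ξ + 1) Y) :
    ∫ q : Ξ × Ξ, f q.1 * g q.2 ∂((sympMeasure σ).prod (sympMeasure σ)) =
      (∫ Y, f Y ∂(sympMeasure σ)) * ∫ Y, g Y ∂(sympMeasure σ) := by
  have := isAddHaarMeasure_sympMeasure hσ
  have i1 : Integrable f (sympMeasure σ) := ((integrable_decay le_rfl).const_mul C).mono'
    hf.aestronglyMeasurable (ae_of_all _ hC)
  have i2 : Integrable g (sympMeasure σ) := ((integrable_decay le_rfl).const_mul D).mono'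
    hg.aestronglyMeasurable (ae_of_all _ hD)
  have i3 : Integrable (fun q : Ξ × Ξ => f q.1 * g q.2)
      ((sympMeasure σ).prod (sympMeasure σ)) := by
    refine ((i1.norm.mul_prod i2.norm)).mono' (by fun_prop) (ae_of_all _ fun q => norm_mul_le _ _)
  rw [integral_prod _ i3, ← integral_mul_const_of_integrable i1]
  congr 1
  funext Y
  exact integral_const_mul_of_integrable (c := f Y) i2

/-- The inner integral of `boxKernel` is a product of two Fourier transforms, since
`σ(C - A, D - B) - σ(A, B) = σ(C, D) - σ(C, B) - σ(A, D)`. -/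
lemma integral_boxKernel (hσ_alt : σ.IsAlt) (hσ : σ.Nondegenerate) {χ₁ : 𝓢(Ξ, ℂ)} {χ : 𝓢(Ξ × Ξ, ℂ)}
    (hχ : ∀ p, χ p = χ₁ p.1 * χ₁ p.2) {F G a b : SchwartzSpace Θ}
    (ha : ∀ X, a X = Θ.aut X (F X)) (hb : ∀ X, b X = Θ.aut X (G X)) (X : Ξ) (ε : ℝ) (p : Ξ × Ξ) :
    ∫ q, boxKernel σ Θ χ F G X ε q p ∂((sympMeasure σ).prod (sympMeasure σ)) =
      Complex.exp (2 * Complex.I * (σ p.1 p.2 : ℂ)) •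
        (Θ.aut (p.1 - X) (cutoffFourier σ χ₁ a X ε p.1 ((-2 : ℝ) • p.2)) *
          Θ.aut (p.2 - X) (cutoffFourier σ χ₁ b X ε p.2 ((2 : ℝ) • p.1))) := by
  have := isAddHaarMeasure_sympMeasure hσ
  have hint : ∀ (c : SchwartzSpace Θ) (Z W V : Ξ), ∃ f : Ξ → A, Continuous f ∧
      (∃ C, ∀ Y, ‖f Y‖ ≤ C * decay (Module.finrank ℝ Ξ + 1) Y) ∧
      (∀ Y, f Y = (Complex.exp (-Complex.I * (σ W Y : ℂ)) * χ₁ (ε • (Z - Y))) •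
        Θ.aut (V - X) (c (X - Y))) ∧
      Θ.aut (V - X) (cutoffFourier σ χ₁ c X ε Z W) = ∫ Y, f Y ∂(sympMeasure σ) := by
    intro c Z W V
    obtain ⟨C, hC0, hC⟩ := exists_norm_eval_le (isBoundedFamily_const (ι := Unit) c)
      (Module.finrank ℝ Ξ + 1)
    obtain ⟨D, hD0, hD⟩ := exists_norm_cutoff_integrand_le (σ := σ) (hC ()) χ₁ X
    have hc := continuous_cutoffFourier_integrand (σ := σ) c.continuous_eval χ₁ X ε Z W
    refine ⟨_, (Θ.autR (V - X)).continuous.comp hc, ⟨D, fun Y => ?_⟩, fun Y => ?_,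
      ((Θ.autR (V - X)).integral_comp_comm (((integrable_decay le_rfl).const_mul D).mono'
        hc.aestronglyMeasurable (ae_of_all _ (hD ε Z W)))).symm⟩
    · exact (Θ.norm_aut _ _).trans_le (hD ε Z W Y)
    · simp only [Function.comp_apply, VectorAction.autR_apply, map_smul, smul_smul]
  obtain ⟨f, hf, ⟨C, hC⟩, hf', ef⟩ := hint a p.1 ((-2 : ℝ) • p.2) p.1
  obtain ⟨g, hg, ⟨D, hD⟩, hg', eg⟩ := hint b p.2 ((2 : ℝ) • p.1) p.2
  rw [ef, eg, ← integral_mul_integral hσ hf hg hC hD, ← integral_smul]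
  congr 1
  funext q
  rw [hf', hg', boxKernel, smul_mul_smul_comm, smul_smul, ha, hb, ← Θ.aut_add, ← Θ.aut_add, hχ]
  have e1 : p.1 - X + (X - q.1) = (p - q).1 := by
    rw [Prod.fst_sub]
    abel
  have e2 : p.2 - X + (X - q.2) = (p - q).2 := by
    rw [Prod.snd_sub]
    abel
  rw [e1, e2]
  congr 1
  simp only [Prod.smul_fst, Prod.smul_snd, Prod.fst_sub, Prod.snd_sub]
  have e3 : Complex.exp (-2 * Complex.I * (σ q.1 q.2 : ℂ)) *
      Complex.exp (2 * Complex.I * (σ (p.1 - q.1) (p.2 - q.2) : ℂ)) =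
      Complex.exp (2 * Complex.I * (σ p.1 p.2 : ℂ)) *
        (Complex.exp (-Complex.I * (σ ((-2 : ℝ) • p.2) q.1 : ℂ)) *
          Complex.exp (-Complex.I * (σ ((2 : ℝ) • p.1) q.2 : ℂ))) := by
    rw [← Complex.exp_add, ← Complex.exp_add, ← Complex.exp_add]
    congr 1
    have h1 := hσ_alt.neg_eq p.2 q.1
    simp only [map_sub, map_smul, LinearMap.sub_apply, LinearMap.smul_apply, smul_eq_mul, ← h1]
    push_cast
    ring
  linear_combination (χ₁ (ε • (p.1 - q.1)) * χ₁ (ε • (p.2 - q.2))) * e3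

/-- The regularization of `F □ G`: the variables of the Rieffel product are shifted by those of `□`,
and the order of integration is changed. -/
lemma integral_regularized_box (hσ : σ.Nondegenerate) {χ₁ : 𝓢(Ξ, ℂ)} {χ : 𝓢(Ξ × Ξ, ℂ)}
    (hχ : ∀ p, χ p = χ₁ p.1 * χ₁ p.2) (F G : SchwartzSpace Θ) (X : Ξ) {ε : ℝ}
    (hε : ε ∈ Set.Ioc (0 : ℝ) 1) :
    ∫ q : Ξ × Ξ, Complex.exp (-2 * Complex.I * (σ q.1 q.2 : ℂ)) •
      ∫ p : Ξ × Ξ, (χ (ε • p) * Complex.exp (2 * Complex.I * (σ p.1 p.2 : ℂ))) •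
        (Θ.aut p.1 (F (X - q.1)) * Θ.aut p.2 (G (X - q.2)))
        ∂((sympMeasure σ).prod (sympMeasure σ)) ∂((sympMeasure σ).prod (sympMeasure σ)) =
      ∫ p, ∫ q, boxKernel σ Θ χ F G X ε q p ∂((sympMeasure σ).prod (sympMeasure σ))
        ∂((sympMeasure σ).prod (sympMeasure σ)) := by
  have := isAddHaarMeasure_sympMeasure hσ
  rw [← integral_integral_swap (integrable_boxKernel hσ hχ F G X hε)]
  congr 1
  funext q
  rw [← integral_sub_right_eq_self _ q, ← integral_smul]
  simp only [boxKernel, smul_smul]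

end SchwartzSpace

end Box

/-! ### The product `□` corresponds to the product `⋄` -/

section BoxDiamond

variable {Ξ A : Type*} [NormedAddCommGroup Ξ] [NormedSpace ℝ Ξ]
  [NonUnitalCStarAlgebra A] {Θ : VectorAction Ξ A} {σ : LinearMap.BilinForm ℝ Ξ}

namespace SchwartzSpace

lemma decay_smul_le (N : ℕ) {c : ℝ} (hc : 1 ≤ |c|) (X : Ξ) : decay N (c • X) ≤ decay N X := by
  unfold decay
  gcongr
  rw [norm_smul, Real.norm_eq_abs]
  exact le_mul_of_one_le_left (norm_nonneg X) hc

/-- The integrand that remains of `F □ G` when the regularization is removed; `α` and `β` stand for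
the images of `F` and `G` under the canonical mapping. -/
def boxLimit (σ : LinearMap.BilinForm ℝ Ξ) (Θ : VectorAction Ξ A) (α β : Ξ → A) (X : Ξ)
    (p : Ξ × Ξ) : A :=
  Complex.exp (2 * Complex.I * (σ p.1 p.2 : ℂ)) •
    (Θ.aut (p.1 - X) (Complex.exp (-Complex.I * (σ ((-2 : ℝ) • p.2) X : ℂ)) •
        α (-((-2 : ℝ) • p.2))) *
      Θ.aut (p.2 - X) (Complex.exp (-Complex.I * (σ ((2 : ℝ) • p.1) X : ℂ)) •
        β (-((2 : ℝ) • p.1))))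

lemma exists_norm_boxLimit_le (α β : SchwartzSpace Θ) (X : Ξ) (N : ℕ) :
    ∃ C, ∀ p : Ξ × Ξ, ‖boxLimit σ Θ α β X p‖ ≤ C * (decay N p.1 * decay N p.2) := by
  obtain ⟨C, hC0, hC⟩ := exists_norm_eval_le (isBoundedFamily_const (ι := Unit) α) N
  obtain ⟨D, hD0, hD⟩ := exists_norm_eval_le (isBoundedFamily_const (ι := Unit) β) N
  refine ⟨C * D, fun p => ?_⟩
  rw [boxLimit, norm_smul, norm_exp_two_I, one_mul]
  refine (norm_mul_le _ _).trans ?_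
  rw [Θ.norm_aut, Θ.norm_aut, norm_smul, norm_smul, Complex.norm_exp_neg_I_mul_ofReal,
    Complex.norm_exp_neg_I_mul_ofReal, one_mul, one_mul]
  have h1 := hC () (-((-2 : ℝ) • p.2))
  have h2 := hD () (-((2 : ℝ) • p.1))
  rw [decay_neg] at h1 h2
  have h3 := decay_smul_le N (c := -2) (by norm_num) p.2
  have h4 := decay_smul_le N (c := 2) (by norm_num) p.1
  have a1 := decay_nonneg N p.2
  calc _ ≤ (C * decay N p.2) * (D * decay N p.1) := by
        gcongr
        · exact h1.trans (by gcongr)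
        · exact h2.trans (by gcongr)
    _ = _ := by ring

/-- The change of variables `W = 2 (D - C)`, `Y = 2 D` leads from the integrand of `⋄` to
`boxLimit`. -/
lemma aut_diamondIntegrand_eq_boxLimit (hσ_alt : σ.IsAlt) (α β : Ξ → A) (X : Ξ) (p : Ξ × Ξ) :
    Complex.exp (-Complex.I * (σ X ((2 : ℝ) • p.2 - (2 : ℝ) • p.1) : ℂ)) •
      Θ.aut (-X) (diamondIntegrand σ Θ α β ((2 : ℝ) • p.2 - (2 : ℝ) • p.1) ((2 : ℝ) • p.2)) =
      boxLimit σ Θ α β X p := by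
  have e1 : -X + (1 / 2 : ℝ) • ((2 : ℝ) • p.2 - ((2 : ℝ) • p.2 - (2 : ℝ) • p.1)) = p.1 - X := by
    module
  have e2 : -X + (1 / 2 : ℝ) • (2 : ℝ) • p.2 = p.2 - X := by module
  have e3 : (2 : ℝ) • p.2 - (2 : ℝ) • p.1 - (2 : ℝ) • p.2 = -((2 : ℝ) • p.1) := by module
  have e4 : -((-2 : ℝ) • p.2) = (2 : ℝ) • p.2 := by module
  rw [aut_diamondIntegrand, boxLimit, e1, e2, e3, e4, map_smul (Θ.aut (p.1 - X)),
    map_smul (Θ.aut (p.2 - X)), smul_mul_smul_comm, smul_smul, smul_smul]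
  congr 1
  rw [cocycle, ← Complex.exp_add, ← Complex.exp_add, ← Complex.exp_add]
  congr 1
  have h1 := hσ_alt.neg_eq p.2 X
  have h2 := hσ_alt.neg_eq p.1 X
  have h3 := hσ_alt p.2
  simp only [map_sub, map_smul, LinearMap.sub_apply, LinearMap.smul_apply, smul_eq_mul, ← h1, ← h2,
    h3]
  push_cast
  ring

variable [FiniteDimensional ℝ Ξ]

lemma continuous_boxLimit (α β : SchwartzSpace Θ) (X : Ξ) : Continuous (boxLimit σ Θ α β X) :=
  (continuous_exp_symp _ (by fun_prop) (by fun_prop)).smul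
    ((Θ.continuous_aut (by fun_prop) ((continuous_exp_symp _ (by fun_prop) (by fun_prop)).smul
      (α.continuous_eval.comp (by fun_prop)))).mul
    (Θ.continuous_aut (by fun_prop) ((continuous_exp_symp _ (by fun_prop) (by fun_prop)).smul
      (β.continuous_eval.comp (by fun_prop)))))

variable [MeasurableSpace Ξ] [BorelSpace Ξ]

lemma integrable_boxLimit (hσ : σ.Nondegenerate) (α β : SchwartzSpace Θ) (X : Ξ) :
    Integrable (boxLimit σ Θ α β X) ((sympMeasure σ).prod (sympMeasure σ)) := by
  have := isAddHaarMeasure_sympMeasure hσ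
  obtain ⟨C, hC⟩ := exists_norm_boxLimit_le (σ := σ) α β X (Module.finrank ℝ Ξ + 1)
  exact ((integrable_decay_prod hσ).const_mul C).mono'
    (continuous_boxLimit α β X).aestronglyMeasurable (ae_of_all _ hC)

/-- The Fourier transforms in `integral_boxKernel` decrease rapidly, uniformly in `ε`, so the
regularization can be removed under the integral. -/
lemma tendsto_integral_boxKernel (hσ_alt : σ.IsAlt) (hσ : σ.Nondegenerate) {χ₁ : 𝓢(Ξ, ℂ)}
    {χ : 𝓢(Ξ × Ξ, ℂ)} (hχ₁ : χ₁ 0 = 1) (hχ : ∀ p, χ p = χ₁ p.1 * χ₁ p.2)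
    {F G a b α β : SchwartzSpace Θ}
    (ha : ∀ X, a X = Θ.aut X (F X)) (hb : ∀ X, b X = Θ.aut X (G X))
    (hα : ∀ X, α X = sympFourier σ a X) (hβ : ∀ X, β X = sympFourier σ b X) (X : Ξ) :
    Tendsto (fun ε => ∫ p, ∫ q, boxKernel σ Θ χ F G X ε q p ∂((sympMeasure σ).prod (sympMeasure σ))
        ∂((sympMeasure σ).prod (sympMeasure σ))) (𝓝[>] 0)
      (𝓝 (∫ p, boxLimit σ Θ α β X p ∂((sympMeasure σ).prod (sympMeasure σ)))) := by
  have := isAddHaarMeasure_sympMeasure hσ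
  set N := Module.finrank ℝ Ξ + 1 with hN
  obtain ⟨C, hC0, hC⟩ := exists_norm_cutoffFourier_le hσ a.isSymbol_eval χ₁ X N
  obtain ⟨D, hD0, hD⟩ := exists_norm_cutoffFourier_le hσ b.isSymbol_eval χ₁ X N
  obtain ⟨C', -, hC'⟩ := exists_norm_eval_le (isBoundedFamily_const (ι := Unit) a) N
  obtain ⟨D', -, hD'⟩ := exists_norm_eval_le (isBoundedFamily_const (ι := Unit) b) N
  refine tendsto_integral_filter_of_dominated_convergence
    (fun p => C * D * (decay N p.1 * decay N p.2)) ?_ ?_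
    ((integrable_decay_prod hσ).const_mul _) (ae_of_all _ fun p => ?_)
  · filter_upwards [Ioc_mem_nhdsGT (zero_lt_one (α := ℝ))] with ε hε
    exact (integrable_boxKernel hσ hχ F G X hε).integral_prod_right.aestronglyMeasurable
  · filter_upwards [Ioc_mem_nhdsGT (zero_lt_one (α := ℝ))] with ε hε
    refine ae_of_all _ fun p => ?_
    rw [integral_boxKernel hσ_alt hσ hχ ha hb, norm_smul, norm_exp_two_I, one_mul]
    refine (norm_mul_le _ _).trans ?_
    rw [Θ.norm_aut, Θ.norm_aut]
    have h3 := decay_smul_le N (c := -2) (by norm_num) p.2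
    have h4 := decay_smul_le N (c := 2) (by norm_num) p.1
    have a1 := decay_nonneg N p.2
    calc _ ≤ (C * decay N p.2) * (D * decay N p.1) := by
          gcongr
          · exact (hC ε hε _ _).trans (by gcongr)
          · exact (hD ε hε _ _).trans (by gcongr)
      _ = _ := by ring
  · simp only [integral_boxKernel hσ_alt hσ hχ ha hb]
    have t1 := tendsto_cutoffFourier hσ a.continuous_eval (hC' ()) hχ₁ X p.1 ((-2 : ℝ) • p.2)
    have t2 := tendsto_cutoffFourier hσ b.continuous_eval (hD' ()) hχ₁ X p.2 ((2 : ℝ) • p.1)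
    have t3 := (((Θ.autR (p.1 - X)).continuous.tendsto _).comp t1).mul
      (((Θ.autR (p.2 - X)).continuous.tendsto _).comp t2)
    have t4 := t3.const_smul (Complex.exp (2 * Complex.I * (σ p.1 p.2 : ℂ)))
    rw [boxLimit, hα, hβ]
    exact t4

/-- The product `□` is absolutely convergent, and given by a double integral over the images of the
factors under the canonical mapping. -/
theorem boxMul_eq_integral_boxLimit (hσ_alt : σ.IsAlt) (hσ : σ.Nondegenerate)
    {F G a b α β : SchwartzSpace Θ}
    (ha : ∀ X, a X = Θ.aut X (F X)) (hb : ∀ X, b X = Θ.aut X (G X))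
    (hα : ∀ X, α X = sympFourier σ a X) (hβ : ∀ X, β X = sympFourier σ b X) (X : Ξ) :
    Integrable (boxIntegrand σ Θ F G X) ((sympMeasure σ).prod (sympMeasure σ)) ∧
    boxMul σ Θ F G X = ((2 : ℂ) ^ Module.finrank ℝ Ξ * (2 : ℂ) ^ Module.finrank ℝ Ξ) •
      ∫ p, boxLimit σ Θ α β X p ∂((sympMeasure σ).prod (sympMeasure σ)) := by
  have := isAddHaarMeasure_sympMeasure hσ
  set N := Module.finrank ℝ Ξ + 1 with hN
  obtain ⟨I, hI, ⟨K, hK⟩, hlim⟩ := exists_rieffelMul_bounds hσ F G N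
  obtain ⟨χ₁, χ, hχ₁, hχ0, hχ⟩ := exists_cutoff Ξ
  obtain ⟨K', hK'⟩ := hlim χ hχ0
  have hr : ∀ q : Ξ × Ξ, rieffelMul σ Θ (F q.1) (G q.2) = (2 : ℂ) ^ Module.finrank ℝ Ξ • I q :=
    fun q => by rw [rieffelMul, (hI q).oscIntegral_eq]
  -- the regularization `R ε` of the integrand of `□`, and its limit `L`
  let R : ℝ → Ξ × Ξ → A := fun ε q => Complex.exp (-2 * Complex.I * (σ q.1 q.2 : ℂ)) •
      ∫ p : Ξ × Ξ, (χ (ε • p) * Complex.exp (2 * Complex.I * (σ p.1 p.2 : ℂ))) •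
        (Θ.aut p.1 (F (X - q.1)) * Θ.aut p.2 (G (X - q.2)))
        ∂((sympMeasure σ).prod (sympMeasure σ))
  let L : Ξ × Ξ → A := fun q => Complex.exp (-2 * Complex.I * (σ q.1 q.2 : ℂ)) •
    I (X - q.1, X - q.2)
  have hw : Integrable (fun q : Ξ × Ξ => decay N (X - q.1) * decay N (X - q.2))
      ((sympMeasure σ).prod (sympMeasure σ)) :=
    ((integrable_decay le_rfl).comp_sub_left X).mul_prod ((integrable_decay le_rfl).comp_sub_left X)
  have hRm : ∀ ε, AEStronglyMeasurable (R ε) ((sympMeasure σ).prod (sympMeasure σ)) := by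
    intro ε
    refine (continuous_exp_symp _ continuous_fst continuous_snd).aestronglyMeasurable.smul ?_
    have hc : Continuous fun r : (Ξ × Ξ) × Ξ × Ξ =>
        (χ (ε • r.2) * Complex.exp (2 * Complex.I * (σ r.2.1 r.2.2 : ℂ))) •
        (Θ.aut r.2.1 (F (X - r.1.1)) * Θ.aut r.2.2 (G (X - r.1.2))) :=
      ((χ.continuous.comp (by fun_prop)).mul
        (continuous_exp_symp _ (by fun_prop) (by fun_prop))).smul
        ((Θ.continuous_aut (by fun_prop) (F.continuous_eval.comp (by fun_prop))).mul
          (Θ.continuous_aut (by fun_prop) (G.continuous_eval.comp (by fun_prop))))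
    exact hc.aestronglyMeasurable.integral_prod_right'
  have hRL : ∀ q, Tendsto (fun ε => R ε q) (𝓝[>] 0) (𝓝 (L q)) := fun q =>
    (tendsto_of_norm_sub_le_mul (hK' (X - q.1, X - q.2))).const_smul
      (Complex.exp (-2 * Complex.I * (σ q.1 q.2 : ℂ)))
  have hLn : ∀ q, ‖L q‖ ≤ K * (decay N (X - q.1) * decay N (X - q.2)) := by
    intro q
    rw [norm_smul, norm_exp_neg_two_I, one_mul]
    exact hK (X - q.1, X - q.2)
  have hRn : ∀ ε ∈ Set.Ioc (0 : ℝ) 1, ∀ q,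
      ‖R ε q‖ ≤ (|K| + |K'|) * (decay N (X - q.1) * decay N (X - q.2)) := by
    intro ε hε q
    rw [norm_smul, norm_exp_neg_two_I, one_mul]
    have h0 : 0 ≤ decay N (X - q.1) * decay N (X - q.2) :=
      mul_nonneg (decay_nonneg N _) (decay_nonneg N _)
    have h1 := hK (X - q.1, X - q.2)
    have h2 := hK' (X - q.1, X - q.2) ε hε
    have h3 : K' * (decay N (X - q.1) * decay N (X - q.2)) * ε ≤
        |K'| * (decay N (X - q.1) * decay N (X - q.2)) * 1 := by
      gcongr
      · exact hε.1.le
      · exact le_abs_self K'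
      · exact hε.2
    have h4 : K * (decay N (X - q.1) * decay N (X - q.2)) ≤
        |K| * (decay N (X - q.1) * decay N (X - q.2)) := by
      gcongr
      exact le_abs_self K
    refine (norm_le_norm_sub_add _ (I (X - q.1, X - q.2))).trans ?_
    simp only at h1 h2
    linarith
  have hLm : AEStronglyMeasurable L ((sympMeasure σ).prod (sympMeasure σ)) :=
    aestronglyMeasurable_of_tendsto_ae (𝓝[>] (0 : ℝ)) hRm (ae_of_all _ hRL)
  have hLi : Integrable L ((sympMeasure σ).prod (sympMeasure σ)) :=
    (hw.const_mul K).mono' hLm (ae_of_all _ hLn)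
  have hbox : boxIntegrand σ Θ F G X = fun q => (2 : ℂ) ^ Module.finrank ℝ Ξ • L q := by
    funext q
    rw [boxIntegrand, hr (X - q.1, X - q.2), smul_comm]
  have hlimR : Tendsto (fun ε => ∫ q, R ε q ∂((sympMeasure σ).prod (sympMeasure σ))) (𝓝[>] 0)
      (𝓝 (∫ q, L q ∂((sympMeasure σ).prod (sympMeasure σ)))) := by
    refine tendsto_integral_filter_of_dominated_convergence _ (Eventually.of_forall hRm) ?_
      (hw.const_mul (|K| + |K'|)) (ae_of_all _ hRL)
    filter_upwards [Ioc_mem_nhdsGT (zero_lt_one (α := ℝ))] with ε hε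
    exact ae_of_all _ (hRn ε hε)
  have hlimB := tendsto_integral_boxKernel hσ_alt hσ hχ₁ hχ ha hb hα hβ X
  have hval : ∫ q, L q ∂((sympMeasure σ).prod (sympMeasure σ)) =
      ∫ p, boxLimit σ Θ α β X p ∂((sympMeasure σ).prod (sympMeasure σ)) := by
    refine tendsto_nhds_unique hlimR (hlimB.congr' ?_)
    filter_upwards [Ioc_mem_nhdsGT (zero_lt_one (α := ℝ))] with ε hε
    exact (integral_regularized_box hσ hχ F G X hε).symm
  constructor
  · rw [hbox]
    exact hLi.smul ((2 : ℂ) ^ Module.finrank ℝ Ξ)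
  · rw [boxMul, hbox, integral_smul, smul_smul, hval]

/-- The double integral `boxLimit` is the inverse canonical mapping of a product `⋄`. -/
theorem canonicalMapInv_diamondMul (hσ_alt : σ.IsAlt) (hσ : σ.Nondegenerate)
    (α β : SchwartzSpace Θ) (X : Ξ) :
    canonicalMapInv σ Θ (diamondMul σ Θ α β) X =
      ((2 : ℂ) ^ Module.finrank ℝ Ξ * (2 : ℂ) ^ Module.finrank ℝ Ξ) •
      ∫ p, boxLimit σ Θ α β X p ∂((sympMeasure σ).prod (sympMeasure σ)) := by
  have := isAddHaarMeasure_sympMeasure hσ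
  let Ψ : Ξ → Ξ → A := fun W Y => Complex.exp (-Complex.I * (σ X W : ℂ)) •
    Θ.aut (-X) (diamondIntegrand σ Θ α β W Y)
  have hΨc : Continuous (Function.uncurry Ψ) :=
    (continuous_exp_symp _ continuous_const continuous_fst).smul
      (Θ.continuous_aut continuous_const (continuous_diamondIntegrand α β))
  obtain ⟨C, hC0, hC⟩ := (isSymbol_diamondIntegrand (σ := σ)
    (isBoundedFamily_const (ι := Unit) α) (isBoundedFamily_const β)
    (Module.finrank ℝ Ξ + 1) (Module.finrank ℝ Ξ + 1)).norm_le
  have hΨi : Integrable (Function.uncurry Ψ) ((sympMeasure σ).prod (sympMeasure σ)) := by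
    refine ((integrable_decay_prod hσ).const_mul C).mono' hΨc.aestronglyMeasurable
      (ae_of_all _ fun r => ?_)
    rw [Function.uncurry, norm_smul, Complex.norm_exp_neg_I_mul_ofReal, one_mul]
    exact hC () ((r.1, -X), r.2)
  -- the two scalings by `2` produce the factor `2 ^ (2 dim Ξ)` of `□`
  have hscale : ∀ f : Ξ → A, ∫ Y, f Y ∂(sympMeasure σ) =
      (2 : ℂ) ^ Module.finrank ℝ Ξ • ∫ Y, f ((2 : ℝ) • Y) ∂(sympMeasure σ) := by
    intro f
    rw [Measure.integral_comp_smul, ← Complex.coe_smul, smul_smul]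
    have h2 : ((2 : ℝ) ^ Module.finrank ℝ Ξ) ≠ 0 := by positivity
    rw [abs_of_pos (by positivity), Complex.ofReal_inv, Complex.ofReal_pow, Complex.ofReal_ofNat,
      mul_inv_cancel₀ (by exact_mod_cast h2), one_smul]
  calc canonicalMapInv σ Θ (diamondMul σ Θ α β) X
      = ∫ W, ∫ Y, Ψ W Y ∂(sympMeasure σ) ∂(sympMeasure σ) := by
        rw [canonicalMapInv]
        congr 1
        funext W
        rw [aut_diamondMul hσ, ← integral_smul]
    _ = ∫ Y, ∫ W, Ψ W Y ∂(sympMeasure σ) ∂(sympMeasure σ) := integral_integral_swap hΨi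
    _ = ∫ Y, (2 : ℂ) ^ Module.finrank ℝ Ξ •
          ∫ Z, Ψ (Y - (2 : ℝ) • Z) Y ∂(sympMeasure σ) ∂(sympMeasure σ) := by
        congr 1
        funext Y
        rw [← integral_sub_left_eq_self _ _ Y, hscale]
    _ = (2 : ℂ) ^ Module.finrank ℝ Ξ • (2 : ℂ) ^ Module.finrank ℝ Ξ •
          ∫ Y, ∫ Z, Ψ ((2 : ℝ) • Y - (2 : ℝ) • Z) ((2 : ℝ) • Y)
            ∂(sympMeasure σ) ∂(sympMeasure σ) := by
        rw [integral_smul, hscale]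
    _ = _ := by
        rw [smul_smul, integral_prod_symm _ (integrable_boxLimit hσ α β X)]
        congr 2
        funext Y
        congr 1
        funext Z
        exact aut_diamondIntegrand_eq_boxLimit hσ_alt α β X (Z, Y)

end SchwartzSpace

end BoxDiamond

/-! ### The Fréchet `*`-algebras -/

section Algebras

/-- The structure of a Fréchet `*`-algebra can be transported along a linear homeomorphism. -/
lemma IsFrechetStarAlgebra.transport {V : Type*} [AddCommGroup V] [Module ℂ V] [TopologicalSpace V]
    {mul mul' : V → V → V} {inv inv' : V → V} (h : IsFrechetStarAlgebra V mul inv) (M : V ≃L[ℂ] V)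
    (hmul : ∀ a b, M (mul' a b) = mul (M a) (M b)) (hinv : ∀ a, M (inv' a) = inv (M a)) :
    IsFrechetStarAlgebra V mul' inv' where
  isFrechetSpace := h.isFrechetSpace
  add_mul a b c := M.injective (by simp only [hmul, map_add, h.add_mul])
  mul_add a b c := M.injective (by simp only [hmul, map_add, h.mul_add])
  smul_mul z a b := M.injective (by simp only [hmul, map_smul, h.smul_mul])
  mul_smul z a b := M.injective (by simp only [hmul, map_smul, h.mul_smul])
  mul_assoc a b c := M.injective (by simp only [hmul, h.mul_assoc])
  continuous_mul := by
    have e : (fun p : V × V => mul' p.1 p.2) = fun p => M.symm (mul (M p.1) (M p.2)) := by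
      funext p
      rw [← hmul, M.symm_apply_apply]
    rw [e]
    exact M.symm.continuous.comp (h.continuous_mul.comp
      ((M.continuous.comp continuous_fst).prodMk (M.continuous.comp continuous_snd)))
  inv_add a b := M.injective (by simp only [hinv, map_add, h.inv_add])
  inv_smul z a := M.injective (by simp only [hinv, map_smul, h.inv_smul])
  inv_inv a := M.injective (by simp only [hinv, h.inv_inv])
  inv_mul a b := M.injective (by simp only [hinv, hmul, h.inv_mul])
  continuous_inv := by
    have e : inv' = fun a => M.symm (inv (M a)) := by
      funext a
      rw [← hinv, M.symm_apply_apply]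
    rw [e]
    exact M.symm.continuous.comp (h.continuous_inv.comp M.continuous)

variable {Ξ A : Type*} [NormedAddCommGroup Ξ] [NormedSpace ℝ Ξ] [FiniteDimensional ℝ Ξ]
  [MeasurableSpace Ξ] [BorelSpace Ξ]
  [NonUnitalCStarAlgebra A] {Θ : VectorAction Ξ A} {σ : LinearMap.BilinForm ℝ Ξ}

namespace SchwartzSpace

/-- The Fréchet `*`-algebra `(𝒮(Ξ; A^∞), ⋄, ^⋄)`. -/
theorem exists_diamond_algebra (hσ_alt : σ.IsAlt) (hσ : σ.Nondegenerate) :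
    ∃ (dia : SchwartzSpace Θ → SchwartzSpace Θ → SchwartzSpace Θ)
      (diaSt : SchwartzSpace Θ → SchwartzSpace Θ),
      (∀ F G X, dia F G X = diamondMul σ Θ F G X) ∧ (∀ F X, diaSt F X = diamondStar F X) ∧
      IsFrechetStarAlgebra (SchwartzSpace Θ) dia diaSt := by
  obtain ⟨T, hT, hTc⟩ := exists_diamond (Θ := Θ) hσ
  obtain ⟨R, hR⟩ := exists_reflection Θ
  obtain ⟨S, hSc, hS⟩ := exists_star Θ
  have hst : ∀ F X, R (S F) X = diamondStar F X := fun F X => by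
    rw [hR, hS]
    rfl
  refine ⟨fun F G => T F G, fun F => R (S F), hT, hst,
    { isFrechetSpace := isFrechetSpace
      add_mul := fun F G H => by simp only [map_add, LinearMap.add_apply]
      mul_add := fun F G H => map_add _ _ _
      smul_mul := fun z F G => by simp only [map_smul, LinearMap.smul_apply]
      mul_smul := fun z F G => map_smul _ _ _
      mul_assoc := fun F G H => ext_eval fun X => ?_
      continuous_mul := hTc
      inv_add := fun F G => ext_eval fun X => ?_
      inv_smul := fun z F => ext_eval fun X => ?_
      inv_inv := fun F => ext_eval fun X => ?_
      inv_mul := fun F G => ext_eval fun X => ?_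
      continuous_inv := R.continuous.comp hSc }⟩
  · rw [hT, hT]
    exact diamondMul_assoc hσ_alt hσ F G H _ _ (hT F G) (hT G H) X
  · simp only [add_eval, hst, diamondStar, star_add]
  · simp only [smul_eval, hst, diamondStar, star_smul]
    rfl
  · simp only [hst, diamondStar, neg_neg, star_star]
  · rw [hst, hT]
    have e : ((T F G : SchwartzSpace Θ) : Ξ → A) = diamondMul σ Θ F G := funext (hT F G)
    have eF : ((R (S F) : SchwartzSpace Θ) : Ξ → A) = diamondStar F := funext (hst F)
    have eG : ((R (S G) : SchwartzSpace Θ) : Ξ → A) = diamondStar G := funext (hst G)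
    rw [e, eF, eG]
    exact diamondMul_star hσ_alt hσ F G X

/-- The canonical mapping intertwines the products `□` and `⋄`. -/
theorem boxMul_eq_canonicalMapInv (hσ_alt : σ.IsAlt) (hσ : σ.Nondegenerate)
    {F G α β : SchwartzSpace Θ} (hα : ∀ X, α X = canonicalMap σ Θ F X)
    (hβ : ∀ X, β X = canonicalMap σ Θ G X) (X : Ξ) :
    Integrable (boxIntegrand σ Θ F G X) ((sympMeasure σ).prod (sympMeasure σ)) ∧
      boxMul σ Θ F G X = canonicalMapInv σ Θ (diamondMul σ Θ α β) X := by
  obtain ⟨C, hC, -⟩ := exists_twist Θ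
  have e : ∀ F, (C F : Ξ → A) = twist Θ F := fun F => funext (hC F)
  rw [canonicalMapInv_diamondMul hσ_alt hσ]
  refine boxMul_eq_integral_boxLimit hσ_alt hσ (hC F) (hC G) (fun Y => ?_) (fun Y => ?_) X
  · rw [hα, e]
    rfl
  · rw [hβ, e]
    rfl

end SchwartzSpace

end Algebras

end RieffelCrossed

end

open RieffelCrossed RieffelCrossed.SchwartzSpace

theorem mainTheorem2 {Ξ A : Type*} [NormedAddCommGroup Ξ] [NormedSpace ℝ Ξ]
    [FiniteDimensional ℝ Ξ] [MeasurableSpace Ξ] [BorelSpace Ξ] [NonUnitalCStarAlgebra A]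
    (σ : LinearMap.BilinForm ℝ Ξ) (hσ_alt : σ.IsAlt) (hσ_nondeg : σ.Nondegenerate)
    (Θ : RieffelCrossed.VectorAction Ξ A) :
    -- the (oscillatory and absolutely convergent) integrals in the definitions exist
    (∀ f ∈ RieffelCrossed.smoothVectors Θ, ∀ g ∈ RieffelCrossed.smoothVectors Θ,
      (∃ L, RieffelCrossed.HasOscIntegral σ (fun p => Θ.aut p.1 f * Θ.aut p.2 g) L) ∧
        RieffelCrossed.rieffelMul σ Θ f g ∈ RieffelCrossed.smoothVectors Θ) ∧
    (∀ (F G : RieffelCrossed.SchwartzSpace Θ) (X : Ξ),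
      Integrable (RieffelCrossed.boxIntegrand σ Θ F G X)
        ((RieffelCrossed.sympMeasure σ).prod (RieffelCrossed.sympMeasure σ)) ∧
      Integrable (RieffelCrossed.diamondIntegrand σ Θ F G X) (RieffelCrossed.sympMeasure σ) ∧
      Integrable (RieffelCrossed.twist Θ F) (RieffelCrossed.sympMeasure σ) ∧
      Integrable F (RieffelCrossed.sympMeasure σ)) ∧
    -- `□`, `^□`, `⋄`, `^⋄`, `M` as operations on the Schwartz space
    ∃ (box dia : RieffelCrossed.SchwartzSpace Θ → RieffelCrossed.SchwartzSpace Θ →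
          RieffelCrossed.SchwartzSpace Θ)
      (boxSt diaSt : RieffelCrossed.SchwartzSpace Θ → RieffelCrossed.SchwartzSpace Θ)
      (M : RieffelCrossed.SchwartzSpace Θ ≃L[ℂ] RieffelCrossed.SchwartzSpace Θ),
      (∀ F G X, box F G X = RieffelCrossed.boxMul σ Θ F G X) ∧
      (∀ F X, boxSt F X = RieffelCrossed.boxStar F X) ∧
      (∀ F G X, dia F G X = RieffelCrossed.diamondMul σ Θ F G X) ∧
      (∀ F X, diaSt F X = RieffelCrossed.diamondStar F X) ∧
      (∀ F X, M F X = RieffelCrossed.canonicalMap σ Θ F X) ∧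
      (∀ G X, M.symm G X = RieffelCrossed.canonicalMapInv σ Θ G X) ∧
      RieffelCrossed.IsFrechetStarAlgebra (RieffelCrossed.SchwartzSpace Θ) box boxSt ∧
      RieffelCrossed.IsFrechetStarAlgebra (RieffelCrossed.SchwartzSpace Θ) dia diaSt ∧
      (∀ F G, M (box F G) = dia (M F) (M G)) ∧
      (∀ F, M (boxSt F) = diaSt (M F)) := by
  obtain ⟨M, hM, hM'⟩ := exists_canonicalMap (Θ := Θ) hσ_alt hσ_nondeg
  obtain ⟨dia, diaSt, hdia, hdiaSt, hD⟩ := exists_diamond_algebra (Θ := Θ) hσ_alt hσ_nondeg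
  obtain ⟨S, -, hS⟩ := exists_star Θ
  have hbox := fun F G : SchwartzSpace Θ =>
    boxMul_eq_canonicalMapInv hσ_alt hσ_nondeg (hM F) (hM G)
  have hMS : ∀ F, M (S F) = diaSt (M F) := fun F => ext_eval fun X => by
    have e1 : (S F : Ξ → A) = boxStar F := funext (hS F)
    have e2 : (M F : Ξ → A) = canonicalMap σ Θ F := funext (hM F)
    rw [hM, hdiaSt, e1, e2, canonicalMap_star]
  have hMm : ∀ F G, M (M.symm (dia (M F) (M G))) = dia (M F) (M G) := fun F G =>
    M.apply_symm_apply _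
  have := isAddHaarMeasure_sympMeasure hσ_nondeg
  refine ⟨fun f hf g hg => rieffelMul_mem hσ_nondeg hf hg, fun F G X =>
    ⟨(hbox F G X).1, integrable_diamondIntegrand hσ_nondeg F G X, integrable_twist hσ_nondeg F,
      integrable_eval F⟩, fun F G => M.symm (dia (M F) (M G)), dia, S, diaSt, M, fun F G X => ?_,
    hS, hdia, hdiaSt, hM, hM', hD.transport M hMm hMS, hD, hMm, hMS⟩
  have e : (dia (M F) (M G) : Ξ → A) = diamondMul σ Θ (M F) (M G) := funext (hdia _ _)
  rw [hM', e, (hbox F G X).2]
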